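/- **Setting.** Let $D\subset\mathbb R^d$ be a domain (non-empty, open, connected) and let $$Au(x)=\tfrac12{\rm Tr}\big({\bf Q}(x)\nabla^2u(x)\big)+b(x)\cdot\nabla u(x)+\int_{\mathbb R^d}\Big(u(x+y)-u(x)-\frac{y\cdot\nabla u(x)}{1+|y|^2}\Big)N(x,dy),$$ with coefficients given on $\mathbb R^d$, where the entries of ${\bf Q}$ and $b$ are bounded and Borel on $D$, ${\bf Q}(x)$ is non-negative definite for $x\in D$, and $N$ is a Lévy kernel with $N(x,\{0\})=0$ and $\sup_{x\in\mathbb R^d}\int\min\{1,|y|^2\}N(x,dy)<\infty$. Put $\mathcal S(D)=\bigcup_{x\in D}\big(x+{\rm supp}\,N(x,\cdot)\big)$, $\partial_SD=\partial D\cup(\mathcal S(D)\setminus D)$, $D_S=D\cup\partial_SD$, and $\bar u_{D_S}=\sup_{D_S}u$. Let $(P_x)_{x\in\mathbb R^d}$ be a strong Markovian solution of the martingale problem for $A$ on the space of càdlàg paths in $\mathbb R^d$ (test functions: $C^2$, bounded with their first two derivatives), $X$ the canonical process, $\tau_D=\inf\{t>0:X_t\notin D\}$, and suppose that $P_x[\tau_D<\infty]=1$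 for $x\in D$. Put $P^D_tf(x)=\mathbb E_x[f(X_t),\,t<\tau_D]$ and $R^D_\alpha f=\int_0^\infty e^{-\alpha t}P^D_tf\,dt$. For Borel $g\le0$ on $D$ and a non-negative bounded Borel function $c$ on $D$, let $e_c(t)=\exp\{-\int_0^tc(X_r)dr\}$ and let $\mathcal U_c(g)$ be the set of weak subsolutions of $(-A+c)v=g$ in $D$, i.e. of the bounded Borel functions $u$ on $\mathbb R^d$ with $$u(x)\le\mathbb E_x\big[e_c(\tau_D\wedge t)u(X_{\tau_D\wedge t})\big]+\mathbb E_x\Big[\int_0^{\tau_D\wedge t}e_c(r)g(X_r)\,dr\Big],\qquad x\in D,\ t\ge0 .$$ Let $m$ be a finite Borel measure on $D$ such that $P^D_tf(x)=\int_Dp_D(t,x,y)f(y)\,m(dy)$ for all $x\in D$, $t>0$ and bounded Borel $f$, where for each $t>0$ the function $p_D(t,\cdot,\cdot)$ is bounded, continuous and strictly positive on $D\times D$; let $\hat P^D_tf(x)=\int_Dp_D(t,y,x)f(y)\,m(dy)$ be sub-Markovian too, and suppose that both families extend to strongly continuous semigroups on $L^2(D,m)$. Let $\lambda_D>0$ be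 the principal eigenvalue and $\varphi_D,\hat\varphi_D:D\to(0,\infty)$ the bounded continuous eigenfunctions, $P^D_t\varphi_D=e^{-\lambda_Dt}\varphi_D$ and $\hat P^D_t\hat\varphi_D=e^{-\lambda_Dt}\hat\varphi_D$ for $t>0$, with $\int_D\varphi_D\,dm=\int_D\hat\varphi_D\,dm=1$. Assume that $(P^D_t)$ is *intrinsically ultracontractive*: for each $t>0$ there is $c_t>0$ with $p_D(t,x,y)\le c_t\varphi_D(x)\hat\varphi_D(y)$ for all $x,y\in D$. **Corollary 5.2.** Under these assumptions: 1. There is a continuous $\tilde c:(0,\infty)\to(0,\infty)$ with $p_D(t,x,y)\ge\tilde c(t)\varphi_D(x)\hat\varphi_D(y)$ for all $t>0$ and $x,y\in D$. For every such $\tilde c$ and every $\alpha>0$ the condition $M'(\alpha,\nu^\alpha_D)$ holds with $\nu^\alpha_D(dx)=\big(\int_0^\infty\tilde c(a)e^{-\alpha a}da\big)\hat\varphi_D(x)\,m(dx)$; that is, $\nu^\alpha_D$ is a non-trivial measure on $D$, $\varphi_D$ is a non-negative eigenfunction with eigenvalue $\lambda_D\ge 0$ (i.e. $P^D_t\varphi_D=e^{-\lambda_Dt}\varphi_D$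 on $D$ for $t\ge0$ and $\int_D\varphi_D\,dm>0$), and $$R^D_\alpha f(x)\ge\varphi_D(x)\int_Df\,d\nu^\alpha_D,\qquad x\in D,$$ for all non-negative bounded Borel $f$ on $D$. Moreover $m\ll\nu^\alpha_D$. 2. ($\varphi_D$-Hopf lemma) Let $c$ be a non-negative bounded Borel function on $D$, let $g\le 0$ be Borel on $D$, and let $u\in\mathcal U_c(g)$ with $\bar u_{D_S}\ge0$ be non-constant $m$-a.e. in $D$. Then there is $a>0$ with $\bar u_{D_S}-u(x)\ge a\,\varphi_D(x)$ for all $x\in D$. 3. (Quantitative $\varphi_D$-Hopf lemma) Let $c$ be a non-negative bounded Borel function on $D$ with $\int_Dc\,dm>0$. Then there is $a>0$ such that for every Borel $g\le0$ on $D$ and every $u\in\mathcal U_c(g)$, $\bar u_{D_S}-u(x)\ge a\,\bar u_{D_S}\,\varphi_D(x)$ for all $x\in D$. -/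

import Mathlib

open MeasureTheory ProbabilityTheory Set Filter Topology
open scoped NNReal ENNReal

noncomputable section

/-! Euclidean space and the canonical path space. -/

/-- The Euclidean space `ℝ^d`. -/
abbrev Euc (d : ℕ) : Type := EuclideanSpace ℝ (Fin d)

/-- Right continuous with left limits at every time. -/
def IsCadlag {d : ℕ} (ω : ℝ≥0 → Euc d) : Prop :=
  ∀ t, ContinuousWithinAt ω (Ici t) t ∧ ∃ l, Tendsto ω (𝓝[<] t) (𝓝 l)

/-- The space of càdlàg paths in `ℝ^d`. Its σ-algebra (inherited from the product) is the one
generated by the coordinates, i.e. the Borel σ-algebra of the Skorokhod topology. -/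
abbrev CadlagPath (d : ℕ) : Type := {ω : ℝ≥0 → Euc d // IsCadlag ω}

/-- The canonical process. -/
def coordProc {d : ℕ} (t : ℝ≥0) (ω : CadlagPath d) : Euc d := ω.1 t

theorem measurable_coordProc {d : ℕ} (t : ℝ≥0) :
    Measurable (coordProc t : CadlagPath d → Euc d) :=
  (measurable_pi_apply t).comp measurable_subtype_coe

/-- The natural filtration of the canonical process. -/
def natFiltration (d : ℕ) :
    Filtration ℝ≥0 (inferInstance : MeasurableSpace (CadlagPath d)) :=
  Filtration.natural (fun t ω => coordProc t ω)
    (fun t => (measurable_coordProc t).stronglyMeasurable)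

theorem IsCadlag.shift {d : ℕ} {ω : ℝ≥0 → Euc d} (h : IsCadlag ω) (t : ℝ≥0) :
    IsCadlag (fun s => ω (t + s)) := by
  intro s
  obtain ⟨h1, l, hl⟩ := h (t + s)
  have hc : Continuous (fun r : ℝ≥0 => t + r) := by fun_prop
  refine ⟨?_, l, ?_⟩
  · exact ContinuousWithinAt.comp (f := fun r : ℝ≥0 => t + r) h1 hc.continuousWithinAt
      (fun r hr => add_le_add_right (mem_Ici.1 hr) t)
  · refine hl.comp (tendsto_nhdsWithin_iff.2 ⟨(hc.tendsto s).mono_left nhdsWithin_le_nhds, ?_⟩)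
    filter_upwards [self_mem_nhdsWithin] with r hr
    exact add_lt_add_right (mem_Iio.1 hr) t

/-- The shift `θ_t`. -/
def shiftPath {d : ℕ} (t : ℝ≥0) (ω : CadlagPath d) : CadlagPath d :=
  ⟨fun s => ω.1 (t + s), ω.2.shift t⟩

/-! Coefficients, the operator, and the extended boundary. -/

/-- `f` restricted to `D` is a bounded Borel function on `D`. -/
def IsBddBorelOn {d : ℕ} (D : Set (Euc d)) (f : Euc d → ℝ) : Prop :=
  Measurable (D.domRestrict f) ∧ ∃ C : ℝ, ∀ x ∈ D, |f x| ≤ C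

/-- The diffusion matrix and the drift are bounded and Borel on `D`, and the matrix is
non-negative definite there. -/
def DiffusionDriftCondition {d : ℕ} (D : Set (Euc d))
    (Q : Euc d → Matrix (Fin d) (Fin d) ℝ) (b : Euc d → Euc d) : Prop :=
  (∀ i j, IsBddBorelOn D (fun x => Q x i j)) ∧
  (∀ i, IsBddBorelOn D (fun x => b x i)) ∧
  ∀ x ∈ D, ∀ ξ : Fin d → ℝ, 0 ≤ ∑ i, ∑ j, Q x i j * ξ i * ξ j

/-- The Lévy kernel does not charge the origin and
`sup_x ∫ min(1, |y|²) N(x, dy) < ∞` (this makes each `N(x, ·)` σ-finite). -/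
def LevyKernelCondition {d : ℕ} (N : Kernel (Euc d) (Euc d)) : Prop :=
  (∀ x, N x {0} = 0) ∧
  ∃ C : ℝ≥0, ∀ x, ∫⁻ y, ENNReal.ofReal (min 1 (‖y‖ ^ 2)) ∂(N x) ≤ C

/-- `C²` functions that are bounded together with their first two derivatives. -/
def IsCb2 {d : ℕ} (f : Euc d → ℝ) : Prop :=
  ContDiff ℝ 2 f ∧
  ∃ C : ℝ, ∀ x, |f x| ≤ C ∧ ‖fderiv ℝ f x‖ ≤ C ∧ ‖iteratedFDeriv ℝ 2 f x‖ ≤ C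

/-- The integro-differential operator
`A f(x) = ½ Tr(Q(x) ∇²f(x)) + b(x)·∇f(x)
  + ∫ (f(x+y) - f(x) - y·∇f(x)/(1+|y|²)) N(x,dy)`. -/
def levyOperator {d : ℕ} (Q : Euc d → Matrix (Fin d) (Fin d) ℝ) (b : Euc d → Euc d)
    (N : Kernel (Euc d) (Euc d)) (f : Euc d → ℝ) (x : Euc d) : ℝ :=
  (1 / 2 : ℝ) * ∑ i, ∑ j, Q x i j *
      iteratedFDeriv ℝ 2 f x ![EuclideanSpace.single i 1, EuclideanSpace.single j 1]
    + fderiv ℝ f x (b x)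
    + ∫ y, (f (x + y) - f x - fderiv ℝ f x y / (1 + ‖y‖ ^ 2)) ∂(N x)

/-- The range of non-locality `𝒮(D) = ⋃_{x ∈ D} (x + supp N(x,·))`. -/
def nonlocalRange {d : ℕ} (N : Kernel (Euc d) (Euc d)) (D : Set (Euc d)) : Set (Euc d) :=
  ⋃ x ∈ D, (fun y => x + y) '' (N x).support

/-- The extended boundary `∂_S D = ∂D ∪ (𝒮(D) \ D)`. -/
def extBoundary {d : ℕ} (N : Kernel (Euc d) (Euc d)) (D : Set (Euc d)) : Set (Euc d) :=
  frontier D ∪ (nonlocalRange N D \ D)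

/-- `D_S = ∂_S D ∪ D`. -/
def extDomain {d : ℕ} (N : Kernel (Euc d) (Euc d)) (D : Set (Euc d)) : Set (Euc d) :=
  extBoundary N D ∪ D

/-! The martingale problem. -/

/-- `P` is a solution of the martingale problem for the operator with coefficients `Q, b, N` and
initial law `μ`. The first part of `mart` says that the time integral in the second part makes
sense along almost every path. -/
structure IsMartingaleSolution {d : ℕ} (Q : Euc d → Matrix (Fin d) (Fin d) ℝ)
    (b : Euc d → Euc d) (N : Kernel (Euc d) (Euc d)) (μ : Measure (Euc d))
    (P : Measure (CadlagPath d)) : Prop where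
  prob : IsProbabilityMeasure P
  init : P.map (coordProc 0) = μ
  mart : ∀ f : Euc d → ℝ, IsCb2 f →
    (∀ᵐ ω ∂P, ∀ t : ℝ≥0, IntervalIntegrable
      (fun r : ℝ => levyOperator Q b N f (coordProc r.toNNReal ω)) volume 0 t) ∧
    Martingale (fun (t : ℝ≥0) (ω : CadlagPath d) =>
      f (coordProc t ω) - f (coordProc 0 ω)
        - ∫ r in (0 : ℝ)..t, levyOperator Q b N f (coordProc r.toNNReal ω))
      (natFiltration d) P

/-- The canonical process is strongly Markovian for the natural filtration and the family `P`:
for every stopping time `τ`, on `{τ < ∞}` the conditional law of `θ_τ` given `𝓕_τ` under `P_x`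
is `P_{X_τ}`. -/
def IsStrongMarkovFamily {d : ℕ} (P : Kernel (Euc d) (CadlagPath d)) : Prop :=
  ∀ (τ : CadlagPath d → WithTop ℝ≥0) (hτ : IsStoppingTime (natFiltration d) τ)
    (x : Euc d) (F : Set (CadlagPath d)), MeasurableSet[hτ.measurableSpace] F →
    (∀ ω ∈ F, τ ω ≠ ⊤) → ∀ C : Set (CadlagPath d), MeasurableSet C →
    P x {ω | ω ∈ F ∧ shiftPath ((τ ω).untopD 0) ω ∈ C}
      = ∫⁻ ω in F, P (coordProc ((τ ω).untopD 0) ω) C ∂(P x)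

/-- A strong Markovian solution `(P_x)` of the martingale problem. Measurability of
`x ↦ P_x(C)` is part of `Kernel`. -/
structure IsStrongMarkovSolution {d : ℕ} (Q : Euc d → Matrix (Fin d) (Fin d) ℝ)
    (b : Euc d → Euc d) (N : Kernel (Euc d) (Euc d))
    (P : Kernel (Euc d) (CadlagPath d)) : Prop where
  solution : ∀ x, IsMartingaleSolution Q b N (Measure.dirac x) (P x)
  strongMarkov : IsStrongMarkovFamily P
  mixture : ∀ μ : Measure (Euc d), IsProbabilityMeasure μ →
    IsMartingaleSolution Q b N μ (μ.bind P)

/-! Exit time, killed semigroup, resolvent, weak subsolutions. -/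

/-- `τ_D = inf {t > 0 : X_t ∉ D}` (infinite if the set is empty). -/
def exitTime {d : ℕ} (D : Set (Euc d)) (ω : CadlagPath d) : ℝ≥0∞ :=
  ⨅ (s : ℝ≥0) (_ : 0 < s ∧ coordProc s ω ∉ D), (s : ℝ≥0∞)

/-- `τ_D ∧ t`. -/
def exitMin {d : ℕ} (D : Set (Euc d)) (t : ℝ≥0) (ω : CadlagPath d) : ℝ≥0 :=
  (min (exitTime D ω) t).toNNReal

/-- The exit time from `D` is almost surely finite for every starting point in `D`. -/
def ExitTimeFinite {d : ℕ} (P : Kernel (Euc d) (CadlagPath d)) (D : Set (Euc d)) : Prop :=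
  ∀ x ∈ D, ∀ᵐ ω ∂(P x), exitTime D ω < ⊤

/-- `f(X_t) 1_{t < τ_D}`. -/
def killedValue {d : ℕ} (D : Set (Euc d)) (t : ℝ≥0) (f : Euc d → ℝ) (ω : CadlagPath d) : ℝ :=
  {ω : CadlagPath d | (t : ℝ≥0∞) < exitTime D ω}.indicator (fun ω => f (coordProc t ω)) ω

/-- The killed semigroup `P^D_t f(x) = E_x[f(X_t), t < τ_D]`. -/
def killedSemigroup {d : ℕ} (P : Kernel (Euc d) (CadlagPath d)) (D : Set (Euc d))
    (t : ℝ≥0) (f : Euc d → ℝ) (x : Euc d) : ℝ :=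
  ∫ ω, killedValue D t f ω ∂(P x)

/-- The resolvent `R^D_α f(x) = ∫_0^∞ e^{-αt} P^D_t f(x) dt ∈ [0, ∞]` for non-negative `f`. -/
def killedResolvent {d : ℕ} (P : Kernel (Euc d) (CadlagPath d)) (D : Set (Euc d))
    (α : ℝ) (f : Euc d → ℝ) (x : Euc d) : ℝ≥0∞ :=
  ∫⁻ t in Ioi (0 : ℝ),
    ENNReal.ofReal (Real.exp (-(α * t)) * killedSemigroup P D t.toNNReal f x)

/-- `e_c(t) = exp(-∫_0^t c(X_r) dr)`. -/
def expWeight {d : ℕ} (c : Euc d → ℝ) (t : ℝ) (ω : CadlagPath d) : ℝ :=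
  Real.exp (-∫ r in (0 : ℝ)..t, c (coordProc r.toNNReal ω))

/-- `E_x ∫_0^{τ_D ∧ t} e_c(r) g⁻(X_r) dr ∈ [0, ∞]`. -/
def sourceCost {d : ℕ} (P : Kernel (Euc d) (CadlagPath d)) (D : Set (Euc d))
    (c g : Euc d → ℝ) (t : ℝ≥0) (x : Euc d) : ℝ≥0∞ :=
  ∫⁻ ω, (∫⁻ r in Ioo (0 : ℝ) (exitMin D t ω),
    ENNReal.ofReal (expWeight c r ω * -g (coordProc r.toNNReal ω)) ∂volume) ∂(P x)

/-- `g` is a Borel function on `D` with `g ≤ 0`. -/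
def IsNonposSource {d : ℕ} (D : Set (Euc d)) (g : Euc d → ℝ) : Prop :=
  Measurable (D.domRestrict g) ∧ ∀ x ∈ D, g x ≤ 0

/-- `u ∈ 𝒰_c(g)`: the bounded Borel function `u` is a weak subsolution of `(-A + c) v = g` in `D`,
for `g ≤ 0`. The expectation of the integral of the non-positive function `g` is `-sourceCost`,
and the inequality forces it to be finite. -/
def IsWeakSubsolution {d : ℕ} (P : Kernel (Euc d) (CadlagPath d)) (D : Set (Euc d))
    (c g u : Euc d → ℝ) : Prop :=
  Measurable u ∧ (∃ C : ℝ, ∀ x, |u x| ≤ C) ∧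
  ∀ x ∈ D, ∀ t : ℝ≥0, sourceCost P D c g t x ≠ ⊤ ∧
    u x ≤ (∫ ω, expWeight c (exitMin D t ω) ω * u (coordProc (exitMin D t ω) ω) ∂(P x))
      - (sourceCost P D c g t x).toReal

/-- `c` is a non-negative bounded Borel function on `D`. -/
def IsKillingRate {d : ℕ} (D : Set (Euc d)) (c : Euc d → ℝ) : Prop :=
  IsBddBorelOn D c ∧ ∀ x ∈ D, 0 ≤ c x

/-! Eigenfunctions, the minorization condition, intrinsic ultracontractivity. -/

/-- `φ` and `lam` are a non-negative eigenfunction and eigenvalue for the killed semigroup. -/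
structure IsNonnegEigenpair {d : ℕ} (P : Kernel (Euc d) (CadlagPath d)) (D : Set (Euc d))
    (m : Measure (Euc d)) (lam : ℝ) (φ : Euc d → ℝ) : Prop where
  meas : Measurable (D.domRestrict φ)
  nonneg : ∀ x ∈ D, 0 ≤ φ x
  lam_nonneg : 0 ≤ lam
  eigen : ∀ (t : ℝ≥0), ∀ x ∈ D, Integrable (killedValue D t φ) (P x) ∧
    Real.exp (-(lam * t)) * φ x = killedSemigroup P D t φ x
  nontrivial : 0 < ∫⁻ x in D, ENNReal.ofReal (φ x) ∂m

/-- The minorization condition `M'(α, ν)` with respect to the eigenfunction `φ`. -/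
structure MinorizationByEigenfunction {d : ℕ} (P : Kernel (Euc d) (CadlagPath d))
    (D : Set (Euc d)) (m : Measure (Euc d)) (lam : ℝ) (φ : Euc d → ℝ)
    (α : ℝ) (ν : Measure (Euc d)) : Prop where
  eig : IsNonnegEigenpair P D m lam φ
  onD : ν Dᶜ = 0
  nontrivial : ν ≠ 0
  minor : ∀ f : Euc d → ℝ, IsBddBorelOn D f → (∀ x ∈ D, 0 ≤ f x) → ∀ x ∈ D,
    ENNReal.ofReal (φ x) * ∫⁻ y in D, ENNReal.ofReal (f y) ∂ν ≤ killedResolvent P D α f x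

/-- The operators `f ↦ ∫ k(t, ·, y) f(y) m(dy)`, `t > 0`, on bounded functions extend to a strongly
continuous semigroup on `L²(m)`. -/
def ExtendsToL2Semigroup {d : ℕ} (m : Measure (Euc d)) (k : ℝ → Euc d → Euc d → ℝ) : Prop :=
  ∃ T : ℝ≥0 → (Lp ℝ 2 m →L[ℝ] Lp ℝ 2 m),
    T 0 = ContinuousLinearMap.id ℝ (Lp ℝ 2 m) ∧
    (∀ s t, T (s + t) = (T s).comp (T t)) ∧
    (∀ F : Lp ℝ 2 m, Continuous fun t => T t F) ∧
    ∀ t : ℝ≥0, 0 < t → ∀ f : Euc d → ℝ, Measurable f → (∃ C : ℝ, ∀ x, |f x| ≤ C) →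
      ∀ F : Lp ℝ 2 m, F =ᵐ[m] f → T t F =ᵐ[m] fun x => ∫ y, k t x y * f y ∂m

/-- The standing assumptions on the transition density `p_D(t,x,y)` of the killed semigroup with
respect to the measure `m` (which is carried by `D`), and on the dual semigroup. -/
structure IsTransitionDensity {d : ℕ} (P : Kernel (Euc d) (CadlagPath d)) (D : Set (Euc d))
    (m : Measure (Euc d)) (p : ℝ → Euc d → Euc d → ℝ) : Prop where
  bounded : ∀ t, 0 < t → ∃ C : ℝ, ∀ x ∈ D, ∀ y ∈ D, p t x y ≤ C
  cont : ∀ t, 0 < t → ContinuousOn (fun z : Euc d × Euc d => p t z.1 z.2) (D ×ˢ D)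
  pos : ∀ t, 0 < t → ∀ x ∈ D, ∀ y ∈ D, 0 < p t x y
  repr : ∀ t : ℝ≥0, 0 < t → ∀ f : Euc d → ℝ, Measurable f → (∃ C : ℝ, ∀ x, |f x| ≤ C) →
    ∀ x ∈ D, killedSemigroup P D t f x = ∫ y, p t x y * f y ∂m
  dual_subMarkov : ∀ t, 0 < t → ∀ x ∈ D, ∫ y, p t y x ∂m ≤ 1
  l2 : ExtendsToL2Semigroup m p
  l2_dual : ExtendsToL2Semigroup m (fun t x y => p t y x)

/-- `lam > 0` is the principal eigenvalue, and `φ`, `φ'` are the corresponding strictly positive,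
bounded, continuous and normalized eigenfunctions of the semigroup and of the dual semigroup. -/
structure IsPrincipalTriple {d : ℕ} (D : Set (Euc d)) (m : Measure (Euc d))
    (p : ℝ → Euc d → Euc d → ℝ) (lam : ℝ) (φ φ' : Euc d → ℝ) : Prop where
  lam_pos : 0 < lam
  cont : ContinuousOn φ D
  cont' : ContinuousOn φ' D
  pos : ∀ x ∈ D, 0 < φ x
  pos' : ∀ x ∈ D, 0 < φ' x
  bounded : ∃ C : ℝ, ∀ x ∈ D, φ x ≤ C
  bounded' : ∃ C : ℝ, ∀ x ∈ D, φ' x ≤ C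
  eigen : ∀ t, 0 < t → ∀ x ∈ D, Real.exp (-(lam * t)) * φ x = ∫ y, p t x y * φ y ∂m
  eigen' : ∀ t, 0 < t → ∀ x ∈ D, Real.exp (-(lam * t)) * φ' x = ∫ y, p t y x * φ' y ∂m
  normalized : ∫ x, φ x ∂m = 1
  normalized' : ∫ x, φ' x ∂m = 1

/-- Intrinsic ultracontractivity of the semigroup with density `p`, where `φ` and `φ'` are the
principal eigenfunctions of the semigroup and its dual. -/
def IntrinsicallyUltracontractive {d : ℕ} (D : Set (Euc d)) (p : ℝ → Euc d → Euc d → ℝ)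
    (φ φ' : Euc d → ℝ) : Prop :=
  ∀ t, 0 < t → ∃ C : ℝ, 0 < C ∧ ∀ x ∈ D, ∀ y ∈ D, p t x y ≤ C * φ x * φ' y

/-- `h` is continuous and positive on `(0,∞)` and `p(t,x,y) ≥ h(t) φ(x) φ'(y)` on `D × D`. -/
structure IsLowerRate {d : ℕ} (D : Set (Euc d)) (p : ℝ → Euc d → Euc d → ℝ)
    (φ φ' : Euc d → ℝ) (h : ℝ → ℝ) : Prop where
  cont : ContinuousOn h (Ioi 0)
  pos : ∀ t, 0 < t → 0 < h t
  le : ∀ t, 0 < t → ∀ x ∈ D, ∀ y ∈ D, h t * φ x * φ' y ≤ p t x y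

/-- `ν^α(dx) = (∫_0^∞ h(a) e^{-αa} da) φ'(x) m(dx)`. -/
def minorizingMeasure {d : ℕ} (m : Measure (Euc d)) (φ' : Euc d → ℝ) (h : ℝ → ℝ) (α : ℝ) :
    Measure (Euc d) :=
  (∫⁻ a in Ioi (0 : ℝ), ENNReal.ofReal (h a * Real.exp (-(α * a)))) •
    m.withDensity (fun x => ENNReal.ofReal (φ' x))

end

/-!
The killed density satisfies the Chapman–Kolmogorov equation pointwise on `D × D`. Splitting `t` into
three equal parts and bounding the middle factor below on a compact `K ⊆ D` of positive mass gives
`p(t,x,y) ≥ c_K (∫_K p(t/3,x,·) dm) (∫_K p(t/3,·,y) dm)`. Intrinsic ultracontractivity, applied to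
the part of the eigenfunction equation `e^{-λt} φ = ∫ p(t,·,y) φ(y) dm` that lives off `K`, makes
`∫_K p(t/3,x,·) dm` comparable to `φ(x)`, and dually for `φ'`. Such a lower bound persists in time
with a factor `e^{-λs}`, so that local constants patch to a continuous `h`
(`IntrinsicallyUltracontractive.exists_isLowerRate`). Integrating `e^{-αt} p` in time gives the
minorization (`IsPrincipalTriple.minorizationByEigenfunction`).

For the Hopf lemmas let `ū = sup_{D_S} u` and let `e` be the Feynman–Kac weight at `τ_D ∧ t`. Since
`g ≤ 0`, `ū - u(x) ≥ E_x[ū (1 - e) + e (ū - u)(X_{τ_D ∧ t})]`, and both terms are non-negative once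
`X_{τ_D} ∈ D_S` almost surely. On the event `{t < τ_D}` the second term is at least
`e^{-Ct} P^D_t(ū - u)(x)`, which `h` bounds below by a multiple of `φ(x)` unless `u = ū` almost
everywhere. For the quantitative version the first term is at least a multiple of
`ū E_x ∫_0^{τ_D ∧ 1} c(X_r) dr`, to which the same lower bound for `P^D_r c` applies.

The probabilistic core is `IsMartingaleSolution.ae_exit_mem_extDomain`: almost surely
`X_{τ_D} ∈ D_S`. If `X_{τ_D}` is not in the closure of `D`, then the path jumps at `τ_D`.
The martingale problem for a bump function supported in a small ball `V` around `X_{τ_D}`, with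
optional sampling on generators of the predictable σ-algebra, gives a Lévy system formula for the
first entrance into a larger ball: almost surely it is not a jump into `V` out of a point `z` with
`N(z, V - z) = 0`. Quasi-left continuity, the same formula on another predictable set, excludes a
jump out of a left limit on `∂D`, since that is announced by the hitting times of the
neighbourhoods of the complement of `D`.

The filtration is the raw one, in which `τ_D` need not be a stopping time or even be Borel. Only
hitting times of open sets are used as optional times, and `τ_D` is shown to be measurable up to
`P_x`-null sets: `{t < τ_D}` carries positive mass because `p > 0`, and the density formula equates
this mass with the integral of an indicator, which is only possible for a null-measurable set.
-/

noncomputable section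

/-! ### Path regularity and left limits -/

section Paths

variable {d : ℕ}

/-- The grid point `(⌊(n+1) r⌋ + 1) / (n+1)`, strictly to the right of `r`. -/
def gridAbove (n : ℕ) (r : ℝ≥0) : ℝ≥0 := (⌊((n : ℝ≥0) + 1) * r⌋₊ + 1) / ((n : ℝ≥0) + 1)

theorem lt_gridAbove (n : ℕ) (r : ℝ≥0) : r < gridAbove n r := by
  unfold gridAbove
  rw [lt_div_iff₀ (by positivity), mul_comm]
  exact Nat.lt_floor_add_one _

theorem gridAbove_le (n : ℕ) (r : ℝ≥0) : gridAbove n r ≤ r + 1 / ((n : ℝ≥0) + 1) := by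
  unfold gridAbove
  rw [add_div]
  gcongr
  rw [div_le_iff₀ (by positivity), mul_comm r]
  exact Nat.floor_le (zero_le)

theorem tendsto_gridAbove (r : ℝ≥0) : Tendsto (fun n => gridAbove n r) atTop (𝓝 r) := by
  have h1 : Tendsto (fun n : ℕ => r + 1 / ((n : ℝ≥0) + 1)) atTop (𝓝 r) := by
    simpa using tendsto_const_nhds.add (tendsto_one_div_add_atTop_nhds_zero_nat (𝕜 := ℝ≥0))
  exact tendsto_of_tendsto_of_tendsto_of_le_of_le tendsto_const_nhds h1
    (fun n => (lt_gridAbove n r).le) (fun n => gridAbove_le n r)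

theorem tendsto_coordProc_gridAbove (r : ℝ≥0) (ω : CadlagPath d) :
    Tendsto (fun n => coordProc (gridAbove n r) ω) atTop (𝓝 (coordProc r ω)) :=
  (ω.2 r).1.tendsto.comp (tendsto_nhdsWithin_iff.2
    ⟨tendsto_gridAbove r, Eventually.of_forall fun n => (lt_gridAbove n r).le⟩)

/-- The canonical process is jointly measurable in time and path. -/
theorem measurable_uncurry_coordProc :
    Measurable (fun z : ℝ≥0 × CadlagPath d => coordProc z.1 z.2) := by
  refine measurable_of_tendsto_metrizable (f := fun (n : ℕ) (z : ℝ≥0 × CadlagPath d) =>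
    coordProc (gridAbove n z.1) z.2) (fun n => ?_)
    (tendsto_pi_nhds.2 fun z => tendsto_coordProc_gridAbove z.1 z.2)
  have h1 : Measurable (fun z : ℕ × CadlagPath d =>
      coordProc (((z.1 : ℝ≥0) + 1) / ((n : ℝ≥0) + 1)) z.2) :=
    measurable_from_prod_countable_right (f := fun z : ℕ × CadlagPath d =>
      coordProc (((z.1 : ℝ≥0) + 1) / ((n : ℝ≥0) + 1)) z.2) fun k =>
        measurable_coordProc (((k : ℝ≥0) + 1) / ((n : ℝ≥0) + 1))
  have h2 : Measurable (fun z : ℝ≥0 × CadlagPath d => (⌊((n : ℝ≥0) + 1) * z.1⌋₊, z.2)) :=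
    (Nat.measurable_floor.comp (measurable_const.mul measurable_fst)).prodMk measurable_snd
  exact h1.comp h2

/-- The left limit `X_{r-}` of the canonical process, with `X_{0-} = X_0`. -/
def leftCoord (r : ℝ≥0) (ω : CadlagPath d) : Euc d := Function.leftLim ω.1 r

theorem leftCoord_zero (ω : CadlagPath d) : leftCoord 0 ω = coordProc 0 ω :=
  leftLim_eq_of_isBot fun _ => zero_le

theorem tendsto_leftCoord (r : ℝ≥0) (ω : CadlagPath d) :
    Tendsto (fun s => coordProc s ω) (𝓝[<] r) (𝓝 (leftCoord r ω)) := by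
  obtain ⟨l, hl⟩ := (ω.2 r).2
  exact tendsto_leftLim_of_tendsto ⟨l, hl⟩

/-- A càdlàg path has at most countably many jumps. -/
theorem countable_jumps (ω : CadlagPath d) :
    {r : ℝ≥0 | leftCoord r ω ≠ coordProc r ω}.Countable := by
  have key : ∀ ε : ℝ, 0 < ε → {r : ℝ≥0 | ε < dist (leftCoord r ω) (coordProc r ω)}.Countable := by
    intro ε hε
    have hloc : ∀ x : ℝ≥0, ∃ t ∈ 𝓝 x,
        (t ∩ {r : ℝ≥0 | ε < dist (leftCoord r ω) (coordProc r ω)}) ⊆ {x} := by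
      intro x
      have hR : ∀ᶠ s in 𝓝[≥] x, dist (coordProc s ω) (coordProc x ω) < ε / 2 :=
        (ω.2 x).1.tendsto.eventually (Metric.ball_mem_nhds _ (half_pos hε))
      have hLft : ∀ᶠ s in 𝓝[<] x, dist (coordProc s ω) (leftCoord x ω) < ε / 2 :=
        (tendsto_leftCoord x ω).eventually (Metric.ball_mem_nhds _ (half_pos hε))
      have side : ∀ (I : Set ℝ≥0) (l : Euc d) (y : ℝ≥0), IsOpen I → y ∈ I →
          (∀ s ∈ I, dist (coordProc s ω) l < ε / 2) →
          dist (leftCoord y ω) (coordProc y ω) ≤ ε := by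
        intro I l y hI hy hs
        by_cases hy0 : y = 0
        · subst hy0; rw [leftCoord_zero, dist_self]; exact hε.le
        have : (𝓝[<] y).NeBot := nhdsLT_neBot_of_exists_lt ⟨0, pos_iff_ne_zero.2 hy0⟩
        have h1 : dist (leftCoord y ω) l ≤ ε / 2 := by
          refine le_of_tendsto ((tendsto_leftCoord y ω).dist tendsto_const_nhds) ?_
          filter_upwards [nhdsWithin_le_nhds (hI.mem_nhds hy)] with s h using (hs s h).le
        have h2 := (hs y hy).le
        calc _ ≤ dist (leftCoord y ω) l + dist (coordProc y ω) l := dist_triangle_right _ _ _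
          _ ≤ ε := by linarith
      obtain ⟨u, hu, huR⟩ := mem_nhdsWithin_iff_exists_mem_nhds_inter.1 hR
      obtain ⟨v, hv, hvL⟩ := mem_nhdsWithin_iff_exists_mem_nhds_inter.1 hLft
      obtain ⟨O, hO, hOo, hxO⟩ := mem_nhds_iff.1 (inter_mem hu hv)
      refine ⟨O, hOo.mem_nhds hxO, ?_⟩
      rintro y ⟨hyO, hy⟩
      by_contra hne
      rcases lt_or_gt_of_ne (show y ≠ x from hne) with h | h
      · exact absurd (side (O ∩ Iio x) (leftCoord x ω) y (hOo.inter isOpen_Iio) ⟨hyO, h⟩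
          (fun s hs => hvL ⟨(hO hs.1).2, hs.2⟩)) (not_le.2 hy)
      · exact absurd (side (O ∩ Ioi x) (coordProc x ω) y (hOo.inter isOpen_Ioi) ⟨hyO, h⟩
          (fun s hs => huR ⟨(hO hs.1).1, (mem_Ioi.1 hs.2).le⟩)) (not_le.2 hy)
    choose t ht htsub using hloc
    obtain ⟨c, hc, hcU⟩ := TopologicalSpace.countable_cover_nhds ht
    refine hc.mono fun r hr => ?_
    have : r ∈ ⋃ x ∈ c, t x := hcU ▸ mem_univ r
    obtain ⟨x, hx, hrx⟩ := mem_iUnion₂.1 this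
    have : r = x := htsub x ⟨hrx, hr⟩
    exact this ▸ hx
  have : {r : ℝ≥0 | leftCoord r ω ≠ coordProc r ω} ⊆
      ⋃ n : ℕ, {r : ℝ≥0 | 1 / ((n : ℝ) + 1) < dist (leftCoord r ω) (coordProc r ω)} := by
    intro r hr
    obtain ⟨n, hn⟩ := exists_nat_one_div_lt (dist_pos.2 hr)
    exact mem_iUnion.2 ⟨n, hn⟩
  exact (countable_iUnion fun n => key _ (by positivity)).mono this

/-- The grid point `(⌈(n+1) r⌉ - 1) / (n+1)`, strictly to the left of `r > 0`. -/
def gridBelow (n : ℕ) (r : ℝ≥0) : ℝ≥0 := ((⌈((n : ℝ≥0) + 1) * r⌉₊ - 1 : ℕ) : ℝ≥0) / ((n : ℝ≥0) + 1)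

theorem mem_gridBelow_iff (n k : ℕ) (r : ℝ≥0) :
    r ∈ Ioc ((k : ℝ≥0) / ((n : ℝ≥0) + 1)) (((k + 1 : ℕ) : ℝ≥0) / ((n : ℝ≥0) + 1)) ↔
      ⌈((n : ℝ≥0) + 1) * r⌉₊ = k + 1 := by
  rw [Nat.ceil_eq_iff (by simp), mem_Ioc, div_lt_iff₀ (by positivity), le_div_iff₀ (by positivity),
    mul_comm r]
  simp

theorem gridBelow_lt (n : ℕ) {r : ℝ≥0} (hr : 0 < r) : gridBelow n r < r := by
  obtain ⟨k, hk⟩ := Nat.exists_eq_succ_of_ne_zero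
    (Nat.ceil_pos.2 (show 0 < ((n : ℝ≥0) + 1) * r by positivity)).ne'
  have := (mem_gridBelow_iff n k r).2 hk
  unfold gridBelow
  rw [hk]
  exact this.1

theorem le_gridBelow_add (n : ℕ) (r : ℝ≥0) : r ≤ gridBelow n r + 1 / ((n : ℝ≥0) + 1) := by
  rcases eq_or_ne r 0 with rfl | hr
  · exact zero_le
  obtain ⟨k, hk⟩ := Nat.exists_eq_succ_of_ne_zero
    (Nat.ceil_pos.2 (show 0 < ((n : ℝ≥0) + 1) * r by positivity)).ne'
  have := ((mem_gridBelow_iff n k r).2 hk).2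
  unfold gridBelow
  rw [hk, ← add_div]
  simpa using this

theorem tendsto_gridBelow {r : ℝ≥0} (hr : 0 < r) :
    Tendsto (fun n => gridBelow n r) atTop (𝓝[<] r) := by
  refine tendsto_nhdsWithin_iff.2 ⟨?_, Eventually.of_forall fun n => gridBelow_lt n hr⟩
  have h1 : Tendsto (fun n : ℕ => r - 1 / ((n : ℝ≥0) + 1)) atTop (𝓝 r) := by
    simpa using tendsto_const_nhds.sub (tendsto_one_div_add_atTop_nhds_zero_nat (𝕜 := ℝ≥0))
  exact tendsto_of_tendsto_of_tendsto_of_le_of_le h1 tendsto_const_nhds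
    (fun n => tsub_le_iff_right.2 (le_gridBelow_add n r)) (fun n => (gridBelow_lt n hr).le)

theorem measurable_coordProc_natFiltration {s t : ℝ≥0} (h : s ≤ t) :
    Measurable[natFiltration d t] (coordProc s : CadlagPath d → Euc d) :=
  ((Filtration.stronglyAdapted_natural (u := fun t (ω : CadlagPath d) => coordProc t ω)
    (fun t => (measurable_coordProc t).stronglyMeasurable) s).measurable).mono
    ((natFiltration d).mono h) le_rfl

/-- The left-limit process is predictable. -/
theorem measurable_leftCoord_predictable :
    Measurable[(natFiltration d).predictable]
      (fun z : ℝ≥0 × CadlagPath d => leftCoord z.1 z.2) := by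
  refine @measurable_of_tendsto_metrizable _ (Euc d) (natFiltration d).predictable _ _ _ _
    (fun (n : ℕ) (z : ℝ≥0 × CadlagPath d) => coordProc (gridBelow n z.1) z.2) _ (fun n => ?_)
    (tendsto_pi_nhds.2 fun z => ?_)
  · intro C hC
    have hset : (fun z : ℝ≥0 × CadlagPath d => coordProc (gridBelow n z.1) z.2) ⁻¹' C =
        ({⊥} ×ˢ (coordProc 0 ⁻¹' C)) ∪ ⋃ k : ℕ,
          Ioc ((k : ℝ≥0) / ((n : ℝ≥0) + 1)) (((k + 1 : ℕ) : ℝ≥0) / ((n : ℝ≥0) + 1)) ×ˢ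
            (coordProc ((k : ℝ≥0) / ((n : ℝ≥0) + 1)) ⁻¹' C) := by
      ext ⟨r, ω⟩
      simp only [mem_preimage, mem_union, mem_prod, mem_singleton_iff, mem_iUnion,
        mem_gridBelow_iff]
      rcases eq_or_ne r 0 with rfl | hr
      · simp [gridBelow]
      · obtain ⟨k, hk⟩ := Nat.exists_eq_succ_of_ne_zero
          (Nat.ceil_pos.2 (show 0 < ((n : ℝ≥0) + 1) * r by positivity)).ne'
        have hr' : r ≠ ⊥ := hr
        simp only [hr', false_and, false_or, hk, gridBelow]
        simp
    rw [hset]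
    refine MeasurableSet.union (measurableSet_predictable_singleton_bot_prod
      (measurable_coordProc_natFiltration (le_of_eq rfl) hC)) (MeasurableSet.iUnion fun k => ?_)
    exact measurableSet_predictable_Ioc_prod _ _ (measurable_coordProc_natFiltration le_rfl hC)
  · rcases eq_or_ne z.1 0 with h | h
    · have : ∀ n, gridBelow n z.1 = 0 := fun n => by simp [gridBelow, h]
      rw [h] at this
      simp only [h, this, leftCoord_zero]
      exact tendsto_const_nhds
    · exact (tendsto_leftCoord z.1 z.2).comp (tendsto_gridBelow (pos_iff_ne_zero.2 h))

end Paths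

/-! ### Optional times and optional sampling -/

section Optional

variable {Ω : Type*} {m₀ : MeasurableSpace Ω}

/-- A `[0, ∞]`-valued random time `σ` with `{σ < r} ∈ 𝓕_r` for all `r`. For a filtration that is
not right continuous this is weaker than being a stopping time. -/
def IsOptionalTime (𝓕 : Filtration ℝ≥0 m₀) (σ : Ω → ℝ≥0∞) : Prop :=
  ∀ r : ℝ≥0, MeasurableSet[𝓕 r] {ω | σ ω < r}

variable {𝓕 : Filtration ℝ≥0 m₀}

theorem isOptionalTime_const (c : ℝ≥0∞) : IsOptionalTime 𝓕 fun _ => c := fun _ => .const _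

theorem IsOptionalTime.min {σ τ : Ω → ℝ≥0∞} (hσ : IsOptionalTime 𝓕 σ) (hτ : IsOptionalTime 𝓕 τ) :
    IsOptionalTime 𝓕 fun ω => min (σ ω) (τ ω) := fun r => by
  simp only [min_lt_iff]; exact (hσ r).union (hτ r)

theorem IsOptionalTime.max {σ τ : Ω → ℝ≥0∞} (hσ : IsOptionalTime 𝓕 σ) (hτ : IsOptionalTime 𝓕 τ) :
    IsOptionalTime 𝓕 fun ω => max (σ ω) (τ ω) := fun r => by
  simp only [max_lt_iff]; exact (hσ r).inter (hτ r)

theorem lt_coe_iff_exists_rat {a : ℝ≥0∞} {r : ℝ≥0} :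
    a < r ↔ ∃ q : ℚ, Real.toNNReal q < r ∧ a < (Real.toNNReal q : ℝ≥0∞) := by
  constructor
  · intro h
    obtain ⟨q, -, h1, h2⟩ := ENNReal.lt_iff_exists_rat_btwn.1 h
    exact ⟨q, ENNReal.coe_lt_coe.1 h2, h1⟩
  · rintro ⟨q, h1, h2⟩
    exact h2.trans (ENNReal.coe_lt_coe.2 h1)

theorem IsOptionalTime.iSup {σ : ℕ → Ω → ℝ≥0∞} (hσ : ∀ k, IsOptionalTime 𝓕 (σ k)) :
    IsOptionalTime 𝓕 fun ω => ⨆ k, σ k ω := by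
  intro r
  have : {ω | ⨆ k, σ k ω < r} = ⋃ (q : ℚ) (_ : Real.toNNReal q < r),
      ⋂ k, {ω | σ k ω < (Real.toNNReal q : ℝ≥0∞)} := by
    ext ω
    simp only [mem_iUnion, mem_iInter, exists_prop, mem_ofPred_eq]
    constructor
    · rw [lt_coe_iff_exists_rat]
      rintro ⟨q, h1, h2⟩
      exact ⟨q, h1, fun k => (le_iSup (fun k => σ k ω) k).trans_lt h2⟩
    · rintro ⟨q, h1, h2⟩
      exact (iSup_le fun k => (h2 k).le).trans_lt (ENNReal.coe_lt_coe.2 h1)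
  rw [this]
  exact MeasurableSet.iUnion fun q => MeasurableSet.iUnion fun h => MeasurableSet.iInter fun k =>
    𝓕.mono h.le _ (hσ k _)

theorem IsOptionalTime.measurable {σ : Ω → ℝ≥0∞} (hσ : IsOptionalTime 𝓕 σ) : Measurable σ := by
  refine measurable_of_Iio fun a => ?_
  induction a with
  | top =>
    have : σ ⁻¹' Iio ⊤ = ⋃ n : ℕ, {ω | σ ω < ((n : ℝ≥0) : ℝ≥0∞)} := by
      ext ω
      simp only [mem_preimage, mem_Iio, mem_iUnion, mem_ofPred_eq]
      exact ⟨fun h => by simpa using ENNReal.exists_nat_gt h.ne, fun ⟨n, h⟩ => h.trans_le le_top⟩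
    rw [this]
    exact MeasurableSet.iUnion fun n => 𝓕.le _ _ (hσ _)
  | coe r => exact 𝓕.le _ _ (hσ r)

theorem IsOptionalTime.measurableSet_predictable_lt {σ : Ω → ℝ≥0∞} (hσ : IsOptionalTime 𝓕 σ) :
    MeasurableSet[𝓕.predictable] {z : ℝ≥0 × Ω | σ z.2 < z.1} := by
  have : {z : ℝ≥0 × Ω | σ z.2 < z.1} =
      ⋃ q : ℚ, Ioi (Real.toNNReal q) ×ˢ {ω | σ ω < (Real.toNNReal q : ℝ≥0∞)} := by
    ext z
    rw [mem_ofPred_eq, lt_coe_iff_exists_rat]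
    simp only [mem_iUnion, mem_prod, mem_Ioi, mem_ofPred_eq]
  rw [this]
  exact MeasurableSet.iUnion fun q => measurableSet_predictable_Ioi_prod (hσ _)

theorem predictable_le_prod : 𝓕.predictable ≤ (inferInstance : MeasurableSpace (ℝ≥0 × Ω)) :=
  measurableSpace_le_predictable_of_measurableSet
    (fun _ hA => (measurableSet_singleton _).prod (𝓕.le _ _ hA))
    (fun i _ hA => measurableSet_Ioi.prod (𝓕.le i _ hA))

/-- **Optional sampling** for a martingale with right-continuous paths and a bounded optional time:
the expected value of the martingale at that time is its terminal expectation. The discrete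
optional sampling theorem applies to grid times decreasing to `σ`, and the sampled values are
conditional expectations of the terminal value, hence uniformly integrable. -/
theorem integral_martingale_optionalTime {μ : Measure Ω} [IsFiniteMeasure μ] {M : ℝ≥0 → Ω → ℝ}
    (hM : Martingale M 𝓕 μ)
    (hrc : ∀ᵐ ω ∂μ, ∀ t, ContinuousWithinAt (fun s => M s ω) (Ici t) t)
    {σ : Ω → ℝ≥0} (hσ : IsOptionalTime 𝓕 fun ω => (σ ω : ℝ≥0∞)) {T : ℝ≥0} (hT : ∀ ω, σ ω ≤ T) :
    Integrable (fun ω => M (σ ω) ω) μ ∧ ∫ ω, M (σ ω) ω ∂μ = ∫ ω, M T ω ∂μ := by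
  set τ : ℕ → Ω → WithTop ℝ≥0 := fun n ω => ((min (gridAbove n (σ ω)) T : ℝ≥0) : WithTop ℝ≥0)
    with hτdef
  have hτ : ∀ n, IsStoppingTime 𝓕 (τ n) := by
    intro n t
    rcases le_or_gt T t with h | h
    · have : {ω | τ n ω ≤ t} = univ := by
        ext ω
        simp only [hτdef, mem_ofPred_eq, mem_univ, iff_true, WithTop.coe_le_coe]
        exact (min_le_right _ _).trans h
      rw [this]; exact .univ
    · set K : ℕ := ⌊((n : ℝ≥0) + 1) * t⌋₊
      have : {ω | τ n ω ≤ t} = {ω | (σ ω : ℝ≥0∞) < ((K / ((n : ℝ≥0) + 1) : ℝ≥0) : ℝ≥0∞)} := by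
        ext ω
        simp only [hτdef, mem_ofPred_eq, WithTop.coe_le_coe, ENNReal.coe_lt_coe, min_le_iff,
          not_le.2 h, or_false]
        rw [gridAbove, div_le_iff₀ (by positivity), lt_div_iff₀ (by positivity), mul_comm t,
          mul_comm (σ ω), ← Nat.cast_add_one, ← Nat.le_floor_iff zero_le, Nat.succ_le_iff,
          Nat.floor_lt zero_le]
      rw [this]
      refine 𝓕.mono ?_ _ (hσ _)
      rw [div_le_iff₀ (by positivity), mul_comm]
      exact Nat.floor_le zero_le
  have hτT : ∀ n ω, τ n ω ≤ (T : WithTop ℝ≥0) := fun n ω => WithTop.coe_le_coe.2 (min_le_right _ _)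
  have hcr : ∀ n, (range (τ n)).Countable := by
    intro n
    refine (countable_range fun k : ℕ =>
      ((min (((k : ℝ≥0) + 1) / ((n : ℝ≥0) + 1)) T : ℝ≥0) : WithTop ℝ≥0)).mono ?_
    rintro _ ⟨ω, rfl⟩
    exact ⟨_, rfl⟩
  have hce : ∀ n, μ[M T | (hτ n).measurableSpace] =ᵐ[μ] stoppedValue M (τ n) := fun n =>
    (hM.stoppedValue_ae_eq_condExp_of_le_const_of_countable_range (hτ n) (hτT n) (hcr n)).symm
  have hUI : UniformIntegrable (fun n => stoppedValue M (τ n)) 1 μ :=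
    ((hM.integrable T).uniformIntegrable_condExp
      (fun n => (hτ n).measurableSpace_le)).ae_eq hce
  have hlim : ∀ᵐ ω ∂μ, Tendsto (fun n => stoppedValue M (τ n) ω) atTop (𝓝 (M (σ ω) ω)) := by
    filter_upwards [hrc] with ω hω
    have h1 : Tendsto (fun n => min (gridAbove n (σ ω)) T) atTop (𝓝[≥] (σ ω)) := by
      refine tendsto_nhdsWithin_iff.2 ⟨?_, Eventually.of_forall fun n =>
        le_min (lt_gridAbove _ _).le (hT ω)⟩
      simpa [min_eq_left (hT ω)] using (tendsto_gridAbove (σ ω)).min (tendsto_const_nhds (x := T))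
    exact (hω (σ ω)).tendsto.comp h1
  have hmem := hUI.memLp_of_ae_tendsto hlim
  refine ⟨memLp_one_iff_integrable.1 hmem, ?_⟩
  have hL := tendsto_Lp_finite_of_tendsto_ae le_rfl ENNReal.one_ne_top hUI.1 hmem hUI.2.1 hlim
  have hI : ∀ n, ∫ ω, stoppedValue M (τ n) ω ∂μ = ∫ ω, M T ω ∂μ := fun n => by
    rw [← integral_congr_ae (hce n), integral_condExp (hτ n).measurableSpace_le]
  have := tendsto_integral_of_L1' _ hmem.1
    (Eventually.of_forall fun n => (memLp_one_iff_integrable.1 (hUI.memLp n))) hL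
  simp only [hI] at this
  exact (tendsto_nhds_unique this tendsto_const_nhds)

end Optional

/-! ### Hitting times of open sets -/

section Hitting

variable {d : ℕ}

/-- The hitting time `inf {s ≥ q : X_s ∈ W}`. -/
def hitAfter (W : Set (Euc d)) (q : ℝ≥0) (ω : CadlagPath d) : ℝ≥0∞ :=
  ⨅ (s : ℝ≥0) (_ : q ≤ s ∧ coordProc s ω ∈ W), (s : ℝ≥0∞)

theorem hitAfter_lt_iff {W : Set (Euc d)} {q : ℝ≥0} {ω : CadlagPath d} {a : ℝ≥0∞} :
    hitAfter W q ω < a ↔ ∃ s : ℝ≥0, q ≤ s ∧ coordProc s ω ∈ W ∧ (s : ℝ≥0∞) < a := by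
  simp [hitAfter, iInf_lt_iff, and_assoc]

theorem hitAfter_le {W : Set (Euc d)} {q s : ℝ≥0} {ω : CadlagPath d} (hs : q ≤ s)
    (h : coordProc s ω ∈ W) : hitAfter W q ω ≤ s := iInf₂_le s ⟨hs, h⟩

theorem le_hitAfter {W : Set (Euc d)} {q : ℝ≥0} {ω : CadlagPath d} {a : ℝ≥0∞}
    (h : ∀ s : ℝ≥0, q ≤ s → coordProc s ω ∈ W → a ≤ s) : a ≤ hitAfter W q ω :=
  le_iInf₂ fun s hs => h s hs.1 hs.2

theorem notMem_of_lt_hitAfter {W : Set (Euc d)} {q s : ℝ≥0} {ω : CadlagPath d} (hs : q ≤ s)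
    (h : (s : ℝ≥0∞) < hitAfter W q ω) : coordProc s ω ∉ W := fun hW =>
  (hitAfter_le hs hW).not_gt h

/-- The first hitting time of an open set is optional. -/
theorem isOptionalTime_hitAfter {W : Set (Euc d)} (hW : IsOpen W) (q : ℝ≥0) :
    IsOptionalTime (natFiltration d) (hitAfter W q) := by
  intro r
  have : {ω : CadlagPath d | hitAfter W q ω < r} =
      ⋃ (s : ℚ) (_ : q ≤ Real.toNNReal s ∧ Real.toNNReal s < r),
        coordProc (Real.toNNReal s) ⁻¹' W := by
    ext ω
    simp only [mem_ofPred_eq, hitAfter_lt_iff, mem_iUnion, mem_preimage, exists_prop,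
      ENNReal.coe_lt_coe]
    constructor
    · rintro ⟨s, hqs, hsW, hsr⟩
      -- by right continuity the path stays in `W` up to a later rational time
      have h1 : ∀ᶠ t in 𝓝[≥] s, coordProc t ω ∈ W :=
        (ω.2 s).1.tendsto.eventually (hW.mem_nhds hsW)
      obtain ⟨u, hu, hI⟩ := (mem_nhdsGE_iff_exists_Ico_subset' hsr).1 h1
      obtain ⟨t, -, h2, h3⟩ := (NNReal.lt_iff_exists_rat_btwn s (min u r)).1
        (lt_min hu hsr)
      exact ⟨t, ⟨hqs.trans h2.le, h3.trans_le (min_le_right _ _)⟩,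
        hI ⟨h2.le, h3.trans_le (min_le_left _ _)⟩⟩
    · rintro ⟨t, ⟨h1, h2⟩, h3⟩
      exact ⟨_, h1, h3, h2⟩
  rw [this]
  exact MeasurableSet.iUnion fun s => MeasurableSet.iUnion fun h =>
    measurable_coordProc_natFiltration h.2.le hW.measurableSet

end Hitting

/-! ### The Lévy system of the first jump into an open set -/

section LevySystem

variable {d : ℕ}

/-- The process `f(X_t) - f(X_0) - ∫_0^t L(X_r) dr`. -/
def compensated (f L : Euc d → ℝ) (t : ℝ≥0) (ω : CadlagPath d) : ℝ :=
  f (coordProc t ω) - f (coordProc 0 ω) - ∫ r in (0 : ℝ)..t, L (coordProc r.toNNReal ω)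

theorem continuousWithinAt_compensated {f L : Euc d → ℝ} (hf : Continuous f) {ω : CadlagPath d}
    (hL : ∀ t : ℝ≥0, IntervalIntegrable (fun r : ℝ => L (coordProc r.toNNReal ω)) volume 0 t)
    (t : ℝ≥0) : ContinuousWithinAt (fun s => compensated f L s ω) (Ici t) t := by
  unfold compensated
  refine ContinuousWithinAt.sub (ContinuousWithinAt.sub ?_ continuousWithinAt_const) ?_
  · exact hf.continuousAt.comp_continuousWithinAt (ω.2 t).1
  · have h1 : ContinuousOn (fun b : ℝ => ∫ r in (0 : ℝ)..b, L (coordProc r.toNNReal ω))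
        (uIcc 0 ((t + 1 : ℝ≥0) : ℝ)) :=
      intervalIntegral.continuousOn_primitive_interval' (hL (t + 1)) left_mem_uIcc
    have h2 : ContinuousAt (fun b : ℝ≥0 => ∫ r in (0 : ℝ)..b, L (coordProc r.toNNReal ω)) t := by
      have h3 : ContinuousOn (fun b : ℝ≥0 => ∫ r in (0 : ℝ)..b, L (coordProc r.toNNReal ω))
          (Iic (t + 1)) := by
        refine h1.comp NNReal.continuous_coe.continuousOn fun b hb => ?_
        rw [uIcc_of_le (NNReal.coe_nonneg _)]
        exact ⟨NNReal.coe_nonneg _, NNReal.coe_le_coe.2 hb⟩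
      exact h3.continuousAt (Iic_mem_nhds (lt_add_one t))
    exact h2.continuousWithinAt

/-- The position `f(X_S)` at the hitting time `S`, on the event `{s < S ≤ T}`. -/
def hitValue (W : Set (Euc d)) (q : ℝ≥0) (f : Euc d → ℝ) (s T : ℝ≥0) (ω : CadlagPath d) : ℝ :=
  {ω : CadlagPath d | (s : ℝ≥0∞) < hitAfter W q ω ∧ hitAfter W q ω ≤ T}.indicator
    (fun ω => f (coordProc (hitAfter W q ω).toNNReal ω)) ω

/-- The jump intensity `ν(X_r)` before the hitting time. -/
def preHitRate (W : Set (Euc d)) (q : ℝ≥0) (ν : Euc d → ℝ) (r : ℝ) (ω : CadlagPath d) : ℝ :=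
  {ω : CadlagPath d | (r.toNNReal : ℝ≥0∞) < hitAfter W q ω}.indicator
    (fun ω => ν (coordProc r.toNNReal ω)) ω

variable {μ : Measure (CadlagPath d)} [IsProbabilityMeasure μ] {f L ν : Euc d → ℝ}
  {W : Set (Euc d)} {C : ℝ}

theorem measurable_coordProc_comp {σ : CadlagPath d → ℝ≥0} (hσ : Measurable σ) :
    Measurable fun ω => coordProc (σ ω) ω :=
  measurable_uncurry_coordProc.comp (hσ.prodMk measurable_id)

theorem measurable_hitValue (hW : IsOpen W) (hf : Continuous f) (q s T : ℝ≥0) :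
    Measurable (hitValue W q f s T) := by
  have hS := (isOptionalTime_hitAfter hW q).measurable
  exact ((hf.measurable.comp (measurable_coordProc_comp hS.ennreal_toNNReal))).indicator
    ((measurableSet_lt measurable_const hS).inter (measurableSet_le hS measurable_const))

theorem measurable_preHitRate (hW : IsOpen W) (hν : Measurable ν) (q : ℝ≥0) :
    Measurable fun z : ℝ × CadlagPath d => preHitRate W q ν z.1 z.2 := by
  have hS := (isOptionalTime_hitAfter hW q).measurable
  have h1 : Measurable fun z : ℝ × CadlagPath d => coordProc z.1.toNNReal z.2 :=
    measurable_uncurry_coordProc.comp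
      ((measurable_real_toNNReal.comp measurable_fst).prodMk measurable_snd)
  exact (hν.comp h1).indicator (measurableSet_lt
    (measurable_real_toNNReal.comp measurable_fst).coe_nnreal_ennreal (hS.comp measurable_snd))

theorem preHitRate_nonneg (hν0 : ∀ x, 0 ≤ ν x) (q : ℝ≥0) (r : ℝ) (ω : CadlagPath d) :
    0 ≤ preHitRate W q ν r ω := indicator_nonneg (fun _ _ => hν0 _) _

theorem preHitRate_le (hν0 : ∀ x, 0 ≤ ν x) (hνC : ∀ x, ν x ≤ C) (q : ℝ≥0) (r : ℝ)
    (ω : CadlagPath d) : preHitRate W q ν r ω ≤ C :=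
  indicator_apply_le' (fun _ => hνC _) (fun _ => (hν0 0).trans (hνC 0))

/-- The increment of `f(X) - ∫ L(X_r) dr` between `s` and `(S ∧ T) ∨ s`, for the first hitting
time `S` of a set off which `f` vanishes and `L = ν`. -/
theorem compensated_increment {ω : CadlagPath d}
    (hL : ∀ t : ℝ≥0, IntervalIntegrable (fun r : ℝ => L (coordProc r.toNNReal ω)) volume 0 t)
    (hfW : ∀ x ∉ W, f x = 0) (hLW : ∀ x ∉ W, L x = ν x) {q s T : ℝ≥0} (hqs : q ≤ s) (hsT : s ≤ T) :
    compensated f L (max s (min (hitAfter W q ω) T).toNNReal) ω - compensated f L s ω =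
      hitValue W q f s T ω - ∫ r in Ioc (s : ℝ) T, preHitRate W q ν r ω := by
  set S := hitAfter W q ω with hS
  set σ : ℝ≥0 := max s (min S T).toNNReal with hσ
  have hsσ : s ≤ σ := le_max_left _ _
  have hfin : min S (T : ℝ≥0∞) ≠ ⊤ := ne_top_of_le_ne_top ENNReal.coe_ne_top (min_le_right _ _)
  have hσ' : (σ : ℝ≥0∞) = max (s : ℝ≥0∞) (min S T) := by
    rw [hσ, ENNReal.coe_max, ENNReal.coe_toNNReal hfin]
  have hσT : σ ≤ T := by
    rw [← ENNReal.coe_le_coe, hσ']; exact max_le (by simpa using hsT) (min_le_right _ _)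
  have hint : (∫ r in (0 : ℝ)..σ, L (coordProc r.toNNReal ω)) -
      ∫ r in (0 : ℝ)..s, L (coordProc r.toNNReal ω) =
      ∫ r in Ioc (s : ℝ) T, preHitRate W q ν r ω := by
    rw [intervalIntegral.integral_interval_sub_left (hL σ) (hL s),
      intervalIntegral.integral_of_le (NNReal.coe_le_coe.2 hsσ), integral_Ioc_eq_integral_Ioo]
    have hsub : Ioo (s : ℝ) σ ⊆ Ioc (s : ℝ) T := fun r hr =>
      ⟨hr.1, hr.2.le.trans (NNReal.coe_le_coe.2 hσT)⟩
    rw [← integral_indicator measurableSet_Ioo, ← integral_indicator measurableSet_Ioc]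
    -- the two integrands agree off the single point `σ`
    refine integral_congr_ae ?_
    filter_upwards [Measure.ae_ne volume (σ : ℝ)] with r hr
    by_cases hrI : r ∈ Ioc (s : ℝ) T
    · have hr0 : 0 ≤ r := (NNReal.coe_nonneg s).trans hrI.1.le
      lift r to ℝ≥0 using hr0
      have h1 : s < r := NNReal.coe_lt_coe.1 hrI.1
      have h2 : r ≤ T := NNReal.coe_le_coe.1 hrI.2
      rw [indicator_of_mem hrI]
      by_cases hrS : (r : ℝ≥0∞) < S
      · have h3 : r < σ := by
          refine lt_of_le_of_ne ?_ fun h => hr (by rw [h])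
          rw [← ENNReal.coe_le_coe, hσ']
          exact le_max_of_le_right (le_min hrS.le (by simpa using h2))
        rw [indicator_of_mem (show (r : ℝ) ∈ Ioo (s : ℝ) σ from
          ⟨hrI.1, NNReal.coe_lt_coe.2 h3⟩), preHitRate, indicator_of_mem (by simpa using hrS),
          Real.toNNReal_coe]
        exact hLW _ (notMem_of_lt_hitAfter (hqs.trans h1.le) hrS)
      · rw [indicator_of_notMem, preHitRate, indicator_of_notMem (by simpa using hrS)]
        rintro ⟨-, h3⟩
        have h4 : (r : ℝ≥0∞) < max (s : ℝ≥0∞) (min S T) := by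
          rw [← hσ']; exact ENNReal.coe_lt_coe.2 (NNReal.coe_lt_coe.1 h3)
        rcases lt_max_iff.1 h4 with h5 | h5
        · exact absurd (ENNReal.coe_lt_coe.1 h5) h1.not_gt
        · exact hrS (lt_min_iff.1 h5).1
    · rw [indicator_of_notMem hrI, indicator_of_notMem (fun h => hrI (hsub h))]
  have hval : f (coordProc σ ω) - f (coordProc s ω) = hitValue W q f s T ω := by
    unfold hitValue
    by_cases h1 : (s : ℝ≥0∞) < S
    · have hs0 : f (coordProc s ω) = 0 := hfW _ (notMem_of_lt_hitAfter hqs h1)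
      by_cases h2 : S ≤ T
      · rw [indicator_of_mem (by exact ⟨h1, h2⟩), hs0, sub_zero, ← hS]
        congr 2
        rw [hσ, min_eq_left h2, max_eq_right]
        exact ENNReal.le_toNNReal_of_coe_le h1.le (ne_top_of_le_ne_top ENNReal.coe_ne_top h2)
      · rw [indicator_of_notMem (fun h => h2 h.2), hs0, sub_zero]
        have : σ = T := by
          rw [hσ, min_eq_right (not_le.1 h2).le, ENNReal.toNNReal_coe, max_eq_right hsT]
        rw [this]
        exact hfW _ (notMem_of_lt_hitAfter (hqs.trans hsT) (not_le.1 h2))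
    · rw [indicator_of_notMem (fun h => h1 h.1)]
      have : σ = s := by
        rw [← ENNReal.coe_inj, hσ']
        exact max_eq_left ((min_le_left _ _).trans (not_lt.1 h1))
      rw [this, sub_self]
  unfold compensated
  rw [← hval, ← hint]
  ring

theorem integrable_integral_preHitRate (hW : IsOpen W) (hν : Measurable ν) (hν0 : ∀ x, 0 ≤ ν x)
    (hνC : ∀ x, ν x ≤ C) (q s T : ℝ≥0) :
    Integrable (fun ω => ∫ r in Ioc (s : ℝ) T, preHitRate W q ν r ω) μ := by
  refine Integrable.of_bound ?_ (C * volume.real (Ioc (s : ℝ) T))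
    (Eventually.of_forall fun ω => ?_)
  · exact (StronglyMeasurable.integral_prod_right' (f := fun z : CadlagPath d × ℝ =>
      preHitRate W q ν z.2 z.1) ((measurable_preHitRate hW hν q).comp
        measurable_swap).stronglyMeasurable).aestronglyMeasurable
  · refine norm_setIntegral_le_of_norm_le_const (by simp) fun r _ => ?_
    rw [Real.norm_of_nonneg (preHitRate_nonneg hν0 q r ω)]
    exact preHitRate_le hν0 hνC q r ω

/-- The value of `f` at the first hitting time is compensated by the integrated rate. -/
theorem setIntegral_hitValue (hW : IsOpen W) (hf : Continuous f) (hf1 : ∀ x, ‖f x‖ ≤ 1)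
    (hν : Measurable ν) (hν0 : ∀ x, 0 ≤ ν x) (hνC : ∀ x, ν x ≤ C)
    (hL : ∀ᵐ ω ∂μ, ∀ t : ℝ≥0,
      IntervalIntegrable (fun r : ℝ => L (coordProc r.toNNReal ω)) volume 0 t)
    (hM : Martingale (compensated f L) (natFiltration d) μ)
    (hfW : ∀ x ∉ W, f x = 0) (hLW : ∀ x ∉ W, L x = ν x) {q s T : ℝ≥0} (hqs : q ≤ s) (hsT : s ≤ T)
    {B : Set (CadlagPath d)} (hB : MeasurableSet[natFiltration d s] B) :
    ∫ ω in B, hitValue W q f s T ω ∂μ =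
      ∫ ω in B, (∫ r in Ioc (s : ℝ) T, preHitRate W q ν r ω) ∂μ := by
  classical
  have hBm : MeasurableSet B := (natFiltration d).le s _ hB
  have hSo := isOptionalTime_hitAfter hW q
  set σ : CadlagPath d → ℝ≥0 := fun ω => max s (min (hitAfter W q ω) T).toNNReal with hσ
  have hσT : ∀ ω, σ ω ≤ T := fun ω =>
    max_le hsT (ENNReal.toNNReal_mono ENNReal.coe_ne_top (min_le_right _ _))
  have hσc : ∀ ω, (σ ω : ℝ≥0∞) = max (s : ℝ≥0∞) (min (hitAfter W q ω) T) := fun ω => by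
    rw [hσ, ENNReal.coe_max, ENNReal.coe_toNNReal
      (ne_top_of_le_ne_top ENNReal.coe_ne_top (min_le_right _ _))]
  have hσo : IsOptionalTime (natFiltration d) fun ω => (σ ω : ℝ≥0∞) := by
    simp only [hσc]
    exact (isOptionalTime_const _).max (hSo.min (isOptionalTime_const _))
  -- the time equal to `σ` on `B` and to `T` off `B` is optional because `σ ≥ s`
  have hσB : IsOptionalTime (natFiltration d) fun ω => ((if ω ∈ B then σ ω else T : ℝ≥0) : ℝ≥0∞) := by
    intro r
    rcases le_or_gt r s with hr | hr
    · have : {ω : CadlagPath d | ((if ω ∈ B then σ ω else T : ℝ≥0) : ℝ≥0∞) < r} = ∅ := by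
        ext ω
        simp only [mem_ofPred_eq, mem_empty_iff_false, iff_false, not_lt, ENNReal.coe_le_coe]
        refine hr.trans ?_
        split_ifs
        exacts [le_max_left _ _, hsT]
      rw [this]; exact @MeasurableSet.empty _ (natFiltration d r)
    · have : {ω : CadlagPath d | ((if ω ∈ B then σ ω else T : ℝ≥0) : ℝ≥0∞) < r} =
          (B ∩ {ω | (σ ω : ℝ≥0∞) < r}) ∪ (Bᶜ ∩ {ω | (T : ℝ≥0∞) < r}) := by
        ext ω
        by_cases h : ω ∈ B <;> simp [h]
      rw [this]
      have hB' := (natFiltration d).mono hr.le _ hB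
      exact (hB'.inter (hσo r)).union (hB'.compl.inter (.const _))
  have hrc : ∀ᵐ ω ∂μ, ∀ t, ContinuousWithinAt (fun s => compensated f L s ω) (Ici t) t := by
    filter_upwards [hL] with ω hω t using continuousWithinAt_compensated hf hω t
  obtain ⟨hi, -⟩ := integral_martingale_optionalTime hM hrc hσo hσT
  obtain ⟨hiB, hIB⟩ := integral_martingale_optionalTime hM hrc hσB
    (fun ω => by split_ifs; exacts [hσT ω, le_rfl])
  have e1 : ∫ ω in B, compensated f L (σ ω) ω ∂μ = ∫ ω in B, compensated f L T ω ∂μ := by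
    rw [← integral_add_compl hBm hiB, ← integral_add_compl hBm (hM.integrable T)] at hIB
    rw [setIntegral_congr_fun (g := fun ω => compensated f L (σ ω) ω) hBm
        (fun ω hω => by simp [hω]),
      setIntegral_congr_fun (s := Bᶜ) (g := fun ω => compensated f L T ω) hBm.compl
        (fun ω hω => by simp [show ω ∉ B from hω])] at hIB
    exact add_right_cancel hIB
  have e2 : ∫ ω in B, compensated f L s ω ∂μ = ∫ ω in B, compensated f L T ω ∂μ :=
    hM.setIntegral_eq hsT hB
  have e3 : ∫ ω in B, (compensated f L (σ ω) ω - compensated f L s ω) ∂μ = 0 := by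
    rw [integral_sub hi.integrableOn (hM.integrable s).integrableOn, e1, e2, sub_self]
  have hA : Integrable (hitValue W q f s T) μ := by
    refine Integrable.of_bound (measurable_hitValue hW hf q s T).aestronglyMeasurable 1
      (Eventually.of_forall fun ω => ?_)
    unfold hitValue
    exact (norm_indicator_le_norm_self _ _).trans (hf1 _)
  have hR := integrable_integral_preHitRate (μ := μ) hW hν hν0 hνC q s T
  rw [← sub_eq_zero, ← integral_sub hA.integrableOn hR.integrableOn, ← e3]
  refine integral_congr_ae (ae_restrict_of_ae ?_)
  filter_upwards [hL] with ω hω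
  exact (compensated_increment hω hfW hLW hqs hsT).symm

/-- The law of the hitting time and the path, weighted by `f(X_S)` on `{q < S ≤ T}`. -/
def hitMeasure (μ : Measure (CadlagPath d)) (W : Set (Euc d)) (q T : ℝ≥0) (f : Euc d → ℝ) :
    Measure (ℝ≥0 × CadlagPath d) :=
  (μ.withDensity fun ω => ENNReal.ofReal (hitValue W q f q T ω)).map
    fun ω => ((hitAfter W q ω).toNNReal, ω)

/-- The compensating measure `1_{q < r < S ∧ T} ν(X_r) dr P(dω)`. -/
def rateMeasure (μ : Measure (CadlagPath d)) (W : Set (Euc d)) (q T : ℝ≥0) (ν : Euc d → ℝ) :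
    Measure (ℝ≥0 × CadlagPath d) :=
  (((volume.restrict (Ioc (q : ℝ) T)).prod μ).withDensity
    fun z => ENNReal.ofReal (preHitRate W q ν z.1 z.2)).map fun z => (z.1.toNNReal, z.2)

theorem hitMeasure_apply {μ : Measure (CadlagPath d)} {f : Euc d → ℝ} {W : Set (Euc d)}
    (hW : IsOpen W) (q T : ℝ≥0) {H : Set (ℝ≥0 × CadlagPath d)}
    (hH : MeasurableSet H) :
    hitMeasure μ W q T f H =
      ∫⁻ ω in {ω | ((hitAfter W q ω).toNNReal, ω) ∈ H}, ENNReal.ofReal (hitValue W q f q T ω) ∂μ := by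
  have h1 : Measurable fun ω : CadlagPath d => ((hitAfter W q ω).toNNReal, ω) :=
    (isOptionalTime_hitAfter hW q).measurable.ennreal_toNNReal.prodMk measurable_id
  rw [hitMeasure, Measure.map_apply h1 hH, withDensity_apply _ (h1 hH)]
  rfl

theorem rateMeasure_apply (hW : IsOpen W) (hν : Measurable ν) (q T : ℝ≥0)
    {H : Set (ℝ≥0 × CadlagPath d)} (hH : MeasurableSet H) :
    rateMeasure μ W q T ν H =
      ∫⁻ ω, (∫⁻ r in Ioc (q : ℝ) T, {r : ℝ | (r.toNNReal, ω) ∈ H}.indicator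
        (fun r => ENNReal.ofReal (preHitRate W q ν r ω)) r) ∂μ := by
  have h1 : Measurable fun z : ℝ × CadlagPath d => (z.1.toNNReal, z.2) :=
    (measurable_real_toNNReal.comp measurable_fst).prodMk measurable_snd
  rw [rateMeasure, Measure.map_apply h1 hH, withDensity_apply _ (h1 hH),
    ← lintegral_indicator (h1 hH), lintegral_prod_symm _
      (((measurable_preHitRate hW hν q).ennreal_ofReal).indicator (h1 hH)).aemeasurable]
  rfl

/-- **Lévy system of the first jump into an open set.** The weighted law of the hitting time of `W`
and the measure built from the jump rate agree on predictable sets: by optional sampling they agree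
on the generating sets `(s, ∞) × B` with `B ∈ 𝓕_s`. -/
theorem hitMeasure_eq_rateMeasure (hW : IsOpen W) (hf : Continuous f) (hf0 : ∀ x, 0 ≤ f x)
    (hf1 : ∀ x, f x ≤ 1)
    (hν : Measurable ν) (hν0 : ∀ x, 0 ≤ ν x) (hνC : ∀ x, ν x ≤ C)
    (hL : ∀ᵐ ω ∂μ, ∀ t : ℝ≥0,
      IntervalIntegrable (fun r : ℝ => L (coordProc r.toNNReal ω)) volume 0 t)
    (hM : Martingale (compensated f L) (natFiltration d) μ)
    (hfW : ∀ x ∉ W, f x = 0) (hLW : ∀ x ∉ W, L x = ν x) (q T : ℝ≥0)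
    {H : Set (ℝ≥0 × CadlagPath d)} (hH : MeasurableSet[(natFiltration d).predictable] H) :
    hitMeasure μ W q T f H = rateMeasure μ W q T ν H := by
  have hfn : ∀ x, ‖f x‖ ≤ 1 := fun x => by rw [Real.norm_of_nonneg (hf0 x)]; exact hf1 x
  have hbot : ∀ A : Set (CadlagPath d), MeasurableSet A →
      hitMeasure μ W q T f ({⊥} ×ˢ A) = 0 ∧ rateMeasure μ W q T ν ({⊥} ×ˢ A) = 0 := by
    intro A hA
    have hm : MeasurableSet (({⊥} : Set ℝ≥0) ×ˢ A) := (measurableSet_singleton _).prod hA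
    constructor
    · rw [hitMeasure_apply hW q T hm]
      refine setLIntegral_eq_zero ((isOptionalTime_hitAfter hW q).measurable.ennreal_toNNReal.prodMk
        measurable_id hm) fun ω hω => ?_
      have h0 : (hitAfter W q ω).toNNReal = 0 := hω.1
      rw [Pi.zero_apply, hitValue, indicator_of_notMem, ENNReal.ofReal_zero]
      rintro ⟨h1, h2⟩
      rcases (ENNReal.toNNReal_eq_zero_iff _).1 h0 with h | h
      · rw [h] at h1; exact not_lt_zero h1
      · rw [h] at h2; exact ENNReal.coe_ne_top (top_le_iff.1 h2)
    · rw [rateMeasure_apply hW hν q T hm]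
      refine (lintegral_congr fun ω => ?_).trans lintegral_zero
      refine setLIntegral_eq_zero measurableSet_Ioc fun r hr => indicator_of_notMem ?_ _
      rintro ⟨h, -⟩
      exact (Real.toNNReal_pos.2 ((NNReal.coe_nonneg q).trans_lt hr.1)).ne' h
  have hIoi : ∀ (s : ℝ≥0) (A : Set (CadlagPath d)), MeasurableSet[natFiltration d s] A →
      hitMeasure μ W q T f (Ioi s ×ˢ A) = rateMeasure μ W q T ν (Ioi s ×ˢ A) := by
    intro s A hA
    have hAm : MeasurableSet A := (natFiltration d).le s _ hA
    have hm : MeasurableSet (Ioi s ×ˢ A) := measurableSet_Ioi.prod hAm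
    set s' : ℝ≥0 := max s q with hs'
    have e1 : hitMeasure μ W q T f (Ioi s ×ˢ A) =
        ∫⁻ ω in A, ENNReal.ofReal (hitValue W q f s' T ω) ∂μ := by
      have hm' : MeasurableSet {ω | ((hitAfter W q ω).toNNReal, ω) ∈ Ioi s ×ˢ A} :=
        (isOptionalTime_hitAfter hW q).measurable.ennreal_toNNReal.prodMk measurable_id hm
      rw [hitMeasure_apply hW q T hm, ← lintegral_indicator hAm, ← lintegral_indicator hm']
      congr 1 with ω
      simp only [indicator, mem_ofPred_eq, mem_prod, mem_Ioi, hitValue]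
      by_cases hA' : ω ∈ A
      swap
      · simp [hA']
      simp only [hA', if_true]
      by_cases hfin : hitAfter W q ω ≤ T
      · have := ENNReal.coe_toNNReal (ne_top_of_le_ne_top ENNReal.coe_ne_top hfin)
        have h2 : ∀ a : ℝ≥0, (a : ℝ≥0∞) < hitAfter W q ω ↔ a < (hitAfter W q ω).toNNReal := by
          intro a; rw [← ENNReal.coe_lt_coe, this]
        simp only [h2, hs', max_lt_iff]
        by_cases h1 : s < (hitAfter W q ω).toNNReal <;> simp [h1, hA']
      · simp [hfin]
    have e2 : rateMeasure μ W q T ν (Ioi s ×ˢ A) =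
        ∫⁻ ω in A, (∫⁻ r in Ioc (s' : ℝ) T, ENNReal.ofReal (preHitRate W q ν r ω)) ∂μ := by
      rw [rateMeasure_apply hW hν q T hm, ← lintegral_indicator hAm]
      congr 1 with ω
      by_cases hA' : ω ∈ A
      · rw [indicator_of_mem hA', ← lintegral_indicator measurableSet_Ioc,
          ← lintegral_indicator measurableSet_Ioc]
        congr 1 with r
        have : r ∈ Ioc (s' : ℝ) T ↔ r ∈ Ioc (q : ℝ) T ∧ s < r.toNNReal := by
          simp only [mem_Ioc, hs', NNReal.coe_max, max_lt_iff, Real.lt_toNNReal_iff_coe_lt]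
          tauto
        simp only [indicator, this, mem_ofPred_eq, mem_prod, mem_Ioi, hA', and_true]
        split_ifs <;> simp_all
      · rw [indicator_of_notMem hA']
        simp [indicator, hA']
    rw [e1, e2]
    rcases lt_or_ge T s' with h | h
    · have h1 : ∀ ω, hitValue W q f s' T ω = 0 := fun ω => indicator_of_notMem
        (fun h' => (h'.1.trans_le h'.2).not_ge (ENNReal.coe_le_coe.2 h.le)) _
      simp [h1, Ioc_eq_empty (not_lt.2 (NNReal.coe_le_coe.2 h.le))]
    have hv0 : ∀ ω, 0 ≤ hitValue W q f s' T ω := fun ω => indicator_nonneg (fun _ _ => hf0 _) _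
    have e3 : ∀ ω, ∫⁻ r in Ioc (s' : ℝ) T, ENNReal.ofReal (preHitRate W q ν r ω) =
        ENNReal.ofReal (∫ r in Ioc (s' : ℝ) T, preHitRate W q ν r ω) := by
      intro ω
      rw [ofReal_integral_eq_lintegral_ofReal ?_ (Eventually.of_forall fun r =>
        preHitRate_nonneg hν0 q r ω)]
      refine Integrable.of_bound ((measurable_preHitRate hW hν q).comp
        (measurable_id.prodMk measurable_const)).aestronglyMeasurable C
        (Eventually.of_forall fun r => ?_)
      rw [Real.norm_of_nonneg (preHitRate_nonneg hν0 q r ω)]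
      exact preHitRate_le hν0 hνC q r ω
    simp only [e3]
    have hI : Integrable (hitValue W q f s' T) μ := by
      refine Integrable.of_bound (measurable_hitValue hW hf q s' T).aestronglyMeasurable 1
        (Eventually.of_forall fun ω => ?_)
      unfold hitValue
      exact (norm_indicator_le_norm_self _ _).trans (hfn _)
    rw [← ofReal_integral_eq_lintegral_ofReal hI.integrableOn (Eventually.of_forall hv0),
      ← ofReal_integral_eq_lintegral_ofReal
        (integrable_integral_preHitRate hW hν hν0 hνC q s' T).integrableOn
        (Eventually.of_forall fun ω => integral_nonneg fun r => preHitRate_nonneg hν0 q r ω),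
      setIntegral_hitValue hW hf hfn hν hν0 hνC hL hM hfW hLW (le_max_right s q) h
        ((natFiltration d).mono (le_max_left s q) _ hA)]
  have hfin : IsFiniteMeasure (hitMeasure μ W q T f) := by
    have : IsFiniteMeasure (μ.withDensity fun ω => ENNReal.ofReal (hitValue W q f q T ω)) := by
      refine isFiniteMeasure_withDensity_ofReal (Integrable.of_bound
        (measurable_hitValue hW hf q q T).aestronglyMeasurable 1
        (Eventually.of_forall fun ω => ?_)).hasFiniteIntegral
      unfold hitValue
      exact (norm_indicator_le_norm_self _ _).trans (hfn _)
    unfold hitMeasure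
    infer_instance
  refine ext_on_measurableSpace_of_generate_finite _ _ ?_ predictable_le_prod rfl ?_ ?_ hH
  · rintro _ (⟨A, hA, rfl⟩ | ⟨s, A, hA, rfl⟩)
    · have := hbot A ((natFiltration d).le _ _ hA)
      rw [this.1, this.2]
    · exact hIoi s A hA
  · rintro _ (⟨A, hA, rfl⟩ | ⟨s, A, hA, rfl⟩) _ (⟨B, hB, rfl⟩ | ⟨t, B, hB, rfl⟩) -
    · exact Or.inl ⟨A ∩ B, hA.inter hB, by rw [prod_inter_prod, inter_self]⟩
    · refine Or.inl ⟨∅, @MeasurableSet.empty _ (natFiltration d ⊥), ?_⟩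
      rw [prod_inter_prod, show ({⊥} : Set ℝ≥0) ∩ Ioi t = ∅ by ext; simp]; simp
    · refine Or.inl ⟨∅, @MeasurableSet.empty _ (natFiltration d ⊥), ?_⟩
      rw [prod_inter_prod, show Ioi s ∩ ({⊥} : Set ℝ≥0) = ∅ by
        ext x; simp only [mem_inter_iff, mem_Ioi, mem_singleton_iff, mem_empty_iff_false,
          iff_false, not_and]; rintro h rfl; exact not_lt_bot h]; simp
    · refine Or.inr ⟨max s t, A ∩ B, ?_, by rw [prod_inter_prod, Ioi_inter_Ioi]⟩
      exact ((natFiltration d).mono (le_max_left s t) _ hA).inter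
        ((natFiltration d).mono (le_max_right s t) _ hB)
  · have hu : (univ : Set (ℝ≥0 × CadlagPath d)) = {⊥} ×ˢ univ ∪ Ioi ⊥ ×ˢ univ := by
      rw [← union_prod]
      ext z
      simp
    have hd : Disjoint (({⊥} : Set ℝ≥0) ×ˢ (univ : Set (CadlagPath d))) (Ioi ⊥ ×ˢ univ) :=
      Disjoint.set_prod_left (by simp) _ _
    rw [hu, measure_union hd (measurableSet_Ioi.prod .univ),
      measure_union hd (measurableSet_Ioi.prod .univ), (hbot _ .univ).1, (hbot _ .univ).2,
      hIoi ⊥ univ MeasurableSet.univ]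

/-- A predictable set at all but countably many of whose times the jump rate vanishes almost surely
does not contain the hitting time of `W`, on the event that `f > 0` at this time. -/
theorem ae_hitAfter_notMem_predictable (hW : IsOpen W) (hf : Continuous f) (hf0 : ∀ x, 0 ≤ f x)
    (hf1 : ∀ x, f x ≤ 1)
    (hν : Measurable ν) (hν0 : ∀ x, 0 ≤ ν x) (hνC : ∀ x, ν x ≤ C)
    (hL : ∀ᵐ ω ∂μ, ∀ t : ℝ≥0,
      IntervalIntegrable (fun r : ℝ => L (coordProc r.toNNReal ω)) volume 0 t)
    (hM : Martingale (compensated f L) (natFiltration d) μ)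
    (hfW : ∀ x ∉ W, f x = 0) (hLW : ∀ x ∉ W, L x = ν x) (q : ℝ≥0)
    {H : Set (ℝ≥0 × CadlagPath d)} (hH : MeasurableSet[(natFiltration d).predictable] H)
    (hnull : ∀ ω, {r : ℝ≥0 | (r, ω) ∈ H ∧ ν (coordProc r ω) ≠ 0}.Countable) :
    ∀ᵐ ω ∂μ, ∀ s : ℝ≥0, hitAfter W q ω = s → q < s → (s, ω) ∈ H → f (coordProc s ω) = 0 := by
  have hHm : MeasurableSet H := predictable_le_prod _ hH
  have hT : ∀ T : ℕ, ∀ᵐ ω ∂μ, ((hitAfter W q ω).toNNReal, ω) ∈ H →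
      ENNReal.ofReal (hitValue W q f q T ω) = 0 := by
    intro T
    have h0 := hitMeasure_eq_rateMeasure hW hf hf0 hf1 hν hν0 hνC hL hM hfW hLW q (T : ℝ≥0) hH
    rw [hitMeasure_apply hW q T hHm, rateMeasure_apply hW hν q T hHm] at h0
    have hR : ∫⁻ ω, (∫⁻ r in Ioc (q : ℝ) (T : ℝ≥0), {r : ℝ | (r.toNNReal, ω) ∈ H}.indicator
        (fun r => ENNReal.ofReal (preHitRate W q ν r ω)) r) ∂μ = 0 := by
      refine (lintegral_congr fun ω => ?_).trans lintegral_zero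
      have hc : ((fun r : ℝ≥0 => (r : ℝ)) ''
          {r : ℝ≥0 | (r, ω) ∈ H ∧ ν (coordProc r ω) ≠ 0}).Countable := (hnull ω).image _
      refine (lintegral_congr_ae ?_).trans lintegral_zero
      filter_upwards [ae_restrict_of_ae (hc.ae_notMem volume), ae_restrict_mem measurableSet_Ioc]
        with r hr hrI
      have hr0 : 0 ≤ r := (NNReal.coe_nonneg q).trans hrI.1.le
      by_cases hrH : (r.toNNReal, ω) ∈ H
      · rw [indicator_of_mem (by exact hrH)]
        have : ν (coordProc r.toNNReal ω) = 0 := by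
          by_contra hne
          exact hr ⟨r.toNNReal, ⟨hrH, hne⟩, Real.coe_toNNReal r hr0⟩
        simp [preHitRate, indicator, this]
      · exact indicator_of_notMem (by exact hrH) _
    rw [hR] at h0
    have hm' : MeasurableSet {ω | ((hitAfter W q ω).toNNReal, ω) ∈ H} :=
      (isOptionalTime_hitAfter hW q).measurable.ennreal_toNNReal.prodMk measurable_id hHm
    rw [lintegral_eq_zero_iff (measurable_hitValue hW hf q q T).ennreal_ofReal] at h0
    exact (ae_restrict_iff' hm').1 h0
  filter_upwards [ae_all_iff.2 hT] with ω hω s hs hqs hsH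
  obtain ⟨T, hsT⟩ := exists_nat_ge s
  have h1 := hω T (by rw [hs]; exact hsH)
  rw [hitValue, indicator_of_mem, hs, ENNReal.toNNReal_coe, ENNReal.ofReal_eq_zero] at h1
  · exact le_antisymm h1 (hf0 _)
  · rw [mem_ofPred_eq, hs]
    exact ⟨ENNReal.coe_lt_coe.2 hqs, ENNReal.coe_le_coe.2 hsT⟩

/-- Almost surely the process does not enter `{f > 0}` by a jump from a point where the jump rate
vanishes. -/
theorem ae_hitAfter_leftCoord (hW : IsOpen W) (hf : Continuous f) (hf0 : ∀ x, 0 ≤ f x)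
    (hf1 : ∀ x, f x ≤ 1)
    (hν : Measurable ν) (hν0 : ∀ x, 0 ≤ ν x) (hνC : ∀ x, ν x ≤ C)
    (hL : ∀ᵐ ω ∂μ, ∀ t : ℝ≥0,
      IntervalIntegrable (fun r : ℝ => L (coordProc r.toNNReal ω)) volume 0 t)
    (hM : Martingale (compensated f L) (natFiltration d) μ)
    (hfW : ∀ x ∉ W, f x = 0) (hLW : ∀ x ∉ W, L x = ν x) (q : ℝ≥0) :
    ∀ᵐ ω ∂μ, ∀ s : ℝ≥0, hitAfter W q ω = s → q < s → ν (leftCoord s ω) = 0 →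
      f (coordProc s ω) = 0 :=
  ae_hitAfter_notMem_predictable hW hf hf0 hf1 hν hν0 hνC hL hM hfW hLW q
    (H := {z | ν (leftCoord z.1 z.2) = 0})
    ((hν.comp measurable_leftCoord_predictable) (measurableSet_singleton 0))
    fun ω => (countable_jumps ω).mono fun _ hr h => hr.2 ((congrArg ν h).symm.trans hr.1)

/-- Almost surely the first entry into `W`, when it is announced by optional times (all smaller, with
supremum equal to it), is not an entry into `{f > 0}`. -/
theorem ae_hitAfter_ne_iSup (hW : IsOpen W) (hf : Continuous f) (hf0 : ∀ x, 0 ≤ f x)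
    (hf1 : ∀ x, f x ≤ 1)
    (hν : Measurable ν) (hν0 : ∀ x, 0 ≤ ν x) (hνC : ∀ x, ν x ≤ C)
    (hL : ∀ᵐ ω ∂μ, ∀ t : ℝ≥0,
      IntervalIntegrable (fun r : ℝ => L (coordProc r.toNNReal ω)) volume 0 t)
    (hM : Martingale (compensated f L) (natFiltration d) μ)
    (hfW : ∀ x ∉ W, f x = 0) (hLW : ∀ x ∉ W, L x = ν x) (q : ℝ≥0)
    {σ : ℕ → CadlagPath d → ℝ≥0∞} (hσ : ∀ k, IsOptionalTime (natFiltration d) (σ k)) :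
    ∀ᵐ ω ∂μ, ∀ s : ℝ≥0, hitAfter W q ω = s → q < s → (∀ k, σ k ω < s) → ⨆ k, σ k ω = s →
      f (coordProc s ω) = 0 := by
  refine (ae_hitAfter_notMem_predictable hW hf hf0 hf1 hν hν0 hνC hL hM hfW hLW q
    (H := (⋂ k, {z | σ k z.2 < z.1}) ∩ {z | ⨆ k, σ k z.2 < z.1}ᶜ) ?_ fun ω => ?_).mono
    fun ω hω s h1 h2 h3 h4 => hω s h1 h2 ⟨mem_iInter.2 h3, ?_⟩
  · exact (MeasurableSet.iInter fun k => (hσ k).measurableSet_predictable_lt).inter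
      (IsOptionalTime.iSup hσ).measurableSet_predictable_lt.compl
  · refine Set.Subsingleton.countable ?_
    have : ∀ r : ℝ≥0, (r, ω) ∈ (⋂ k, {z : ℝ≥0 × CadlagPath d | σ k z.2 < z.1}) ∩
        {z | ⨆ k, σ k z.2 < z.1}ᶜ → (r : ℝ≥0∞) = ⨆ k, σ k ω := fun r hr =>
      le_antisymm (not_lt.1 hr.2) (iSup_le fun k => (mem_iInter.1 hr.1 k).le)
    intro _ hr _ hr'
    exact ENNReal.coe_inj.1 ((this _ hr.1).trans (this _ hr'.1).symm)
  · exact not_lt.2 h4.ge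

end LevySystem

/-! ### Jumps of solutions of the martingale problem -/

section Jumps

variable {d : ℕ}

/-- A smooth bump function equal to one near `z` and positive exactly on the ball of radius `ρ`. -/
def ballBump (z : Euc d) {ρ : ℝ} (hρ : 0 < ρ) : ContDiffBump z :=
  ⟨ρ / 2, ρ, half_pos hρ, half_lt_self hρ⟩

theorem ballBump_eq_zero {z : Euc d} {ρ : ℝ} (hρ : 0 < ρ) {x : Euc d} (hx : x ∉ Metric.ball z ρ) :
    ballBump z hρ x = 0 := by
  have h : x ∉ Function.support (ballBump z hρ) := by
    rw [ContDiffBump.support_eq]; exact hx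
  simpa using h

theorem ballBump_ne_zero {z : Euc d} {ρ : ℝ} (hρ : 0 < ρ) {x : Euc d} (hx : x ∈ Metric.ball z ρ) :
    ballBump z hρ x ≠ 0 := by
  have h : x ∈ Function.support (ballBump z hρ) := by
    rw [ContDiffBump.support_eq]; exact hx
  exact h

theorem isCb2_ballBump (z : Euc d) {ρ : ℝ} (hρ : 0 < ρ) : IsCb2 (ballBump z hρ) := by
  have hs : HasCompactSupport (ballBump z hρ) := (ballBump z hρ).hasCompactSupport
  have hc : ContDiff ℝ 2 (ballBump z hρ) := (ballBump z hρ).contDiff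
  refine ⟨hc, ?_⟩
  obtain ⟨C0, h0⟩ := hs.exists_bound_of_continuous hc.continuous
  obtain ⟨C1, h1⟩ := (hs.fderiv ℝ).exists_bound_of_continuous (hc.continuous_fderiv (by norm_num))
  obtain ⟨C2, h2⟩ := (hs.iteratedFDeriv (𝕜 := ℝ) 2).exists_bound_of_continuous
    (hc.continuous_iteratedFDeriv (m := 2) (by norm_num))
  refine ⟨max C0 (max C1 C2), fun x => ⟨(h0 x).trans (le_max_left _ _), (h1 x).trans ?_,
    (h2 x).trans ?_⟩⟩
  · exact (le_max_left _ _).trans (le_max_right _ _)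
  · exact (le_max_right _ _).trans (le_max_right _ _)

/-- The rate `∫ f(x + y) N(x, dy)` of jumps of size at least `ρ` into the ball of radius `ρ`
around `z`, weighted by the bump function `f`; it is set to zero on the ball of radius `2ρ`. -/
def bumpRate (N : Kernel (Euc d) (Euc d)) (z : Euc d) {ρ : ℝ} (hρ : 0 < ρ) : Euc d → ℝ :=
  (Metric.ball z (2 * ρ))ᶜ.indicator fun x => ∫ y in {y | ρ ≤ ‖y‖}, ballBump z hρ (x + y) ∂(N x)

variable {N : Kernel (Euc d) (Euc d)}

/-- The Lévy measures of jumps of size at least `ρ` are uniformly bounded. -/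
theorem LevyKernelCondition.exists_bound (hN : LevyKernelCondition N) {ρ : ℝ} (hρ : 0 < ρ) :
    ∃ C : ℝ≥0, ∀ x, N x {y | ρ ≤ ‖y‖} ≤ C := by
  obtain ⟨-, C, hC⟩ := hN
  have hδ : (0 : ℝ) < min 1 (ρ ^ 2) := by positivity
  refine ⟨C / (min 1 (ρ ^ 2)).toNNReal, fun x => ?_⟩
  have hδ' : (min 1 (ρ ^ 2)).toNNReal ≠ 0 := (Real.toNNReal_pos.2 hδ).ne'
  rw [ENNReal.coe_div hδ']
  have h1 : {y : Euc d | ρ ≤ ‖y‖} ⊆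
      {y | ENNReal.ofReal (min 1 (ρ ^ 2)) ≤ ENNReal.ofReal (min 1 (‖y‖ ^ 2))} := fun y hy => by
    refine ENNReal.ofReal_le_ofReal (min_le_min le_rfl ?_)
    exact pow_le_pow_left₀ hρ.le hy 2
  refine (measure_mono h1).trans ((meas_ge_le_lintegral_div ?_ ?_ ENNReal.ofReal_ne_top).trans
    (ENNReal.div_le_div_right (hC x) _))
  · fun_prop
  · simpa using hρ.ne'

theorem bumpRate_nonneg (z : Euc d) {ρ : ℝ} (hρ : 0 < ρ) (x : Euc d) : 0 ≤ bumpRate N z hρ x :=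
  indicator_nonneg (fun _ _ => integral_nonneg fun _ => (ballBump z hρ).nonneg) _

theorem bumpRate_le (hN : LevyKernelCondition N) (z : Euc d) {ρ : ℝ} (hρ : 0 < ρ) :
    ∃ C : ℝ, ∀ x, bumpRate N z hρ x ≤ C := by
  obtain ⟨C, hC⟩ := hN.exists_bound hρ
  refine ⟨C, fun x => indicator_apply_le' (fun _ => ?_) fun _ => C.2⟩
  refine (Real.le_norm_self _).trans ((norm_setIntegral_le_of_norm_le_const (C := 1)
    ((hC x).trans_lt ENNReal.coe_lt_top) fun y _ => ?_).trans ?_)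
  · rw [Real.norm_of_nonneg (ballBump z hρ).nonneg]
    exact (ballBump z hρ).le_one
  · rw [one_mul]
    exact ENNReal.toReal_le_coe_of_le_coe (hC x)

theorem measurable_bumpRate (hN : LevyKernelCondition N) (z : Euc d) {ρ : ℝ} (hρ : 0 < ρ) :
    Measurable (bumpRate N z hρ) := by
  have hs : MeasurableSet {y : Euc d | ρ ≤ ‖y‖} := measurableSet_le measurable_const measurable_norm
  have : IsFiniteKernel (N.restrict hs) := by
    obtain ⟨C, hC⟩ := hN.exists_bound hρ
    refine ⟨C, ENNReal.coe_lt_top, fun x => ?_⟩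
    rw [Kernel.restrict_apply, Measure.restrict_apply_univ]
    exact hC x
  refine Measurable.indicator ?_ Metric.isOpen_ball.measurableSet.compl
  have h : StronglyMeasurable (Function.uncurry fun x y : Euc d => ballBump z hρ (x + y)) := by
    refine ((ballBump z hρ).continuous.comp ?_).stronglyMeasurable
    exact continuous_fst.add continuous_snd
  simpa only [Kernel.restrict_apply] using
    (h.integral_kernel_prod_right (κ := N.restrict hs)).measurable

theorem bumpRate_eq_zero (z : Euc d) {ρ : ℝ} (hρ : 0 < ρ) {x : Euc d}
    (hx : N x {y | x + y ∈ Metric.ball z ρ} = 0) : bumpRate N z hρ x = 0 := by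
  refine indicator_apply_eq_zero.2 fun _ => integral_eq_zero_of_ae (ae_restrict_of_ae ?_)
  filter_upwards [measure_eq_zero_iff_ae_notMem.1 hx] with y hy using ballBump_eq_zero hρ hy

/-- Away from the support of the bump function the operator reduces to its jump part. -/
theorem levyOperator_ballBump (Q : Euc d → Matrix (Fin d) (Fin d) ℝ) (b : Euc d → Euc d)
    (z : Euc d) {ρ : ℝ} (hρ : 0 < ρ) {x : Euc d} (hx : x ∉ Metric.ball z (2 * ρ)) :
    levyOperator Q b N (ballBump z hρ) x = bumpRate N z hρ x := by
  have hdist : 2 * ρ ≤ dist x z := not_lt.1 hx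
  have h0 : (ballBump z hρ : Euc d → ℝ) =ᶠ[𝓝 x] fun _ => 0 := by
    filter_upwards [Metric.ball_mem_nhds x hρ] with w hw
    refine ballBump_eq_zero hρ fun hw' => ?_
    have := dist_triangle_left x z w
    rw [Metric.mem_ball] at hw hw'
    linarith
  have h1 : fderiv ℝ (ballBump z hρ) x = 0 := by rw [h0.fderiv_eq]; simp
  have h2 : iteratedFDeriv ℝ 2 (ballBump z hρ) x = 0 := by
    rw [(h0.iteratedFDeriv ℝ 2).eq_of_nhds]
    simp
  have h3 : ballBump z hρ x = 0 := h0.eq_of_nhds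
  rw [levyOperator, bumpRate, indicator_of_mem (by exact hx)]
  simp only [h1, h2, h3, zero_apply, mul_zero, Finset.sum_const_zero, zero_div, sub_zero, add_zero,
    zero_add]
  refine (setIntegral_eq_integral_of_forall_compl_eq_zero fun y hy => ?_).symm
  refine ballBump_eq_zero hρ fun hw => ?_
  have hy' : ‖y‖ < ρ := not_le.1 hy
  have h4 := dist_triangle x (x + y) z
  rw [dist_self_add_right] at h4
  rw [Metric.mem_ball] at hw
  linarith

variable {Q : Euc d → Matrix (Fin d) (Fin d) ℝ} {b : Euc d → Euc d} {μ₀ : Measure (Euc d)}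
  {μ : Measure (CadlagPath d)}

/-- Almost surely the first entry into the ball of radius `2ρ` around `z` is not a jump into the
ball of radius `ρ` from a point whose Lévy measure does not charge such jumps. -/
theorem IsMartingaleSolution.ae_notMem_ball (hμ : IsMartingaleSolution Q b N μ₀ μ)
    (hN : LevyKernelCondition N) (z : Euc d) {ρ : ℝ} (hρ : 0 < ρ) (q : ℝ≥0) :
    ∀ᵐ ω ∂μ, ∀ s : ℝ≥0, hitAfter (Metric.ball z (2 * ρ)) q ω = s → q < s →
      N (leftCoord s ω) {y | leftCoord s ω + y ∈ Metric.ball z ρ} = 0 →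
      coordProc s ω ∉ Metric.ball z ρ := by
  have := hμ.prob
  obtain ⟨C, hC⟩ := bumpRate_le hN z hρ
  obtain ⟨hL, hM⟩ := hμ.mart _ (isCb2_ballBump z hρ)
  filter_upwards [ae_hitAfter_leftCoord (C := C) (f := ballBump z hρ)
    (L := levyOperator Q b N (ballBump z hρ)) (ν := bumpRate N z hρ) Metric.isOpen_ball
    (ballBump z hρ).continuous (fun _ => (ballBump z hρ).nonneg) (fun _ => (ballBump z hρ).le_one)
    (measurable_bumpRate hN z hρ) (bumpRate_nonneg z hρ) hC hL hM
    (fun x hx => ballBump_eq_zero hρ fun h => hx (Metric.ball_subset_ball (by linarith) h))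
    (fun x hx => levyOperator_ballBump Q b z hρ hx) q] with ω hω s h1 h2 h3 h4
  exact ballBump_ne_zero hρ h4 (hω s h1 h2 (bumpRate_eq_zero z hρ h3))

/-- Almost surely the first entry into the ball of radius `2ρ` around `z`, when announced by optional
times, is not a jump into the ball of radius `ρ`. -/
theorem IsMartingaleSolution.ae_notMem_ball_of_iSup (hμ : IsMartingaleSolution Q b N μ₀ μ)
    (hN : LevyKernelCondition N) (z : Euc d) {ρ : ℝ} (hρ : 0 < ρ) (q : ℝ≥0)
    {σ : ℕ → CadlagPath d → ℝ≥0∞} (hσ : ∀ k, IsOptionalTime (natFiltration d) (σ k)) :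
    ∀ᵐ ω ∂μ, ∀ s : ℝ≥0, hitAfter (Metric.ball z (2 * ρ)) q ω = s → q < s →
      (∀ k, σ k ω < s) → ⨆ k, σ k ω = s → coordProc s ω ∉ Metric.ball z ρ := by
  have := hμ.prob
  obtain ⟨C, hC⟩ := bumpRate_le hN z hρ
  obtain ⟨hL, hM⟩ := hμ.mart _ (isCb2_ballBump z hρ)
  filter_upwards [ae_hitAfter_ne_iSup (C := C) (f := ballBump z hρ)
    (L := levyOperator Q b N (ballBump z hρ)) (ν := bumpRate N z hρ) Metric.isOpen_ball
    (ballBump z hρ).continuous (fun _ => (ballBump z hρ).nonneg) (fun _ => (ballBump z hρ).le_one)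
    (measurable_bumpRate hN z hρ) (bumpRate_nonneg z hρ) hC hL hM
    (fun x hx => ballBump_eq_zero hρ fun h => hx (Metric.ball_subset_ball (by linarith) h))
    (fun x hx => levyOperator_ballBump Q b z hρ hx) q hσ] with ω hω s h1 h2 h3 h4 h5
  exact ballBump_ne_zero hρ h5 (hω s h1 h2 h3 h4)

/-- **Quasi-left continuity.** Almost surely there is no jump at a time announced by optional
times. -/
theorem IsMartingaleSolution.quasiLeftContinuous (hμ : IsMartingaleSolution Q b N μ₀ μ)
    (hN : LevyKernelCondition N)
    {σ : ℕ → CadlagPath d → ℝ≥0∞} (hσ : ∀ k, IsOptionalTime (natFiltration d) (σ k)) :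
    ∀ᵐ ω ∂μ, ∀ s : ℝ≥0, (∀ k, σ k ω < s) → ⨆ k, σ k ω = s → leftCoord s ω = coordProc s ω := by
  have hall : ∀ᵐ ω ∂μ, ∀ (n j : ℕ) (q : ℚ), ∀ s : ℝ≥0,
      hitAfter (Metric.ball (TopologicalSpace.denseSeq (Euc d) n) (2 * (1 / ((j : ℝ) + 1))))
        (Real.toNNReal q) ω = s → Real.toNNReal q < s → (∀ k, σ k ω < s) → ⨆ k, σ k ω = s →
      coordProc s ω ∉ Metric.ball (TopologicalSpace.denseSeq (Euc d) n) (1 / ((j : ℝ) + 1)) :=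
    ae_all_iff.2 fun n => ae_all_iff.2 fun j => ae_all_iff.2 fun q =>
      hμ.ae_notMem_ball_of_iSup hN _ (by positivity) _ hσ
  filter_upwards [hall] with ω hω s h1 h2
  by_contra hne
  have hs0 : 0 < s := by
    have := (zero_le (a := σ 0 ω)).trans_lt (h1 0)
    exact_mod_cast this
  obtain ⟨j, hj⟩ := exists_nat_one_div_lt (show 0 < dist (leftCoord s ω) (coordProc s ω) / 4 by
    have := dist_pos.2 hne; positivity)
  set ρ : ℝ := 1 / ((j : ℝ) + 1) with hρ
  have hρ0 : 0 < ρ := by positivity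
  obtain ⟨n, hn⟩ := (TopologicalSpace.denseRange_denseSeq (Euc d)).exists_dist_lt (coordProc s ω) hρ0
  set z := TopologicalSpace.denseSeq (Euc d) n
  have hfar : 2 * ρ < dist (leftCoord s ω) z := by
    have := dist_triangle_right (leftCoord s ω) (coordProc s ω) z
    linarith
  -- just before `s` the path stays away from the ball of radius `2ρ` around `z`
  have hev : ∀ᶠ r in 𝓝[<] s, 2 * ρ < dist (coordProc r ω) z :=
    ((tendsto_leftCoord s ω).dist tendsto_const_nhds).eventually (lt_mem_nhds hfar)
  obtain ⟨u, hu, hI⟩ := (mem_nhdsLT_iff_exists_Ioo_subset' hs0).1 hev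
  obtain ⟨q, -, hq1, hq2⟩ := (NNReal.lt_iff_exists_rat_btwn u s).1 hu
  refine hω n j q s (le_antisymm (hitAfter_le hq2.le ?_) (le_hitAfter fun r hr hrW => ?_)) hq2 h1 h2
    hn
  · exact Metric.ball_subset_ball (by linarith) hn
  · by_contra hlt
    have hlt' : r < s := ENNReal.coe_lt_coe.1 (not_le.1 hlt)
    have h5 : 2 * ρ < dist (coordProc r ω) z := hI ⟨hq1.trans_le hr, hlt'⟩
    exact absurd hrW (not_lt.2 h5.le)

/-! ### The exit time and the exit position -/

variable {D : Set (Euc d)}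

theorem coordProc_mem_of_lt_exitTime {ω : CadlagPath d} {r : ℝ≥0} (hr : 0 < r)
    (h : (r : ℝ≥0∞) < exitTime D ω) : coordProc r ω ∈ D := by
  by_contra hD
  exact (iInf₂_le (f := fun (s : ℝ≥0) (_ : 0 < s ∧ coordProc s ω ∉ D) => (s : ℝ≥0∞)) r
    ⟨hr, hD⟩).not_gt h

theorem exitTime_lt_of_mem {ω : CadlagPath d} (hD : IsOpen D) {s : ℝ≥0} (hs : coordProc s ω ∈ D)
    (h : (s : ℝ≥0∞) ≤ exitTime D ω) : (s : ℝ≥0∞) < exitTime D ω := by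
  have h1 : ∀ᶠ t in 𝓝[≥] s, coordProc t ω ∈ D :=
    (ω.2 s).1.tendsto.eventually (hD.mem_nhds hs)
  obtain ⟨u, hu, hI⟩ := (mem_nhdsGE_iff_exists_Ico_subset' (lt_add_one s)).1 h1
  refine (ENNReal.coe_lt_coe.2 hu).trans_le (le_iInf₂ fun r hr => ?_)
  by_contra hlt
  have hlt' : r < u := ENNReal.coe_lt_coe.1 (not_le.1 hlt)
  have hsr : s ≤ r := by
    have : (s : ℝ≥0∞) ≤ r := h.trans (iInf₂_le r hr)
    exact_mod_cast this
  exact hr.2 (hI ⟨hsr, hlt'⟩)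

theorem exitTime_pos {ω : CadlagPath d} (hD : IsOpen D) (h : coordProc 0 ω ∈ D) :
    0 < exitTime D ω := by
  simpa using exitTime_lt_of_mem hD h (by simp)

theorem coordProc_exitTime_notMem {ω : CadlagPath d} (hD : IsOpen D) {s : ℝ≥0}
    (h : exitTime D ω = s) : coordProc s ω ∉ D := fun hs =>
  (exitTime_lt_of_mem hD hs h.ge).ne' h

theorem coordProc_hitAfter_mem_closure {W : Set (Euc d)} {q s : ℝ≥0} {ω : CadlagPath d}
    (h : hitAfter W q ω = s) : coordProc s ω ∈ closure W := by
  rw [mem_closure_iff_nhds]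
  intro U hU
  have h1 : ∀ᶠ t in 𝓝[≥] s, coordProc t ω ∈ U := (ω.2 s).1.tendsto.eventually hU
  obtain ⟨u, hu, hI⟩ := (mem_nhdsGE_iff_exists_Ico_subset' (lt_add_one s)).1 h1
  obtain ⟨r, hqr, hrW, hru⟩ := hitAfter_lt_iff.1 (h.trans_lt (ENNReal.coe_lt_coe.2 hu))
  have hsr : s ≤ r := by
    have : (s : ℝ≥0∞) ≤ r := h ▸ hitAfter_le hqr hrW
    exact_mod_cast this
  exact ⟨_, hI ⟨hsr, ENNReal.coe_lt_coe.1 hru⟩, hrW⟩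

theorem IsMartingaleSolution.ae_coordProc_zero {x : Euc d}
    (hμ : IsMartingaleSolution Q b N (Measure.dirac x) μ) : ∀ᵐ ω ∂μ, coordProc 0 ω = x := by
  have h : ∀ᵐ y ∂(μ.map (coordProc 0)), y = x := by
    rw [hμ.init, ae_dirac_eq]; rfl
  exact ae_of_ae_map (measurable_coordProc 0).aemeasurable h

/-- **Exit position.** Started in the open set `D`, the process leaves `D` almost surely through the
extended boundary. A jump out of the closure of `D` starts from a point of `D`, because the jump
from a boundary point would happen at a time announced by the hitting times of
the neighbourhoods of `Dᶜ`; and a jump from a point of `D` follows the support of the Lévy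
measure. -/
theorem IsMartingaleSolution.ae_exit_mem_extDomain (hN : LevyKernelCondition N) (hD : IsOpen D)
    {x : Euc d} (hx : x ∈ D) (hμ : IsMartingaleSolution Q b N (Measure.dirac x) μ) :
    ∀ᵐ ω ∂μ, ∀ s : ℝ≥0, exitTime D ω = s → coordProc s ω ∈ extDomain N D := by
  have hall : ∀ᵐ ω ∂μ, ∀ n j : ℕ, ∀ s : ℝ≥0,
      hitAfter (Metric.ball (TopologicalSpace.denseSeq (Euc d) n) (2 * (1 / ((j : ℝ) + 1))))
        0 ω = s → 0 < s → N (leftCoord s ω) {y | leftCoord s ω + y ∈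
          Metric.ball (TopologicalSpace.denseSeq (Euc d) n) (1 / ((j : ℝ) + 1))} = 0 →
      coordProc s ω ∉ Metric.ball (TopologicalSpace.denseSeq (Euc d) n) (1 / ((j : ℝ) + 1)) :=
    ae_all_iff.2 fun n => ae_all_iff.2 fun j => hμ.ae_notMem_ball hN _ (by positivity) _
  set O : ℕ → Set (Euc d) := fun k => {y | Metric.infDist y Dᶜ < 1 / ((k : ℝ) + 1)} with hO
  have hOo : ∀ k, IsOpen (O k) := fun k =>
    isOpen_lt (Metric.continuous_infDist_pt _) continuous_const
  have hq := hμ.quasiLeftContinuous hN (σ := fun k => hitAfter (O k) 0)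
    (fun k => isOptionalTime_hitAfter (hOo k) 0)
  filter_upwards [hall, hq, hμ.ae_coordProc_zero] with ω hω hqω hω0 s hs
  have h0D : coordProc 0 ω ∈ D := hω0 ▸ hx
  have hs0 : 0 < s := by
    have := exitTime_pos hD h0D
    rw [hs] at this
    exact_mod_cast this
  have hin : ∀ r < s, coordProc r ω ∈ D := by
    intro r hr
    rcases eq_or_ne r 0 with rfl | h
    · exact h0D
    · exact coordProc_mem_of_lt_exitTime (pos_iff_ne_zero.2 h) (hs ▸ ENNReal.coe_lt_coe.2 hr)
  have hout : coordProc s ω ∉ D := coordProc_exitTime_notMem hD hs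
  by_contra hext
  have hncl : coordProc s ω ∉ closure D := fun hcl =>
    hext (Or.inl (Or.inl ⟨hcl, by rwa [hD.interior_eq]⟩))
  have : (𝓝[<] s).NeBot := nhdsLT_neBot_of_exists_lt ⟨0, hs0⟩
  have hlcl : leftCoord s ω ∈ closure D := mem_closure_of_tendsto (tendsto_leftCoord s ω)
    (by filter_upwards [self_mem_nhdsWithin] with r hr using hin r hr)
  have hDc : (Dᶜ).Nonempty := ⟨_, hout⟩
  by_cases hl : leftCoord s ω ∈ D
  · -- a jump from inside `D` against the support of the Lévy measure
    have hsupp : coordProc s ω - leftCoord s ω ∉ (N (leftCoord s ω)).support := fun h =>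
      hext (Or.inl (Or.inr ⟨mem_iUnion₂.2 ⟨_, hl, _, h, by simp⟩, hout⟩))
    obtain ⟨U, hU, hU0⟩ := Measure.notMem_support_iff_exists.1 hsupp
    have hU' : {w | w - leftCoord s ω ∈ U} ∩ (closure D)ᶜ ∈ 𝓝 (coordProc s ω) :=
      inter_mem ((continuous_id.sub continuous_const).continuousAt.preimage_mem_nhds hU)
        (isClosed_closure.isOpen_compl.mem_nhds hncl)
    obtain ⟨ε, hε, hball⟩ := Metric.mem_nhds_iff.1 hU'
    obtain ⟨j, hj⟩ := exists_nat_one_div_lt (show 0 < ε / 3 by positivity)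
    set ρ : ℝ := 1 / ((j : ℝ) + 1) with hρ
    have hρ0 : 0 < ρ := by positivity
    obtain ⟨n, hn⟩ := (TopologicalSpace.denseRange_denseSeq (Euc d)).exists_dist_lt
      (coordProc s ω) hρ0
    set z := TopologicalSpace.denseSeq (Euc d) n
    have hsub : Metric.ball z (2 * ρ) ⊆ Metric.ball (coordProc s ω) ε :=
      Metric.ball_subset_ball' (by rw [dist_comm]; linarith)
    refine hω n j s (le_antisymm (hitAfter_le zero_le ?_) (le_hitAfter fun r _ hrW => ?_)) hs0
      (measure_mono_null (fun y hy => ?_) hU0) hn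
    · exact Metric.ball_subset_ball (by linarith) hn
    · by_contra hlt
      have hlt' : r < s := ENNReal.coe_lt_coe.1 (not_le.1 hlt)
      exact (hball (hsub hrW)).2 (subset_closure (hin r hlt'))
    · simpa using (hball (hsub (Metric.ball_subset_ball (by linarith) hy))).1
  · -- the left limit lies on the boundary
    have hσs : ∀ k, hitAfter (O k) 0 ω < s := by
      intro k
      have h1 : leftCoord s ω ∈ O k := by
        simp only [hO, mem_ofPred_eq, Metric.infDist_zero_of_mem (show leftCoord s ω ∈ Dᶜ from hl)]
        positivity
      have h2 : ∀ᶠ r in 𝓝[<] s, coordProc r ω ∈ O k :=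
        (tendsto_leftCoord s ω).eventually ((hOo k).mem_nhds h1)
      obtain ⟨r, hrO, hrs⟩ := (h2.and self_mem_nhdsWithin).exists
      exact (hitAfter_le zero_le hrO).trans_lt (ENNReal.coe_lt_coe.2 hrs)
    have hsup : ⨆ k, hitAfter (O k) 0 ω ≤ s := iSup_le fun k => (hσs k).le
    obtain ⟨t, ht⟩ : ∃ t : ℝ≥0, (t : ℝ≥0∞) = ⨆ k, hitAfter (O k) 0 ω :=
      ⟨_, ENNReal.coe_toNNReal (ne_top_of_le_ne_top ENNReal.coe_ne_top hsup)⟩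
    have hts : t ≤ s := by rw [← ht] at hsup; exact_mod_cast hsup
    rcases hts.eq_or_lt with rfl | hlt
    · exact hncl (hqω t hσs ht.symm ▸ hlcl)
    · have htD : coordProc t ω ∈ D := hin t hlt
      choose σ hσ using fun k => show ∃ t : ℝ≥0, (t : ℝ≥0∞) = hitAfter (O k) 0 ω from
        ⟨_, ENNReal.coe_toNNReal (hσs k).ne_top⟩
      have hσt : ∀ k, σ k ≤ t := fun k => by
        have := le_iSup (fun k => hitAfter (O k) 0 ω) k
        rw [← ht] at this
        simp only [← hσ k] at this
        exact_mod_cast this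
      have hmono : Monotone σ := by
        intro i k hik
        rw [← ENNReal.coe_le_coe, hσ, hσ]
        refine le_hitAfter fun r _ hr => hitAfter_le zero_le ?_
        refine lt_of_lt_of_le (show Metric.infDist (coordProc r ω) Dᶜ < _ from hr) ?_
        exact one_div_le_one_div_of_le (by positivity) (by exact_mod_cast Nat.succ_le_succ hik)
      have hlim : Tendsto σ atTop (𝓝 t) := by
        have h1 := tendsto_atTop_iSup (f := fun k => hitAfter (O k) 0 ω) fun i k hik => by
          simp only [← hσ]; exact_mod_cast hmono hik
        rw [← ht] at h1
        simp only [← hσ] at h1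
        exact ENNReal.tendsto_coe.1 h1
      have hdist : ∀ k, Metric.infDist (coordProc (σ k) ω) Dᶜ ≤ 1 / ((k : ℝ) + 1) := by
        intro k
        have h1 := coordProc_hitAfter_mem_closure (hσ k).symm
        exact closure_lt_subset_le (Metric.continuous_infDist_pt _) continuous_const h1
      have hmemD : ∀ y : Euc d, Metric.infDist y Dᶜ ≤ 0 → y ∉ D := fun y hy => by
        have := (hD.isClosed_compl.mem_iff_infDist_zero hDc).2
          (le_antisymm hy Metric.infDist_nonneg)
        exact this
      have hne : ∀ k, σ k ≠ t := by
        intro k hk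
        refine hmemD _ (le_of_tendsto_of_tendsto (f := fun _ : ℕ => _)
          tendsto_const_nhds (tendsto_one_div_add_atTop_nhds_zero_nat (𝕜 := ℝ)) ?_) htD
        filter_upwards [eventually_ge_atTop k] with i hi
        have : σ i = t := le_antisymm (hσt i) (hk ▸ hmono hi)
        exact this ▸ hdist i
      have hσlt : ∀ k, σ k < t := fun k => lt_of_le_of_ne (hσt k) (hne k)
      have hcont := hqω t (fun k => by rw [← hσ k]; exact ENNReal.coe_lt_coe.2 (hσlt k)) ht.symm
      have hlim' : Tendsto (fun k => Metric.infDist (coordProc (σ k) ω) Dᶜ) atTop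
          (𝓝 (Metric.infDist (leftCoord t ω) Dᶜ)) :=
        ((Metric.continuous_infDist_pt _).tendsto _).comp ((tendsto_leftCoord t ω).comp
          (tendsto_nhdsWithin_iff.2 ⟨hlim, Eventually.of_forall hσlt⟩))
      refine hmemD _ (le_of_tendsto_of_tendsto hlim'
        (tendsto_one_div_add_atTop_nhds_zero_nat (𝕜 := ℝ)) (Eventually.of_forall hdist)) ?_
      rw [hcont]
      exact htD

end Jumps

/-! ### Kernels with continuous bounded density -/

section Density

variable {d : ℕ} {D : Set (Euc d)} {m : Measure (Euc d)}

theorem ae_mem_of_compl_null (hmD : m Dᶜ = 0) : ∀ᵐ x ∂m, x ∈ D := by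
  rw [ae_iff]; exact hmD

theorem aestronglyMeasurable_of_continuousOn (hD : IsOpen D) (hmD : m Dᶜ = 0) {f : Euc d → ℝ}
    (hf : ContinuousOn f D) : AEStronglyMeasurable f m := by
  have := hf.aestronglyMeasurable (μ := m) hD.measurableSet
  rwa [Measure.restrict_eq_self_of_ae_mem (ae_mem_of_compl_null hmD)] at this

theorem measurable_indicator_of_domRestrict (hD : MeasurableSet D) {f : Euc d → ℝ}
    (hf : Measurable (D.domRestrict f)) : Measurable (D.indicator f) := by
  refine measurable_of_restrict_of_restrict_compl hD ?_ ?_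
  · convert hf using 1
    ext x
    simp [domRestrict]
  · convert (measurable_const : Measurable fun _ : (Dᶜ : Set (Euc d)) => (0 : ℝ)) using 1
    ext x
    exact indicator_of_notMem x.2 f

theorem indicator_ae_eq_of_compl_null (hmD : m Dᶜ = 0) (f : Euc d → ℝ) : D.indicator f =ᵐ[m] f := by
  filter_upwards [ae_mem_of_compl_null hmD] with x hx using indicator_of_mem hx f

/-- Two functions that are continuous on `D` and agree almost everywhere agree on `D`, if every
non-empty open subset of `D` has positive measure. -/
theorem eqOn_of_ae_eq_of_continuousOn (hD : IsOpen D)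
    (hfull : ∀ U ⊆ D, IsOpen U → U.Nonempty → m U ≠ 0) {f g : Euc d → ℝ} (hf : ContinuousOn f D)
    (hg : ContinuousOn g D) (h : f =ᵐ[m] g) : EqOn f g D := by
  intro x hx
  by_contra hne
  have hU : IsOpen (D ∩ (fun x => f x - g x) ⁻¹' {0}ᶜ) :=
    (hf.sub hg).isOpen_inter_preimage hD isOpen_compl_singleton
  refine hfull _ inter_subset_left hU ⟨x, hx, sub_ne_zero.2 hne⟩ (measure_mono_null ?_ h)
  rintro y ⟨-, hy⟩ heq
  exact hy (sub_eq_zero.2 heq)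

/-- The standing assumptions on the kernel `k` on `D × D` that are used at a single time. -/
structure IsBddContKernel (D : Set (Euc d)) (k : Euc d → Euc d → ℝ) : Prop where
  bounded : ∃ C : ℝ, ∀ x ∈ D, ∀ y ∈ D, k x y ≤ C
  cont : ContinuousOn (fun z : Euc d × Euc d => k z.1 z.2) (D ×ˢ D)
  pos : ∀ x ∈ D, ∀ y ∈ D, 0 < k x y

namespace IsBddContKernel

variable {k k' : Euc d → Euc d → ℝ}

theorem swap (hk : IsBddContKernel D k) : IsBddContKernel D fun x y => k y x where
  bounded := hk.bounded.imp fun _ hC x hx y hy => hC y hy x hx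
  cont := hk.cont.comp continuous_swap.continuousOn fun _ hz => ⟨hz.2, hz.1⟩
  pos x hx y hy := hk.pos y hy x hx

theorem cont_right (hk : IsBddContKernel D k) {x : Euc d} (hx : x ∈ D) : ContinuousOn (k x) D :=
  hk.cont.comp (f := fun y => (x, y)) (by fun_prop) fun _ hy => ⟨hx, hy⟩

theorem cont_left (hk : IsBddContKernel D k) {y : Euc d} (hy : y ∈ D) :
    ContinuousOn (fun x => k x y) D := hk.swap.cont_right hy

theorem exists_norm_le (hk : IsBddContKernel D k) :
    ∃ C : ℝ, 0 ≤ C ∧ ∀ x ∈ D, ∀ y ∈ D, ‖k x y‖ ≤ C := by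
  obtain ⟨C, hC⟩ := hk.bounded
  refine ⟨max C 0, le_max_right _ _, fun x hx y hy => ?_⟩
  rw [Real.norm_of_nonneg (hk.pos x hx y hy).le]
  exact (hC x hx y hy).trans (le_max_left _ _)

variable [IsFiniteMeasure m]

theorem integrable_mul (hk : IsBddContKernel D k) (hD : IsOpen D) (hmD : m Dᶜ = 0) {x : Euc d}
    (hx : x ∈ D) {g : Euc d → ℝ} (hg : AEStronglyMeasurable g m) {C : ℝ}
    (hgC : ∀ y ∈ D, ‖g y‖ ≤ C) : Integrable (fun y => k x y * g y) m := by
  obtain ⟨A, hA0, hA⟩ := hk.exists_norm_le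
  refine Integrable.of_bound
    ((aestronglyMeasurable_of_continuousOn hD hmD (hk.cont_right hx)).mul hg) (A * C) ?_
  filter_upwards [ae_mem_of_compl_null hmD] with y hy
  rw [norm_mul]
  exact mul_le_mul (hA x hx y hy) (hgC y hy) (norm_nonneg _) hA0

theorem integrable (hk : IsBddContKernel D k) (hD : IsOpen D) (hmD : m Dᶜ = 0) {x : Euc d}
    (hx : x ∈ D) : Integrable (k x) m := by
  simpa using hk.integrable_mul hD hmD hx (g := fun _ => 1) (C := 1) aestronglyMeasurable_const
    (by simp)

theorem continuousOn_integral_mul (hk : IsBddContKernel D k) (hD : IsOpen D) (hmD : m Dᶜ = 0)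
    {g : Euc d → ℝ} (hg : AEStronglyMeasurable g m) {C : ℝ} (hgC : ∀ y ∈ D, ‖g y‖ ≤ C) :
    ContinuousOn (fun x => ∫ y, k x y * g y ∂m) D := by
  obtain ⟨A, hA0, hA⟩ := hk.exists_norm_le
  refine continuousOn_of_dominated (bound := fun _ => A * C)
    (fun x hx => (hk.integrable_mul hD hmD hx hg hgC).1) (fun x hx => ?_) (integrable_const _) ?_
  · filter_upwards [ae_mem_of_compl_null hmD] with y hy
    rw [norm_mul]
    exact mul_le_mul (hA x hx y hy) (hgC y hy) (norm_nonneg _) hA0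
  · filter_upwards [ae_mem_of_compl_null hmD] with y hy
    exact (hk.cont_left hy).mul continuousOn_const

theorem exists_norm_integral_le (hk : IsBddContKernel D k) (hmD : m Dᶜ = 0)
    {g : Euc d → ℝ} {C : ℝ} (hgC : ∀ y ∈ D, ‖g y‖ ≤ C) :
    ∃ B : ℝ, ∀ x ∈ D, ‖∫ y, k x y * g y ∂m‖ ≤ B := by
  obtain ⟨A, hA0, hA⟩ := hk.exists_norm_le
  refine ⟨A * C * m.real univ, fun x hx => norm_integral_le_of_norm_le_const ?_⟩
  filter_upwards [ae_mem_of_compl_null hmD] with y hy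
  rw [norm_mul]
  exact mul_le_mul (hA x hx y hy) (hgC y hy) (norm_nonneg _) hA0

/-- Pointwise form of a composition law for kernels that holds after integration against all
measurable sets. -/
theorem eq_integral_mul_of_forall_set (hk : IsBddContKernel D k) (hk' : IsBddContKernel D k')
    {k'' : Euc d → Euc d → ℝ} (hk'' : IsBddContKernel D k'') (hD : IsOpen D) (hmD : m Dᶜ = 0)
    (hfull : ∀ U ⊆ D, IsOpen U → U.Nonempty → m U ≠ 0)
    (h : ∀ B, MeasurableSet B → ∀ x ∈ D, ∫ y, k'' x y * B.indicator 1 y ∂m =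
      ∫ z, k x z * ∫ y, k' z y * B.indicator 1 y ∂m ∂m) {x y : Euc d} (hx : x ∈ D) (hy : y ∈ D) :
    k'' x y = ∫ z, k x z * k' z y ∂m := by
  obtain ⟨A, hA0, hA⟩ := hk.exists_norm_le
  obtain ⟨A', hA0', hA'⟩ := hk'.exists_norm_le
  have hgm := (hk.integrable hD hmD hx).1
  have hcont : ContinuousOn (fun y => ∫ z, k x z * k' z y ∂m) D := by
    simpa only [mul_comm] using hk'.swap.continuousOn_integral_mul hD hmD hgm (hA x hx)
  refine eqOn_of_ae_eq_of_continuousOn hD hfull (hk''.cont_right hx) hcont ?_ hy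
  -- the integrand is integrable on the product space
  have hprod : Integrable (fun w : Euc d × Euc d => k x w.1 * k' w.1 w.2) (m.prod m) := by
    have haeD : ∀ᵐ w ∂(m.prod m), w ∈ D ×ˢ D := by
      rw [ae_iff]
      have : {w : Euc d × Euc d | ¬ w ∈ D ×ˢ D} ⊆ Dᶜ ×ˢ univ ∪ univ ×ˢ Dᶜ := by
        rintro ⟨a, b⟩ hab
        simp only [mem_ofPred_eq, mem_prod, not_and_or] at hab
        simpa using hab
      refine measure_mono_null this (measure_union_null ?_ ?_) <;> simp [hmD]
    refine Integrable.of_bound ?_ (A * A') ?_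
    · have h1 : ContinuousOn (fun w : Euc d × Euc d => k x w.1 * k' w.1 w.2) (D ×ˢ D) :=
        ((hk.cont_right hx).comp continuousOn_fst fun w hw => hw.1).mul hk'.cont
      have h2 := h1.aestronglyMeasurable (μ := m.prod m) (hD.prod hD).measurableSet
      rwa [Measure.restrict_eq_self_of_ae_mem haeD] at h2
    · filter_upwards [haeD] with w hw
      rw [norm_mul]
      exact mul_le_mul (hA x hx _ hw.1) (hA' _ hw.1 _ hw.2) (norm_nonneg _) hA0
  refine Integrable.ae_eq_of_forall_setIntegral_eq _ _ (hk''.integrable hD hmD hx)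
    hprod.integral_prod_right fun B hB _ => ?_
  have h1 := h B hB x hx
  have h2 : ∀ g : Euc d → ℝ, ∫ y, g y * B.indicator 1 y ∂m = ∫ y in B, g y ∂m := by
    intro g
    rw [← integral_indicator hB]
    congr 1 with y
    by_cases hyB : y ∈ B <;> simp [hyB]
  simp only [h2] at h1
  rw [h1]
  simp only [← integral_const_mul]
  refine integral_integral_swap (f := fun z y => k x z * k' z y) ?_
  exact hprod.mono_measure (Measure.prod_mono le_rfl Measure.restrict_le_self)

end IsBddContKernel

/-- If `f, g` are bounded on `D`, a kernel bounded by `C f(x) g(y)` with `k f = e f` puts a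
fixed proportion of `f(x)` on a large compact set. -/
theorem exists_le_setIntegral_of_eigen [IsFiniteMeasure m] {k : Euc d → Euc d → ℝ}
    (hk : IsBddContKernel D k)
    (hD : IsOpen D) (hmD : m Dᶜ = 0) {f g : Euc d → ℝ} (hf : ContinuousOn f D)
    (hf0 : ∀ x ∈ D, 0 < f x)
    (hg0 : ∀ x ∈ D, 0 < g x) {A B C e : ℝ} (hA : ∀ x ∈ D, f x ≤ A) (hB : ∀ x ∈ D, g x ≤ B)
    (hC : ∀ x ∈ D, ∀ y ∈ D, k x y ≤ C * f x * g y) (hC0 : 0 < C) (he : 0 < e)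
    (heig : ∀ x ∈ D, e * f x = ∫ y, k x y * f y ∂m) (hDne : D.Nonempty) :
    ∃ δ : ℝ≥0∞, δ ≠ 0 ∧ ∃ c : ℝ, 0 < c ∧ ∀ K ⊆ D, IsCompact K → m (D \ K) < δ →
      ∀ x ∈ D, c * f x ≤ ∫ y in K, k x y ∂m := by
  obtain ⟨x₀, hx₀⟩ := hDne
  have hA0 : 0 < A := (hf0 x₀ hx₀).trans_le (hA x₀ hx₀)
  have hB0 : 0 < B := (hg0 x₀ hx₀).trans_le (hB x₀ hx₀)
  have hfm := aestronglyMeasurable_of_continuousOn hD hmD hf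
  have hfA : ∀ y ∈ D, ‖f y‖ ≤ A := fun y hy => by
    rw [Real.norm_of_nonneg (hf0 y hy).le]; exact hA y hy
  refine ⟨ENNReal.ofReal (e / (2 * (C * B * A))), by simp; positivity, e / (2 * A), by positivity,
    fun K hKD hK hmK x hx => ?_⟩
  have hKm : MeasurableSet K := hK.measurableSet
  have hint := hk.integrable_mul hD hmD hx hfm hfA
  have h1 : ∫ y in K, k x y * f y ∂m ≤ A * ∫ y in K, k x y ∂m := by
    rw [← integral_const_mul]
    refine setIntegral_mono_on hint.integrableOn
      ((hk.integrable hD hmD hx).const_mul A).integrableOn hKm fun y hy => ?_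
    rw [mul_comm]
    exact mul_le_mul_of_nonneg_right (hA y (hKD hy)) (hk.pos x hx y (hKD hy)).le
  have h2 : ∫ y in Kᶜ, k x y * f y ∂m ≤ e / 2 * f x := by
    have h3 : m Kᶜ = m (D \ K) := by
      refine measure_congr ?_
      filter_upwards [ae_mem_of_compl_null hmD] with y hy
      exact propext ⟨fun h => ⟨hy, h⟩, fun h => h.2⟩
    have h4 : m.real Kᶜ ≤ e / (2 * (C * B * A)) :=
      ENNReal.toReal_le_of_le_ofReal (by positivity) (h3 ▸ hmK.le)
    calc ∫ y in Kᶜ, k x y * f y ∂m ≤ ∫ y in Kᶜ, C * f x * B * A ∂m := by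
          refine integral_mono_ae hint.integrableOn (integrable_const _) ?_
          filter_upwards [ae_restrict_of_ae (ae_mem_of_compl_null hmD)] with y hy
          have := hf0 x hx
          exact mul_le_mul ((hC x hx y hy).trans (mul_le_mul_of_nonneg_left (hB y hy) (by positivity)))
            (hA y hy) (hf0 y hy).le (by positivity)
      _ = C * f x * B * A * m.real Kᶜ := by
          rw [setIntegral_const, smul_eq_mul, mul_comm]
      _ ≤ C * f x * B * A * (e / (2 * (C * B * A))) := by
          have := hf0 x hx
          gcongr
      _ = e / 2 * f x := by field_simp
  have h5 := heig x hx
  rw [← integral_add_compl hKm hint] at h5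
  have h6 : e * f x / 2 ≤ A * ∫ y in K, k x y ∂m := by linarith
  rw [div_mul_eq_mul_div, div_le_iff₀ (by positivity)]
  linarith

/-- **Lower bound from composition.** If a kernel bounded by `C φ(x) φ'(y)` has the positive
eigenfunctions `φ` and `φ'` on the two sides, its threefold composition is bounded below by a
multiple of `φ(x) φ'(y)`: on a large compact set the kernel in the middle is bounded below, and the
outer kernels put a proportion `φ(x)` and `φ'(y)` of mass there. -/
theorem exists_lower_bound_threefold [IsFiniteMeasure m] {k k₂ k₃ : Euc d → Euc d → ℝ}
    (hk : IsBddContKernel D k) (hk₂ : IsBddContKernel D k₂)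
    (hD : IsOpen D) (hDne : D.Nonempty) (hmD : m Dᶜ = 0)
    (h₂ : ∀ x ∈ D, ∀ y ∈ D, k₂ x y = ∫ z, k x z * k z y ∂m)
    (h₃ : ∀ x ∈ D, ∀ y ∈ D, k₃ x y = ∫ z, k x z * k₂ z y ∂m)
    {f g : Euc d → ℝ} (hf : ContinuousOn f D) (hg : ContinuousOn g D)
    (hf0 : ∀ x ∈ D, 0 < f x) (hg0 : ∀ x ∈ D, 0 < g x) {A B C e : ℝ}
    (hA : ∀ x ∈ D, f x ≤ A) (hB : ∀ x ∈ D, g x ≤ B)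
    (hC : ∀ x ∈ D, ∀ y ∈ D, k x y ≤ C * f x * g y) (hC0 : 0 < C) (he : 0 < e)
    (heigf : ∀ x ∈ D, e * f x = ∫ y, k x y * f y ∂m)
    (heigg : ∀ x ∈ D, e * g x = ∫ y, k y x * g y ∂m) :
    ∃ c : ℝ, 0 < c ∧ ∀ x ∈ D, ∀ y ∈ D, c * f x * g y ≤ k₃ x y := by
  obtain ⟨δ₁, hδ₁, c₁, hc₁, H₁⟩ :=
    exists_le_setIntegral_of_eigen hk hD hmD hf hf0 hg0 hA hB hC hC0 he heigf hDne
  obtain ⟨δ₂, hδ₂, c₂, hc₂, H₂⟩ := exists_le_setIntegral_of_eigen (k := fun x y => k y x)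
    hk.swap hD hmD hg hg0 hf0 hB hA (fun x hx y hy => (hC y hy x hx).trans (le_of_eq (by ring)))
    hC0 he heigg hDne
  obtain ⟨K, hKD, hK, hmK⟩ := hD.measurableSet.exists_isCompact_sdiff_lt (measure_ne_top m D)
    (ε := min δ₁ δ₂) (by simp [hδ₁, hδ₂, min_eq_iff])
  have h1 := H₁ K hKD hK (hmK.trans_le (min_le_left _ _))
  have h2 := H₂ K hKD hK (hmK.trans_le (min_le_right _ _))
  have hKm := hK.measurableSet
  obtain ⟨c₀, hc₀, h0⟩ : ∃ c : ℝ, 0 < c ∧ ∀ z ∈ K, ∀ w ∈ K, c ≤ k z w := by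
    rcases (K ×ˢ K).eq_empty_or_nonempty with h | h
    · exact ⟨1, one_pos, fun z hz w hw => absurd (show (z, w) ∈ K ×ˢ K from ⟨hz, hw⟩) (by simp [h])⟩
    · obtain ⟨a, ha, hmin⟩ := (hK.prod hK).exists_isMinOn h
        (hk.cont.mono (prod_mono hKD hKD))
      exact ⟨_, hk.pos _ (hKD ha.1) _ (hKD ha.2), fun z hz w hw =>
        hmin (show (z, w) ∈ K ×ˢ K from ⟨hz, hw⟩)⟩
  obtain ⟨M, hM0, hM⟩ := hk.exists_norm_le
  obtain ⟨M₂, hM₂0, hM₂⟩ := hk₂.exists_norm_le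
  have hmid : ∀ z ∈ K, ∀ y ∈ D, c₀ * (c₂ * g y) ≤ k₂ z y := by
    intro z hz y hy
    have hi := hk.integrable_mul hD hmD (hKD hz)
      (aestronglyMeasurable_of_continuousOn hD hmD (hk.cont_left hy)) (fun w hw => hM w hw y hy)
    rw [h₂ z (hKD hz) y hy]
    calc c₀ * (c₂ * g y) ≤ c₀ * ∫ w in K, k w y ∂m := by gcongr; exact h2 y hy
      _ = ∫ w in K, c₀ * k w y ∂m := (integral_const_mul _ _).symm
      _ ≤ ∫ w in K, k z w * k w y ∂m := by
          refine setIntegral_mono_on ((hk.swap.integrable hD hmD hy).const_mul c₀).integrableOn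
            hi.integrableOn hKm fun w hw => ?_
          exact mul_le_mul_of_nonneg_right (h0 z hz w hw) (hk.pos w (hKD hw) y hy).le
      _ ≤ ∫ w, k z w * k w y ∂m := by
          refine setIntegral_le_integral hi ?_
          filter_upwards [ae_mem_of_compl_null hmD] with w hw
          exact mul_nonneg (hk.pos z (hKD hz) w hw).le (hk.pos w hw y hy).le
  refine ⟨c₀ * c₂ * c₁, by positivity, fun x hx y hy => ?_⟩
  have hi := hk.integrable_mul hD hmD hx
    (aestronglyMeasurable_of_continuousOn hD hmD (hk₂.cont_left hy)) (fun w hw => hM₂ w hw y hy)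
  have hgy := hg0 y hy
  rw [h₃ x hx y hy]
  calc c₀ * c₂ * c₁ * f x * g y = (c₁ * f x) * (c₀ * (c₂ * g y)) := by ring
    _ ≤ (∫ z in K, k x z ∂m) * (c₀ * (c₂ * g y)) := by gcongr; exact h1 x hx
    _ = ∫ z in K, k x z * (c₀ * (c₂ * g y)) ∂m := (integral_mul_const _ _).symm
    _ ≤ ∫ z in K, k x z * k₂ z y ∂m := by
        refine setIntegral_mono_on ((hk.integrable hD hmD hx).mul_const _).integrableOn
          hi.integrableOn hKm fun z hz => ?_
        exact mul_le_mul_of_nonneg_left (hmid z hz y hy) (hk.pos x hx z (hKD hz)).le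
    _ ≤ ∫ z, k x z * k₂ z y ∂m := by
        refine setIntegral_le_integral hi ?_
        filter_upwards [ae_mem_of_compl_null hmD] with w hw
        exact mul_nonneg (hk.pos x hx w hw).le (hk₂.pos w hw y hy).le

/-! ### The transition density of the killed semigroup -/

variable {P : Kernel (Euc d) (CadlagPath d)} {p : ℝ → Euc d → Euc d → ℝ}

theorem IsTransitionDensity.kernel (hp : IsTransitionDensity P D m p) {t : ℝ} (ht : 0 < t) :
    IsBddContKernel D (p t) := ⟨hp.bounded t ht, hp.cont t ht, hp.pos t ht⟩

theorem killedValue_one (t : ℝ≥0) : killedValue D t (fun _ => 1) =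
    {ω : CadlagPath d | (t : ℝ≥0∞) < exitTime D ω}.indicator 1 := rfl

/-- The total mass of the density is positive, so the indicator of `{t < τ_D}` is integrable; this
makes the event measurable up to null sets. -/
theorem IsTransitionDensity.nullMeasurableSet_lt_exitTime [IsFiniteMeasure m]
    (hp : IsTransitionDensity P D m p) (hD : IsOpen D) (hmD : m Dᶜ = 0) (hm : m ≠ 0)
    {x : Euc d} (hx : x ∈ D) {t : ℝ≥0} (ht : 0 < t) :
    NullMeasurableSet {ω : CadlagPath d | (t : ℝ≥0∞) < exitTime D ω} (P x) := by
  have hk := hp.kernel (NNReal.coe_pos.2 ht)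
  have h1 := hp.repr t ht (fun _ => 1) measurable_const ⟨1, by simp⟩ x hx
  have hpos : 0 < ∫ y, p t x y * 1 ∂m := by
    simp only [mul_one]
    rw [integral_pos_iff_support_of_nonneg_ae ?_ (hk.integrable hD hmD hx)]
    · refine pos_iff_ne_zero.2 fun h0 => hm ?_
      rw [← Measure.measure_univ_eq_zero]
      refine (measure_congr ?_).trans h0
      filter_upwards [ae_mem_of_compl_null hmD] with y hy
      exact propext ⟨fun _ => (hk.pos x hx y hy).ne', fun _ => trivial⟩
    · filter_upwards [ae_mem_of_compl_null hmD] with y hy using (hk.pos x hx y hy).le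
  have hint : Integrable (killedValue D t fun _ => 1) (P x) := by
    by_contra hni
    rw [← h1, killedSemigroup, integral_undef hni] at hpos
    exact lt_irrefl _ hpos
  rw [killedValue_one] at hint
  have h2 := hint.1.aemeasurable.nullMeasurable (measurableSet_singleton (1 : ℝ))
  convert h2 using 1
  ext ω
  simp [indicator]

theorem IsTransitionDensity.aemeasurable_exitTime [IsFiniteMeasure m]
    (hp : IsTransitionDensity P D m p) (hD : IsOpen D) (hmD : m Dᶜ = 0) (hm : m ≠ 0)
    {x : Euc d} (hx : x ∈ D) (h0 : ∀ᵐ ω ∂(P x), coordProc 0 ω = x) :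
    AEMeasurable (exitTime D) (P x) := by
  have key : NullMeasurable (exitTime D) (P x) := by
    have htop : NullMeasurableSet (exitTime D ⁻¹' Ioi ⊤) (P x) := by
      rw [Ioi_top, preimage_empty]; exact nullMeasurableSet_empty
    refine @measurable_of_Ioi ℝ≥0∞ (NullMeasurableSpace (CadlagPath d) (P x)) _ _ _ _ _ _ _ _
      fun a => ?_
    induction a with
    | top => exact htop
    | coe r =>
      rcases eq_or_ne r 0 with rfl | hr
      · have : exitTime D ⁻¹' Ioi ((0 : ℝ≥0) : ℝ≥0∞) =ᵐ[P x] univ := by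
          filter_upwards [h0] with ω hω
          exact propext ⟨fun _ => trivial, fun _ => exitTime_pos hD (hω ▸ hx)⟩
        exact NullMeasurableSet.congr nullMeasurableSet_univ this.symm
      · exact hp.nullMeasurableSet_lt_exitTime hD hmD hm hx (pos_iff_ne_zero.2 hr)
  exact key.aemeasurable

end Density

/-! ### The killed semigroup and the Chapman–Kolmogorov equation -/

section Semigroup

variable {d : ℕ} {D : Set (Euc d)} {m : Measure (Euc d)} {P : Kernel (Euc d) (CadlagPath d)}
  {p : ℝ → Euc d → Euc d → ℝ} {lam : ℝ} {φ φ' : Euc d → ℝ}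

theorem killedValue_congr {t : ℝ≥0} (ht : 0 < t) {f g : Euc d → ℝ} (h : EqOn f g D) :
    killedValue D t f = killedValue D t g := by
  ext ω
  by_cases hω : (t : ℝ≥0∞) < exitTime D ω
  · rw [killedValue, killedValue, indicator_of_mem (by exact hω), indicator_of_mem (by exact hω),
      h (coordProc_mem_of_lt_exitTime ht hω)]
  · rw [killedValue, killedValue, indicator_of_notMem (by exact hω),
      indicator_of_notMem (by exact hω)]

theorem measurable_domRestrict_of_continuousOn {f : Euc d → ℝ} (hf : ContinuousOn f D) :
    Measurable (D.domRestrict f) := (continuousOn_iff_continuous_domRestrict.1 hf).measurable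

variable [IsFiniteMeasure m]

theorem IsTransitionDensity.integrable_killedValue [IsMarkovKernel P]
    (hp : IsTransitionDensity P D m p)
    (hD : IsOpen D) (hmD : m Dᶜ = 0) (hm : m ≠ 0) {x : Euc d} (hx : x ∈ D) {t : ℝ≥0} (ht : 0 < t)
    {f : Euc d → ℝ} (hf : IsBddBorelOn D f) : Integrable (killedValue D t f) (P x) := by
  obtain ⟨C, hC⟩ := hf.2
  rw [killedValue_congr ht (g := D.indicator f) fun y hy => (indicator_of_mem hy f).symm]
  refine Integrable.of_bound (C := max C 0) (AEStronglyMeasurable.indicator₀ ?_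
    (hp.nullMeasurableSet_lt_exitTime hD hmD hm hx ht)) (Eventually.of_forall fun ω => ?_)
  · exact ((measurable_indicator_of_domRestrict hD.measurableSet hf.1).comp
      (measurable_coordProc t)).aestronglyMeasurable
  · refine (norm_indicator_le_norm_self _ _).trans ?_
    by_cases h : coordProc t ω ∈ D
    · rw [indicator_of_mem h]
      exact (hC _ h).trans (le_max_left _ _)
    · rw [indicator_of_notMem h, norm_zero]
      exact le_max_right _ _

theorem IsTransitionDensity.killedSemigroup_eq {m : Measure (Euc d)}
    (hp : IsTransitionDensity P D m p)
    (hD : IsOpen D) (hmD : m Dᶜ = 0) {x : Euc d} (hx : x ∈ D) {t : ℝ≥0} (ht : 0 < t)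
    {f : Euc d → ℝ} (hf : IsBddBorelOn D f) :
    killedSemigroup P D t f x = ∫ y, p t x y * f y ∂m := by
  obtain ⟨C, hC⟩ := hf.2
  rw [killedSemigroup, killedValue_congr ht (g := D.indicator f)
    fun y hy => (indicator_of_mem hy f).symm, ← killedSemigroup, hp.repr t ht _
    (measurable_indicator_of_domRestrict hD.measurableSet hf.1) ?_ x hx]
  · refine integral_congr_ae ?_
    filter_upwards [ae_mem_of_compl_null hmD] with y hy
    rw [indicator_of_mem hy]
  · refine ⟨max C 0, fun y => ?_⟩
    by_cases h : y ∈ D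
    · rw [indicator_of_mem h]
      exact (hC _ h).trans (le_max_left _ _)
    · rw [indicator_of_notMem h, abs_zero]
      exact le_max_right _ _

/-- Non-empty open subsets of `D` have positive reference measure: by right continuity the
process started in such a set is still in it, and not yet killed, after a short time. -/
theorem IsTransitionDensity.measure_ne_zero [IsMarkovKernel P] (hp : IsTransitionDensity P D m p)
    (hD : IsOpen D) (hmD : m Dᶜ = 0) (hm : m ≠ 0)
    (hinit : ∀ x ∈ D, ∀ᵐ ω ∂(P x), coordProc 0 ω = x) {U : Set (Euc d)} (hUD : U ⊆ D)
    (hU : IsOpen U) (hne : U.Nonempty) : m U ≠ 0 := by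
  intro hmU
  obtain ⟨x, hxU⟩ := hne
  have hx := hUD hxU
  have hbdd : IsBddBorelOn D (U.indicator 1) := by
    refine ⟨(measurable_one.indicator hU.measurableSet).comp measurable_subtype_coe, 1, fun y _ => ?_⟩
    by_cases h : y ∈ U <;> simp [h]
  have hzero : ∀ n : ℕ, ∀ᵐ ω ∂(P x), killedValue D (1 / ((n : ℝ≥0) + 1)) (U.indicator 1) ω = 0 := by
    intro n
    have ht : (0 : ℝ≥0) < 1 / ((n : ℝ≥0) + 1) := by positivity
    have h1 := hp.killedSemigroup_eq hD hmD hx ht hbdd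
    have h2 : ∫ y, p ((1 / ((n : ℝ≥0) + 1) : ℝ≥0) : ℝ) x y * U.indicator 1 y ∂m = 0 := by
      refine integral_eq_zero_of_ae ?_
      filter_upwards [measure_eq_zero_iff_ae_notMem.1 hmU] with y hy
      simp [hy]
    have h0 : 0 ≤ killedValue D (1 / ((n : ℝ≥0) + 1)) (U.indicator 1) := fun ω =>
      indicator_nonneg (fun ω _ => indicator_nonneg (fun _ _ => zero_le_one) _) _
    rw [h2, killedSemigroup, integral_eq_zero_iff_of_nonneg h0
      (hp.integrable_killedValue hD hmD hm hx ht hbdd)] at h1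
    exact h1
  obtain ⟨ω, hω, hω0⟩ := ((ae_all_iff.2 hzero).and (hinit x hx)).exists
  have hlim : Tendsto (fun n : ℕ => 1 / ((n : ℝ≥0) + 1)) atTop (𝓝[≥] 0) :=
    tendsto_nhdsWithin_iff.2 ⟨tendsto_one_div_add_atTop_nhds_zero_nat (𝕜 := ℝ≥0),
      Eventually.of_forall fun n => mem_Ici.2 zero_le⟩
  have e1 : ∀ᶠ n : ℕ in atTop, coordProc (1 / ((n : ℝ≥0) + 1)) ω ∈ U :=
    ((ω.2 0).1.tendsto.comp hlim).eventually (hU.mem_nhds (show coordProc 0 ω ∈ U from hω0 ▸ hxU))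
  have e2 : ∀ᶠ n : ℕ in atTop, ((1 / ((n : ℝ≥0) + 1) : ℝ≥0) : ℝ≥0∞) < exitTime D ω := by
    have h3 : Tendsto (fun n : ℕ => ((1 / ((n : ℝ≥0) + 1) : ℝ≥0) : ℝ≥0∞)) atTop (𝓝 0) :=
      ENNReal.tendsto_coe.2 (tendsto_one_div_add_atTop_nhds_zero_nat (𝕜 := ℝ≥0))
    exact h3.eventually (gt_mem_nhds (exitTime_pos hD (hω0 ▸ hx)))
  obtain ⟨n, hn1, hn2⟩ := (e1.and e2).exists
  have := hω n
  rw [killedValue, indicator_of_mem (by exact hn2), indicator_of_mem hn1] at this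
  exact one_ne_zero this

/-- **Chapman–Kolmogorov equation**, pointwise on `D`: it holds almost everywhere by the semigroup
property on `L²`, and both sides are continuous. -/
theorem IsTransitionDensity.chapmanKolmogorov (hp : IsTransitionDensity P D m p)
    (hD : IsOpen D) (hmD : m Dᶜ = 0)
    (hfull : ∀ U ⊆ D, IsOpen U → U.Nonempty → m U ≠ 0) {s t : ℝ} (hs : 0 < s) (ht : 0 < t) :
    ∀ x ∈ D, ∀ y ∈ D, p (s + t) x y = ∫ z, p s x z * p t z y ∂m := by
  lift s to ℝ≥0 using hs.le
  lift t to ℝ≥0 using ht.le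
  rw [NNReal.coe_pos] at hs ht
  have hks := hp.kernel (NNReal.coe_pos.2 hs)
  have hkt := hp.kernel (NNReal.coe_pos.2 ht)
  have hkst := hp.kernel (NNReal.coe_pos.2 (add_pos hs ht))
  obtain ⟨T, -, hTadd, -, hT⟩ := hp.l2
  intro x hx y hy
  have hst : ((s + t : ℝ≥0) : ℝ) = s + t := NNReal.coe_add s t
  rw [← hst]
  refine hks.eq_integral_mul_of_forall_set hkt hkst hD hmD hfull (fun B hB => ?_) hx hy
  have hBm : Measurable (B.indicator (1 : Euc d → ℝ)) := measurable_one.indicator hB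
  have hB1 : ∀ y, |B.indicator (1 : Euc d → ℝ) y| ≤ 1 := fun y => by
    by_cases h : y ∈ B <;> simp [h]
  have hmem : MemLp (B.indicator (1 : Euc d → ℝ)) 2 m :=
    MemLp.of_bound hBm.aestronglyMeasurable 1 (Eventually.of_forall hB1)
  set F : Lp ℝ 2 m := hmem.toLp _
  have hF := hmem.coeFn_toLp
  have hcont_t := hkt.continuousOn_integral_mul (m := m) hD hmD hBm.aestronglyMeasurable
    (fun y _ => hB1 y)
  set G : Euc d → ℝ := fun z => ∫ y, p t z y * B.indicator 1 y ∂m with hG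
  obtain ⟨C, hC⟩ := hkt.exists_norm_integral_le (m := m) hmD (fun y _ => hB1 y)
  have hGm : Measurable (D.indicator G) :=
    measurable_indicator_of_domRestrict hD.measurableSet
      (measurable_domRestrict_of_continuousOn hcont_t)
  have hGb : ∃ C : ℝ, ∀ z, |D.indicator G z| ≤ C := by
    refine ⟨max C 0, fun z => ?_⟩
    by_cases h : z ∈ D
    · rw [indicator_of_mem h]; exact (hC z h).trans (le_max_left _ _)
    · rw [indicator_of_notMem h, abs_zero]; exact le_max_right _ _
  have e1 := hT (s + t) (add_pos hs ht) _ hBm ⟨1, hB1⟩ F hF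
  have e2 := hT t ht _ hBm ⟨1, hB1⟩ F hF
  have e3 := hT s hs _ hGm hGb (T t F) (e2.trans (indicator_ae_eq_of_compl_null hmD G).symm)
  rw [hTadd, ContinuousLinearMap.comp_apply] at e1
  have e4 : (fun x => ∫ y, p s x y * D.indicator G y ∂m) = fun x => ∫ z, p s x z * G z ∂m := by
    ext x
    refine integral_congr_ae ?_
    filter_upwards [indicator_ae_eq_of_compl_null hmD G] with z hz
    rw [hz]
  rw [e4] at e3
  exact eqOn_of_ae_eq_of_continuousOn hD hfull
    (hkst.continuousOn_integral_mul hD hmD hBm.aestronglyMeasurable (fun y _ => hB1 y))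
    (hks.continuousOn_integral_mul hD hmD
      (aestronglyMeasurable_of_continuousOn hD hmD hcont_t) hC) (e1.symm.trans e3)

/-! ### Lower bounds under intrinsic ultracontractivity -/

theorem IsPrincipalTriple.measure_ne_zero' {m : Measure (Euc d)}
    (hφ : IsPrincipalTriple D m p lam φ φ') : m ≠ 0 := by
  rintro rfl
  have := hφ.normalized
  simp at this

theorem IsPrincipalTriple.isBddBorelOn {m : Measure (Euc d)}
    (hφ : IsPrincipalTriple D m p lam φ φ') : IsBddBorelOn D φ := by
  obtain ⟨C, hC⟩ := hφ.bounded
  exact ⟨measurable_domRestrict_of_continuousOn hφ.cont, C, fun x hx => by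
    rw [abs_of_pos (hφ.pos x hx)]; exact hC x hx⟩

theorem IsPrincipalTriple.isBddBorelOn' {m : Measure (Euc d)}
    (hφ : IsPrincipalTriple D m p lam φ φ') : IsBddBorelOn D φ' := by
  obtain ⟨C, hC⟩ := hφ.bounded'
  exact ⟨measurable_domRestrict_of_continuousOn hφ.cont', C, fun x hx => by
    rw [abs_of_pos (hφ.pos' x hx)]; exact hC x hx⟩

/-- Intrinsic ultracontractivity also bounds the density below by a multiple of `φ(x) φ'(y)`. -/
theorem IntrinsicallyUltracontractive.exists_lower_bound
    (hIU : IntrinsicallyUltracontractive D p φ φ') (hp : IsTransitionDensity P D m p)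
    (hφ : IsPrincipalTriple D m p lam φ φ') (hD : IsOpen D) (hDne : D.Nonempty) (hmD : m Dᶜ = 0)
    (hfull : ∀ U ⊆ D, IsOpen U → U.Nonempty → m U ≠ 0) {t : ℝ} (ht : 0 < t) :
    ∃ c : ℝ, 0 < c ∧ ∀ x ∈ D, ∀ y ∈ D, c * φ x * φ' y ≤ p t x y := by
  have hr : 0 < t / 3 := by positivity
  obtain ⟨A, hA⟩ := hφ.bounded
  obtain ⟨B, hB⟩ := hφ.bounded'
  obtain ⟨C, hC0, hC⟩ := hIU _ hr
  have h3 := hp.chapmanKolmogorov hD hmD hfull hr (add_pos hr hr)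
  rw [show t / 3 + (t / 3 + t / 3) = t by ring] at h3
  exact exists_lower_bound_threefold (hp.kernel hr) (hp.kernel (add_pos hr hr)) hD hDne hmD
    (hp.chapmanKolmogorov hD hmD hfull hr hr) h3 hφ.cont hφ.cont' hφ.pos hφ.pos' hA hB hC hC0
    (Real.exp_pos _) (hφ.eigen _ hr) (hφ.eigen' _ hr)

/-- A lower bound by a multiple of `φ(x) φ'(y)` persists, with the factor `e^{-λ s}`. -/
theorem IsTransitionDensity.lower_bound_add (hp : IsTransitionDensity P D m p)
    (hφ : IsPrincipalTriple D m p lam φ φ') (hD : IsOpen D) (hmD : m Dᶜ = 0)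
    (hfull : ∀ U ⊆ D, IsOpen U → U.Nonempty → m U ≠ 0) {s t c : ℝ} (hs : 0 < s) (ht : 0 < t)
    (hc : ∀ x ∈ D, ∀ y ∈ D, c * φ x * φ' y ≤ p t x y) {x y : Euc d} (hx : x ∈ D) (hy : y ∈ D) :
    c * Real.exp (-(lam * s)) * φ x * φ' y ≤ p (t + s) x y := by
  have hkt := hp.kernel ht
  have hks := hp.kernel hs
  obtain ⟨B, hB⟩ := hφ.isBddBorelOn'.2
  obtain ⟨M, -, hM⟩ := hks.exists_norm_le
  rw [hp.chapmanKolmogorov hD hmD hfull ht hs x hx y hy]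
  calc c * Real.exp (-(lam * s)) * φ x * φ' y
      = c * φ x * ∫ z, p s z y * φ' z ∂m := by rw [← hφ.eigen' s hs y hy]; ring
    _ = ∫ z, c * φ x * (p s z y * φ' z) ∂m := (integral_const_mul _ _).symm
    _ ≤ ∫ z, p t x z * p s z y ∂m := by
        refine integral_mono_ae ((hks.swap.integrable_mul hD hmD hy
          (aestronglyMeasurable_of_continuousOn hD hmD hφ.cont') hB).const_mul _)
          (hkt.integrable_mul hD hmD hx (aestronglyMeasurable_of_continuousOn hD hmD
            (hks.cont_left hy)) (fun z hz => hM z hz y hy)) ?_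
        filter_upwards [ae_mem_of_compl_null hmD] with z hz
        calc c * φ x * (p s z y * φ' z) = (c * φ x * φ' z) * p s z y := by ring
          _ ≤ p t x z * p s z y := mul_le_mul_of_nonneg_right (hc x hx z hz) (hks.pos z hz y hy).le

/-- The lower bounds can be chosen continuously in time: near `t` the constant found at time `t / 2`
works up to a factor. -/
theorem IntrinsicallyUltracontractive.exists_isLowerRate
    (hIU : IntrinsicallyUltracontractive D p φ φ') (hp : IsTransitionDensity P D m p)
    (hφ : IsPrincipalTriple D m p lam φ φ') (hD : IsOpen D) (hDne : D.Nonempty) (hmD : m Dᶜ = 0)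
    (hfull : ∀ U ⊆ D, IsOpen U → U.Nonempty → m U ≠ 0) : ∃ h : ℝ → ℝ, IsLowerRate D p φ φ' h := by
  let S : Ioi (0 : ℝ) → Set ℝ := fun t =>
    {c | 0 < c ∧ ∀ x ∈ D, ∀ y ∈ D, c * φ x * φ' y ≤ p t x y}
  have hconv : ∀ t, Convex ℝ (S t) := by
    intro t
    refine (convex_Ioi (0 : ℝ)).inter ?_
    intro a ha b hb α β hα hβ hαβ x hx y hy
    have h1 := mul_le_mul_of_nonneg_left (ha x hx y hy) hα
    have h2 := mul_le_mul_of_nonneg_left (hb x hx y hy) hβ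
    calc (α • a + β • b) * φ x * φ' y = α * (a * φ x * φ' y) + β * (b * φ x * φ' y) := by
          simp only [smul_eq_mul]; ring
      _ ≤ α * p t x y + β * p t x y := add_le_add h1 h2
      _ = p t x y := by rw [← add_mul, hαβ, one_mul]
  have hloc : ∀ t, ∃ c, ∀ᶠ u in 𝓝 t, c ∈ S u := by
    rintro ⟨t, ht⟩
    have ht2 : 0 < t / 2 := half_pos ht
    obtain ⟨c, hc0, hc⟩ := hIU.exists_lower_bound hp hφ hD hDne hmD hfull ht2
    refine ⟨c * Real.exp (-(lam * (3 / 2 * t))), ?_⟩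
    have hnhds : ∀ᶠ u : Ioi (0 : ℝ) in 𝓝 ⟨t, ht⟩, (u : ℝ) ∈ Ioo (t / 2) (2 * t) :=
      continuous_subtype_val.continuousAt.eventually (Ioo_mem_nhds (half_lt_self ht)
        (by rw [mem_Ioi] at ht; change t < 2 * t; linarith))
    filter_upwards [hnhds] with u hu
    refine ⟨by positivity, fun x hx y hy => ?_⟩
    have h1 := hp.lower_bound_add hφ hD hmD hfull (sub_pos.2 hu.1) ht2 hc hx hy
    rw [add_sub_cancel] at h1
    have hfx := hφ.pos x hx
    have hfy := hφ.pos' y hy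
    refine le_trans ?_ h1
    gcongr
    · exact hφ.lam_pos.le
    · linarith [hu.2]
  obtain ⟨g, hg⟩ := exists_continuous_forall_mem_convex_of_local_const hconv hloc
  refine ⟨fun t => if ht : 0 < t then g ⟨t, ht⟩ else 0, ?_, fun t ht => ?_, fun t ht => ?_⟩
  · rw [continuousOn_iff_continuous_domRestrict]
    convert g.continuous using 1
    ext t
    have := t.2
    rw [mem_Ioi] at this
    simp [domRestrict, this]
  · simp only [ht, dif_pos]; exact (hg ⟨t, ht⟩).1
  · simp only [ht, dif_pos]; exact (hg ⟨t, ht⟩).2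

/-! ### The minorization condition -/

theorem killedSemigroup_zero {x : Euc d} (hD : IsOpen D) (hx : x ∈ D) [IsMarkovKernel P]
    (hinit : ∀ᵐ ω ∂(P x), coordProc 0 ω = x) (f : Euc d → ℝ) :
    Integrable (killedValue D 0 f) (P x) ∧ killedSemigroup P D 0 f x = f x := by
  have h : killedValue D 0 f =ᵐ[P x] fun _ => f x := by
    filter_upwards [hinit] with ω hω
    rw [killedValue, indicator_of_mem, hω]
    exact exitTime_pos hD (hω ▸ hx)
  refine ⟨(integrable_const (f x)).congr h.symm, ?_⟩
  rw [killedSemigroup, integral_congr_ae h]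
  simp

theorem IsPrincipalTriple.isNonnegEigenpair [IsMarkovKernel P] (hp : IsTransitionDensity P D m p)
    (hφ : IsPrincipalTriple D m p lam φ φ') (hD : IsOpen D) (hmD : m Dᶜ = 0)
    (hinit : ∀ x ∈ D, ∀ᵐ ω ∂(P x), coordProc 0 ω = x) : IsNonnegEigenpair P D m lam φ where
  meas := hφ.isBddBorelOn.1
  nonneg x hx := (hφ.pos x hx).le
  lam_nonneg := hφ.lam_pos.le
  eigen t x hx := by
    rcases eq_or_ne t 0 with rfl | ht
    · obtain ⟨h1, h2⟩ := killedSemigroup_zero hD hx (hinit x hx) φ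
      exact ⟨h1, by rw [h2]; simp⟩
    · have ht' := pos_iff_ne_zero.2 ht
      refine ⟨hp.integrable_killedValue hD hmD hφ.measure_ne_zero' hx ht' hφ.isBddBorelOn, ?_⟩
      rw [hp.killedSemigroup_eq hD hmD hx ht' hφ.isBddBorelOn]
      exact hφ.eigen t (NNReal.coe_pos.2 ht') x hx
  nontrivial := by
    rw [Measure.restrict_eq_self_of_ae_mem (ae_mem_of_compl_null hmD), pos_iff_ne_zero]
    intro h0
    have h1 : ∫ x, φ x ∂m = 0 := by
      rw [integral_eq_lintegral_of_nonneg_ae, h0, ENNReal.toReal_zero]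
      · filter_upwards [ae_mem_of_compl_null hmD] with x hx using (hφ.pos x hx).le
      · exact aestronglyMeasurable_of_continuousOn hD hmD hφ.cont
    rw [hφ.normalized] at h1
    exact one_ne_zero h1

theorem IsLowerRate.lintegral_ne_zero {h : ℝ → ℝ} (hh : IsLowerRate D p φ φ' h) (α : ℝ) :
    ∫⁻ a in Ioi (0 : ℝ), ENNReal.ofReal (h a * Real.exp (-(α * a))) ≠ 0 := by
  have hm : AEMeasurable (fun a => ENNReal.ofReal (h a * Real.exp (-(α * a))))
      (volume.restrict (Ioi (0 : ℝ))) :=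
    ((hh.cont.mul (by fun_prop)).aemeasurable measurableSet_Ioi).ennreal_ofReal
  intro h0
  rw [lintegral_eq_zero_iff' hm] at h0
  have h1 := (ae_restrict_iff' measurableSet_Ioi).1 h0
  have h2 : volume (Ioi (0 : ℝ)) = 0 := by
    refine measure_mono_null (fun a ha => ?_) h1
    simp only [mem_compl_iff, mem_ofPred_eq, Classical.not_imp]
    refine ⟨ha, ?_⟩
    simp only [Pi.zero_apply, ENNReal.ofReal_eq_zero, not_le]
    exact mul_pos (hh.pos a ha) (Real.exp_pos _)
  simp at h2

theorem IsPrincipalTriple.absolutelyContinuous_minorizingMeasure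
    {m : Measure (Euc d)} (hφ : IsPrincipalTriple D m p lam φ φ') (hD : IsOpen D)
    (hmD : m Dᶜ = 0) {h : ℝ → ℝ} (hh : IsLowerRate D p φ φ' h) (α : ℝ) :
    m ≪ minorizingMeasure m φ' h α := by
  refine Measure.AbsolutelyContinuous.mk fun s hs hs0 => ?_
  rw [minorizingMeasure, Measure.smul_apply, smul_eq_mul, mul_eq_zero,
    or_iff_right (hh.lintegral_ne_zero α), withDensity_apply _ hs, lintegral_eq_zero_iff'] at hs0
  · have h1 := (ae_restrict_iff' hs).1 hs0
    rw [measure_eq_zero_iff_ae_notMem]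
    filter_upwards [h1, ae_mem_of_compl_null hmD] with y hy hyD hys
    have := hy hys
    simp only [Pi.zero_apply, ENNReal.ofReal_eq_zero] at this
    exact absurd this (not_le.2 (hφ.pos' y hyD))
  · exact (aestronglyMeasurable_of_continuousOn hD hmD
      hφ.cont').aemeasurable.ennreal_ofReal.restrict

/-- The density bound integrates to the minorization `P^D_t f ≥ h(t) φ ∫ f φ' dm`. -/
theorem IsLowerRate.mul_integral_le {h : ℝ → ℝ} (hh : IsLowerRate D p φ φ' h)
    (hp : IsTransitionDensity P D m p) (hφ : IsPrincipalTriple D m p lam φ φ') (hD : IsOpen D)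
    (hmD : m Dᶜ = 0) {t : ℝ} (ht : 0 < t) {f : Euc d → ℝ} (hf : IsBddBorelOn D f)
    (hf0 : ∀ᵐ y ∂m, 0 ≤ f y) {x : Euc d} (hx : x ∈ D) :
    h t * φ x * ∫ y, φ' y * f y ∂m ≤ ∫ y, p t x y * f y ∂m := by
  obtain ⟨C, hC⟩ := hf.2
  obtain ⟨B, hB⟩ := hφ.isBddBorelOn'.2
  have hfm : AEStronglyMeasurable f m :=
    (measurable_indicator_of_domRestrict hD.measurableSet hf.1).aestronglyMeasurable.congr
      (indicator_ae_eq_of_compl_null hmD f)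
  rw [← integral_const_mul]
  refine integral_mono_ae (Integrable.const_mul ?_ _)
    ((hp.kernel ht).integrable_mul hD hmD hx hfm hC) ?_
  · refine Integrable.of_bound ((aestronglyMeasurable_of_continuousOn hD hmD hφ.cont').mul hfm)
      (B * C) ?_
    filter_upwards [ae_mem_of_compl_null hmD] with y hy
    rw [norm_mul]
    exact mul_le_mul (hB y hy) (hC y hy) (norm_nonneg _) ((abs_nonneg _).trans (hB y hy))
  · filter_upwards [ae_mem_of_compl_null hmD, hf0] with y hy hy0
    calc h t * φ x * (φ' y * f y) = (h t * φ x * φ' y) * f y := by ring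
      _ ≤ p t x y * f y := mul_le_mul_of_nonneg_right (hh.le t ht x hx y hy) hy0

theorem IsPrincipalTriple.minorizationByEigenfunction [IsMarkovKernel P]
    (hp : IsTransitionDensity P D m p)
    (hφ : IsPrincipalTriple D m p lam φ φ') (hD : IsOpen D) (hmD : m Dᶜ = 0)
    (hinit : ∀ x ∈ D, ∀ᵐ ω ∂(P x), coordProc 0 ω = x) {h : ℝ → ℝ}
    (hh : IsLowerRate D p φ φ' h) (α : ℝ) :
    MinorizationByEigenfunction P D m lam φ α (minorizingMeasure m φ' h α) where
  eig := hφ.isNonnegEigenpair hp hD hmD hinit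
  onD := by
    rw [minorizingMeasure, Measure.smul_apply, withDensity_absolutelyContinuous m _ hmD, smul_zero]
  nontrivial h0 := by
    have := hφ.absolutelyContinuous_minorizingMeasure hD hmD hh α
    rw [h0] at this
    exact hφ.measure_ne_zero' (Measure.absolutelyContinuous_zero_iff.1 this)
  minor f hf hf0 x hx := by
    have hf0' : ∀ᵐ y ∂m, 0 ≤ f y := by
      filter_upwards [ae_mem_of_compl_null hmD] with y hy using hf0 y hy
    have hfi : AEMeasurable f m :=
      (measurable_indicator_of_domRestrict hD.measurableSet hf.1).aemeasurable.congr
        (indicator_ae_eq_of_compl_null hmD f)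
    have hφm : AEMeasurable φ' m := (aestronglyMeasurable_of_continuousOn hD hmD
      hφ.cont').aemeasurable
    obtain ⟨C, hC⟩ := hf.2
    obtain ⟨B, hB⟩ := hφ.isBddBorelOn'.2
    have e1 : ∫⁻ y in D, ENNReal.ofReal (f y) ∂(minorizingMeasure m φ' h α) =
        (∫⁻ a in Ioi (0 : ℝ), ENNReal.ofReal (h a * Real.exp (-(α * a)))) *
          ENNReal.ofReal (∫ y, φ' y * f y ∂m) := by
      rw [minorizingMeasure, Measure.restrict_smul, lintegral_smul_measure, smul_eq_mul,
        restrict_withDensity hD.measurableSet,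
        Measure.restrict_eq_self_of_ae_mem (ae_mem_of_compl_null hmD),
        lintegral_withDensity_eq_lintegral_mul₀ hφm.ennreal_ofReal hfi.ennreal_ofReal,
        ofReal_integral_eq_lintegral_ofReal]
      · congr 1
        refine lintegral_congr_ae ?_
        filter_upwards [ae_mem_of_compl_null hmD] with y hy
        rw [Pi.mul_apply, ENNReal.ofReal_mul (hφ.pos' y hy).le]
      · refine Integrable.of_bound (hφm.mul hfi).aestronglyMeasurable (B * C) ?_
        filter_upwards [ae_mem_of_compl_null hmD] with y hy
        rw [norm_mul]
        exact mul_le_mul (hB y hy) (hC y hy) (norm_nonneg _) ((abs_nonneg _).trans (hB y hy))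
      · filter_upwards [ae_mem_of_compl_null hmD, hf0'] with y hy hy0
        exact mul_nonneg (hφ.pos' y hy).le hy0
    have hm : AEMeasurable (fun a => ENNReal.ofReal (h a * Real.exp (-(α * a))))
        (volume.restrict (Ioi (0 : ℝ))) :=
      ((hh.cont.mul (by fun_prop)).aemeasurable measurableSet_Ioi).ennreal_ofReal
    rw [e1, ← lintegral_mul_const'' _ hm, ← lintegral_const_mul'' _ (hm.mul_const _)]
    refine setLIntegral_mono_ae' measurableSet_Ioi (Eventually.of_forall fun t ht => ?_)
    have ht' : 0 < t.toNNReal := Real.toNNReal_pos.2 ht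
    have h1 := hh.mul_integral_le hp hφ hD hmD ht hf hf0' hx
    rw [hp.killedSemigroup_eq hD hmD hx ht' hf, Real.coe_toNNReal t (le_of_lt ht),
      ← ENNReal.ofReal_mul (mul_nonneg (hh.pos t ht).le (Real.exp_pos _).le),
      ← ENNReal.ofReal_mul (hφ.pos x hx).le]
    refine ENNReal.ofReal_le_ofReal ?_
    calc φ x * (h t * Real.exp (-(α * t)) * ∫ y, φ' y * f y ∂m)
        = Real.exp (-(α * t)) * (h t * φ x * ∫ y, φ' y * f y ∂m) := by ring
      _ ≤ _ := by gcongr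

end Semigroup

/-! ### The process stopped at the exit time -/

section Hopf

variable {d : ℕ} {D : Set (Euc d)} {P : Kernel (Euc d) (CadlagPath d)} {c : Euc d → ℝ} {C : ℝ}

theorem coe_exitMin (t : ℝ≥0) (ω : CadlagPath d) :
    (exitMin D t ω : ℝ≥0∞) = min (exitTime D ω) t :=
  ENNReal.coe_toNNReal (ne_top_of_le_ne_top ENNReal.coe_ne_top (min_le_right _ _))

theorem exitMin_le (t : ℝ≥0) (ω : CadlagPath d) : exitMin D t ω ≤ t := by
  rw [← ENNReal.coe_le_coe, coe_exitMin]; exact min_le_right _ _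

theorem exitMin_eq_of_lt {t : ℝ≥0} {ω : CadlagPath d} (h : (t : ℝ≥0∞) < exitTime D ω) :
    exitMin D t ω = t := by
  rw [← ENNReal.coe_inj, coe_exitMin, min_eq_right h.le]

theorem coordProc_mem_of_lt_exitMin {t r : ℝ≥0} {ω : CadlagPath d} (hr : 0 < r)
    (h : r < exitMin D t ω) : coordProc r ω ∈ D := by
  refine coordProc_mem_of_lt_exitTime hr ?_
  rw [← ENNReal.coe_lt_coe, coe_exitMin] at h
  exact h.trans_le (min_le_left _ _)

/-- The additive functional `∫_0^{τ_D ∧ t} c(X_r) dr`. -/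
def exitFunctional (D : Set (Euc d)) (c : Euc d → ℝ) (t : ℝ≥0) (ω : CadlagPath d) : ℝ :=
  ∫ r in (0 : ℝ)..exitMin D t ω, c (coordProc r.toNNReal ω)

theorem expWeight_exitMin (t : ℝ≥0) (ω : CadlagPath d) :
    expWeight c (exitMin D t ω) ω = Real.exp (-exitFunctional D c t ω) := rfl

theorem measurable_comp_coordProc (hD : IsOpen D) (hc : Measurable (D.domRestrict c)) :
    Measurable fun z : ℝ × CadlagPath d => D.indicator c (coordProc z.1.toNNReal z.2) :=
  (measurable_indicator_of_domRestrict hD.measurableSet hc).comp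
    (measurable_uncurry_coordProc.comp
      ((measurable_real_toNNReal.comp measurable_fst).prodMk measurable_snd))

/-- Only the values of `c` on `D` matter. -/
theorem exitFunctional_eq (t : ℝ≥0) (ω : CadlagPath d) :
    exitFunctional D c t ω =
      ∫ r in Ioc (0 : ℝ) t, {r : ℝ | r ≤ exitMin D t ω}.indicator
        (fun r => D.indicator c (coordProc r.toNNReal ω)) r := by
  rw [exitFunctional, intervalIntegral.integral_of_le (NNReal.coe_nonneg _),
    setIntegral_indicator
      (show MeasurableSet {r : ℝ | r ≤ exitMin D t ω} from measurableSet_Iic)]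
  have hset : Ioc (0 : ℝ) t ∩ {r | r ≤ exitMin D t ω} = Ioc (0 : ℝ) (exitMin D t ω) := by
    ext r
    simp only [mem_inter_iff, mem_Ioc, mem_ofPred_eq]
    exact ⟨fun h => ⟨h.1.1, h.2⟩, fun h => ⟨⟨h.1, h.2.trans (NNReal.coe_le_coe.2
      (exitMin_le t ω))⟩, h.2⟩⟩
  rw [hset, integral_Ioc_eq_integral_Ioo, integral_Ioc_eq_integral_Ioo]
  refine setIntegral_congr_fun measurableSet_Ioo fun r hr => ?_
  have h0 : 0 < r.toNNReal := Real.toNNReal_pos.2 hr.1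
  have h1 : r.toNNReal < exitMin D t ω := by
    rw [← NNReal.coe_lt_coe, Real.coe_toNNReal r hr.1.le]; exact hr.2
  exact (indicator_of_mem (coordProc_mem_of_lt_exitMin h0 h1) c).symm

theorem exitFunctional_nonneg (hc0 : ∀ x ∈ D, 0 ≤ c x) (t : ℝ≥0) (ω : CadlagPath d) :
    0 ≤ exitFunctional D c t ω := by
  rw [exitFunctional_eq]
  exact integral_nonneg fun r => indicator_nonneg (fun _ _ => indicator_nonneg hc0 _) _

theorem exitFunctional_le (hc0 : ∀ x ∈ D, 0 ≤ c x) (hC0 : 0 ≤ C) (hcC : ∀ x ∈ D, c x ≤ C)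
    (t : ℝ≥0) (ω : CadlagPath d) : exitFunctional D c t ω ≤ C * t := by
  rw [exitFunctional_eq]
  refine (Real.le_norm_self _).trans ((norm_setIntegral_le_of_norm_le_const (C := C)
    (by simp) fun r _ => ?_).trans (le_of_eq (by simp)))
  refine (norm_indicator_le_norm_self _ _).trans ?_
  rw [Real.norm_of_nonneg (indicator_nonneg hc0 _)]
  exact indicator_apply_le' (hcC _) fun _ => hC0

section Measurability

variable {μ : Measure (CadlagPath d)}

theorem aemeasurable_exitMin (hτ : AEMeasurable (exitTime D) μ) (t : ℝ≥0) :
    AEMeasurable (exitMin D t) μ :=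
  (hτ.min aemeasurable_const).ennreal_toNNReal

theorem aemeasurable_coordProc_exitMin (hτ : AEMeasurable (exitTime D) μ) (t : ℝ≥0) :
    AEMeasurable (fun ω => coordProc (exitMin D t ω) ω) μ :=
  measurable_uncurry_coordProc.comp_aemeasurable
    ((aemeasurable_exitMin hτ t).prodMk aemeasurable_id)

theorem measurable_functional (hD : IsOpen D) (hc : Measurable (D.domRestrict c)) :
    Measurable fun w : (ℝ≥0 × CadlagPath d) × ℝ =>
      {w : (ℝ≥0 × CadlagPath d) × ℝ | w.2 ≤ w.1.1}.indicator
      (fun w => D.indicator c (coordProc w.2.toNNReal w.1.2)) w :=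
  ((measurable_comp_coordProc hD hc).comp
    (measurable_snd.prodMk (measurable_snd.comp measurable_fst))).indicator
    (measurableSet_le measurable_snd (measurable_fst.comp measurable_fst).coe_nnreal_real)

theorem aemeasurable_exitFunctional (hD : IsOpen D) (hc : Measurable (D.domRestrict c))
    (hτ : AEMeasurable (exitTime D) μ) (t : ℝ≥0) : AEMeasurable (exitFunctional D c t) μ := by
  have h1 := (measurable_functional hD hc).stronglyMeasurable.integral_prod_right'
    (ν := volume.restrict (Ioc (0 : ℝ) t))
  refine (h1.measurable.comp_aemeasurable
    ((aemeasurable_exitMin hτ t).prodMk aemeasurable_id)).congr (Eventually.of_forall fun ω => ?_)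
  rw [exitFunctional_eq]
  rfl

end Measurability

variable {N : Kernel (Euc d) (Euc d)}

theorem ae_coordProc_exitMin_mem {μ : Measure (CadlagPath d)} {t : ℝ≥0} (ht : 0 < t)
    (hexit : ∀ᵐ ω ∂μ, ∀ s : ℝ≥0, exitTime D ω = s → coordProc s ω ∈ extDomain N D) :
    ∀ᵐ ω ∂μ, coordProc (exitMin D t ω) ω ∈ extDomain N D := by
  filter_upwards [hexit] with ω hω
  rcases lt_or_ge (t : ℝ≥0∞) (exitTime D ω) with h | h
  · rw [exitMin_eq_of_lt h]
    exact Or.inr (coordProc_mem_of_lt_exitTime ht h)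
  · exact hω _ (by rw [coe_exitMin, min_eq_left h])

/-! ### Lower bounds for weak subsolutions -/

/-- The supremum of `u` over `D_S` exceeds `u(x)` by at least the expectation of any random variable
below `ū - e_c(τ_D ∧ t) u(X_{τ_D ∧ t})`. -/
theorem IsWeakSubsolution.integral_le_sub [IsMarkovKernel P] {g u : Euc d → ℝ}
    (hu : IsWeakSubsolution P D c g u) (hD : IsOpen D) (hc : IsKillingRate D c) {x : Euc d}
    (hx : x ∈ D) (hτ : AEMeasurable (exitTime D) (P x)) (t : ℝ≥0) (K : ℝ) {V : CadlagPath d → ℝ}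
    (hV : Integrable V (P x))
    (hVle : ∀ᵐ ω ∂(P x), V ω ≤ K - Real.exp (-exitFunctional D c t ω) *
      u (coordProc (exitMin D t ω) ω)) : ∫ ω, V ω ∂(P x) ≤ K - u x := by
  obtain ⟨hum, ⟨B, hB⟩, hsub⟩ := hu
  have hint : Integrable (fun ω => Real.exp (-exitFunctional D c t ω) *
      u (coordProc (exitMin D t ω) ω)) (P x) := by
    refine Integrable.of_bound (C := B) (AEMeasurable.aestronglyMeasurable ?_)
      (Eventually.of_forall fun ω => ?_)
    · exact (Real.measurable_exp.comp_aemeasurable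
        (aemeasurable_exitFunctional hD hc.1.1 hτ t).neg).mul
        (hum.comp_aemeasurable (aemeasurable_coordProc_exitMin hτ t))
    · rw [norm_mul, Real.norm_of_nonneg (Real.exp_pos _).le]
      have h1 : Real.exp (-exitFunctional D c t ω) ≤ 1 :=
        Real.exp_le_one_iff.2 (neg_nonpos.2 (exitFunctional_nonneg hc.2 t ω))
      calc _ ≤ 1 * B := mul_le_mul h1 (hB _) (abs_nonneg _) zero_le_one
        _ = B := one_mul B
  have h1 := (hsub x hx t).2
  have h2 : ∫ ω, V ω ∂(P x) ≤ ∫ ω, (K - Real.exp (-exitFunctional D c t ω) *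
      u (coordProc (exitMin D t ω) ω)) ∂(P x) :=
    integral_mono_ae hV ((integrable_const K).sub hint) hVle
  rw [integral_sub (integrable_const K) hint] at h2
  simp only [integral_const, probReal_univ, one_smul] at h2
  have h3 : (0 : ℝ) ≤ (sourceCost P D c g t x).toReal := ENNReal.toReal_nonneg
  simp only [expWeight_exitMin] at h1
  linarith

theorem IsWeakSubsolution.le_sSup {g u : Euc d → ℝ} (hu : IsWeakSubsolution P D c g u)
    {y : Euc d} (hy : y ∈ extDomain N D) : u y ≤ sSup (u '' extDomain N D) := by
  obtain ⟨-, ⟨B, hB⟩, -⟩ := hu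
  refine _root_.le_csSup ⟨B, ?_⟩ (mem_image_of_mem u hy)
  rintro _ ⟨z, -, rfl⟩
  exact (abs_le.1 (hB z)).2

variable {m : Measure (Euc d)} [IsFiniteMeasure m] {p : ℝ → Euc d → Euc d → ℝ} {lam : ℝ}
  {φ φ' : Euc d → ℝ}

/-- A non-negative function that does not vanish almost everywhere has a positive integral against
the dual eigenfunction. -/
theorem IsPrincipalTriple.integral_mul_pos (hφ : IsPrincipalTriple D m p lam φ φ') (hD : IsOpen D)
    (hmD : m Dᶜ = 0) {f : Euc d → ℝ} (hf : IsBddBorelOn D f) (hf0 : ∀ᵐ y ∂m, 0 ≤ f y)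
    (hne : ¬ ∀ᵐ y ∂m, f y = 0) : 0 < ∫ y, φ' y * f y ∂m := by
  obtain ⟨A, hA⟩ := hf.2
  obtain ⟨B, hB⟩ := hφ.isBddBorelOn'.2
  have hfm : AEStronglyMeasurable f m :=
    (measurable_indicator_of_domRestrict hD.measurableSet hf.1).aestronglyMeasurable.congr
      (indicator_ae_eq_of_compl_null hmD f)
  have hint : Integrable (fun y => φ' y * f y) m := by
    refine Integrable.of_bound ((aestronglyMeasurable_of_continuousOn hD hmD hφ.cont').mul hfm)
      (B * A) ?_
    filter_upwards [ae_mem_of_compl_null hmD] with y hy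
    rw [norm_mul]
    exact mul_le_mul (hB y hy) (hA y hy) (norm_nonneg _) ((abs_nonneg _).trans (hB y hy))
  have h0 : 0 ≤ᵐ[m] fun y => φ' y * f y := by
    filter_upwards [ae_mem_of_compl_null hmD, hf0] with y hy hy0
    exact mul_nonneg (hφ.pos' y hy).le hy0
  refine lt_of_le_of_ne (integral_nonneg_of_ae h0) fun h => hne ?_
  filter_upwards [(integral_eq_zero_iff_of_nonneg_ae h0 hint).1 h.symm, ae_mem_of_compl_null hmD]
    with y hy hyD
  exact (mul_eq_zero.1 hy).resolve_left (hφ.pos' y hyD).ne'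

/-- The **Hopf lemma** with respect to the principal eigenfunction: `ū - u` dominates the killed
semigroup at time one applied to itself, up to the factor `e^{-‖c‖}`. -/
theorem IsWeakSubsolution.hopf [IsMarkovKernel P] (hp : IsTransitionDensity P D m p)
    (hφ : IsPrincipalTriple D m p lam φ φ') (hD : IsOpen D) (hmD : m Dᶜ = 0)
    (hinit : ∀ x ∈ D, ∀ᵐ ω ∂(P x), coordProc 0 ω = x)
    (hexit : ∀ x ∈ D, ∀ᵐ ω ∂(P x), ∀ s : ℝ≥0, exitTime D ω = s → coordProc s ω ∈ extDomain N D)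
    {h : ℝ → ℝ} (hh : IsLowerRate D p φ φ' h) (hc : IsKillingRate D c) {g u : Euc d → ℝ}
    (hu : IsWeakSubsolution P D c g u) (hM : 0 ≤ sSup (u '' extDomain N D))
    (hne : ¬ ∃ k : ℝ, ∀ᵐ x ∂m, u x = k) :
    ∃ a : ℝ, 0 < a ∧ ∀ x ∈ D, a * φ x ≤ sSup (u '' extDomain N D) - u x := by
  set M := sSup (u '' extDomain N D) with hMdef
  obtain ⟨C, hC⟩ := hc.1.2
  have hm := hφ.measure_ne_zero'
  obtain ⟨B, hB⟩ := hu.2.1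
  set w : Euc d → ℝ := fun y => M - u y with hw
  have hwb : IsBddBorelOn D w := by
    refine ⟨(measurable_const.sub hu.1).comp measurable_subtype_coe, M + B, fun y _ => ?_⟩
    have := abs_le.1 (hB y)
    rw [abs_le]
    constructor <;> simp only [hw] <;> linarith
  have hw0 : ∀ᵐ y ∂m, 0 ≤ w y := by
    filter_upwards [ae_mem_of_compl_null hmD] with y hy
    exact sub_nonneg.2 (hu.le_sSup (Or.inr hy))
  have hpos : 0 < ∫ y, φ' y * w y ∂m := hφ.integral_mul_pos hD hmD hwb hw0 fun h0 =>
    hne ⟨M, h0.mono fun y hy => (sub_eq_zero.1 hy).symm⟩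
  refine ⟨Real.exp (-|C|) * (h 1 * ∫ y, φ' y * w y ∂m),
    mul_pos (Real.exp_pos _) (mul_pos (hh.pos 1 one_pos) hpos), fun x hx => ?_⟩
  have hτ := hp.aemeasurable_exitTime hD hmD hm hx (hinit x hx)
  have hkv := hp.integrable_killedValue hD hmD hm hx one_pos hwb
  have key := hu.integral_le_sub hD hc hx hτ 1 M (hkv.const_mul (Real.exp (-|C|))) ?_
  · rw [integral_const_mul, ← killedSemigroup, hp.killedSemigroup_eq hD hmD hx one_pos hwb] at key
    refine le_trans ?_ key
    have h1 := hh.mul_integral_le hp hφ hD hmD one_pos hwb hw0 hx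
    rw [NNReal.coe_one]
    calc _ = Real.exp (-|C|) * (h 1 * φ x * ∫ y, φ' y * w y ∂m) := by ring
      _ ≤ _ := by gcongr
  · filter_upwards [ae_coordProc_exitMin_mem one_pos (hexit x hx)] with ω hω
    set I := exitFunctional D c 1 ω with hI
    have hI0 : 0 ≤ I := exitFunctional_nonneg hc.2 1 ω
    have hI1 : I ≤ |C| := by
      have := exitFunctional_le hc.2 (abs_nonneg C)
        (fun y hy => (le_abs_self _).trans ((hC y hy).trans (le_abs_self _))) 1 ω
      simpa using this
    have he1 : Real.exp (-I) ≤ 1 := Real.exp_le_one_iff.2 (neg_nonpos.2 hI0)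
    have huM := hu.le_sSup hω
    -- `M - e u = M (1 - e) + e (M - u)`, and both terms are non-negative
    have hdec : Real.exp (-I) * (M - u (coordProc (exitMin D 1 ω) ω)) ≤
        M - Real.exp (-I) * u (coordProc (exitMin D 1 ω) ω) := by
      have := mul_nonneg hM (sub_nonneg.2 he1)
      linarith
    refine le_trans ?_ hdec
    by_cases hlt : ((1 : ℝ≥0) : ℝ≥0∞) < exitTime D ω
    · rw [killedValue, indicator_of_mem (by exact hlt), exitMin_eq_of_lt hlt]
      rw [exitMin_eq_of_lt hlt] at huM
      exact mul_le_mul_of_nonneg_right (Real.exp_le_exp.2 (neg_le_neg hI1)) (sub_nonneg.2 huM)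
    · rw [killedValue, indicator_of_notMem (by exact hlt), mul_zero]
      exact mul_nonneg (Real.exp_pos _).le (sub_nonneg.2 huM)

/-- The expected killing up to time one is at least a multiple of the principal eigenfunction. -/
theorem IsLowerRate.exists_le_integral_exitFunctional [IsMarkovKernel P]
    (hp : IsTransitionDensity P D m p)
    (hφ : IsPrincipalTriple D m p lam φ φ') (hD : IsOpen D) (hmD : m Dᶜ = 0)
    (hinit : ∀ x ∈ D, ∀ᵐ ω ∂(P x), coordProc 0 ω = x)
    {h : ℝ → ℝ} (hh : IsLowerRate D p φ φ' h) (hc : IsKillingRate D c)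
    (hne : ¬ ∀ᵐ y ∂m, c y = 0) :
    ∃ a : ℝ, 0 < a ∧ ∀ x ∈ D, Integrable (exitFunctional D c 1) (P x) ∧
      a * φ x ≤ ∫ ω, exitFunctional D c 1 ω ∂(P x) := by
  have hm := hφ.measure_ne_zero'
  obtain ⟨C, hC⟩ := hc.1.2
  have hcC : ∀ y ∈ D, c y ≤ |C| := fun y hy => (le_abs_self _).trans ((hC y hy).trans (le_abs_self _))
  have hc0 : ∀ᵐ y ∂m, 0 ≤ c y := by
    filter_upwards [ae_mem_of_compl_null hmD] with y hy using hc.2 y hy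
  have hpos : 0 < ∫ y, φ' y * c y ∂m := hφ.integral_mul_pos hD hmD hc.1 hc0 hne
  -- a positive lower bound for the rate on a time interval of length `1 / 2`
  obtain ⟨r₀, hr₀, hmin⟩ := isCompact_Icc.exists_isMinOn
    (nonempty_Icc.2 (show (1 / 2 : ℝ) ≤ 1 by norm_num))
    (hh.cont.mono fun r hr => mem_Ioi.2 (lt_of_lt_of_le (by norm_num) hr.1))
  have hη : 0 < h r₀ := hh.pos r₀ (lt_of_lt_of_le (by norm_num) hr₀.1)
  refine ⟨1 / 2 * (h r₀ * ∫ y, φ' y * c y ∂m), by positivity, fun x hx => ?_⟩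
  have hτ := hp.aemeasurable_exitTime hD hmD hm hx (hinit x hx)
  have hIm := aemeasurable_exitFunctional hD hc.1.1 hτ 1
  have hInt : Integrable (exitFunctional D c 1) (P x) := by
    refine Integrable.of_bound hIm.aestronglyMeasurable |C| (Eventually.of_forall fun ω => ?_)
    rw [Real.norm_of_nonneg (exitFunctional_nonneg hc.2 1 ω)]
    simpa using exitFunctional_le hc.2 (abs_nonneg C) hcC 1 ω
  refine ⟨hInt, ?_⟩
  -- Fubini, for a measurable version `ε` of the stopped exit time
  have hε := aemeasurable_exitMin (D := D) hτ 1
  set ε := hε.mk (exitMin D 1) with hεdef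
  have hεm : Measurable ε := hε.measurable_mk
  have hεeq : exitMin D 1 =ᵐ[P x] ε := hε.ae_eq_mk
  set F : CadlagPath d × ℝ → ℝ := fun w => {w : (ℝ≥0 × CadlagPath d) × ℝ | w.2 ≤ w.1.1}.indicator
      (fun w => D.indicator c (coordProc w.2.toNNReal w.1.2)) ((ε w.1, w.1), w.2) with hF
  have hFm : Measurable F := (measurable_functional hD hc.1.1).comp
    (((hεm.comp measurable_fst).prodMk measurable_fst).prodMk measurable_snd)
  have hF0 : ∀ w, 0 ≤ F w := fun w => indicator_nonneg (fun _ _ => indicator_nonneg hc.2 _) _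
  have hFC : ∀ w, F w ≤ |C| := fun w => indicator_apply_le'
    (fun _ => indicator_apply_le' (hcC _) fun _ => abs_nonneg C) fun _ => abs_nonneg C
  have hFint : Integrable F ((P x).prod (volume.restrict (Ioc (0 : ℝ) (1 : ℝ≥0)))) := by
    refine Integrable.of_bound hFm.aestronglyMeasurable |C| (Eventually.of_forall fun w => ?_)
    rw [Real.norm_of_nonneg (hF0 w)]
    exact hFC w
  have e1 : ∫ ω, exitFunctional D c 1 ω ∂(P x) =
      ∫ ω, (∫ r in Ioc (0 : ℝ) (1 : ℝ≥0), F (ω, r)) ∂(P x) := by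
    refine integral_congr_ae ?_
    filter_upwards [hεeq] with ω hω
    rw [exitFunctional_eq, hω]
    rfl
  rw [e1, integral_integral_swap (f := fun ω r => F (ω, r)) hFint]
  have hsub : Ico (1 / 2 : ℝ) 1 ⊆ Ioc (0 : ℝ) (1 : ℝ≥0) := fun r hr =>
    ⟨lt_of_lt_of_le (by norm_num) hr.1, by simpa using hr.2.le⟩
  have hFint2 : IntegrableOn (fun r => ∫ ω, F (ω, r) ∂(P x)) (Ioc (0 : ℝ) (1 : ℝ≥0)) :=
    hFint.integral_prod_right
  have hlow : ∀ r ∈ Ico (1 / 2 : ℝ) 1,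
      h r₀ * φ x * ∫ y, φ' y * c y ∂m ≤ ∫ ω, F (ω, r) ∂(P x) := by
    intro r hr
    have hr0 : 0 < r := lt_of_lt_of_le (by norm_num) hr.1
    have hr' : 0 < r.toNNReal := Real.toNNReal_pos.2 hr0
    have h1 := hh.mul_integral_le hp hφ hD hmD hr0 hc.1 hc0 hx
    have h2 := hp.killedSemigroup_eq hD hmD hx hr' hc.1
    rw [Real.coe_toNNReal r hr0.le] at h2
    rw [← h2] at h1
    calc h r₀ * φ x * ∫ y, φ' y * c y ∂m ≤ h r * φ x * ∫ y, φ' y * c y ∂m := by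
          have := hφ.pos x hx
          gcongr
          exact hmin ⟨hr.1, hr.2.le⟩
      _ ≤ killedSemigroup P D r.toNNReal c x := h1
      _ ≤ ∫ ω, F (ω, r) ∂(P x) := by
          refine integral_mono_ae (hp.integrable_killedValue hD hmD hm hx hr' hc.1)
            (Integrable.of_bound (hFm.comp (measurable_id.prodMk
              measurable_const)).aestronglyMeasurable |C| (Eventually.of_forall fun ω => ?_)) ?_
          · rw [Real.norm_of_nonneg (hF0 _)]
            exact hFC _
          · filter_upwards [hεeq] with ω hω
            by_cases hlt : (r.toNNReal : ℝ≥0∞) < exitTime D ω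
            · have hle : r ≤ ε ω := by
                rw [← hω, ← Real.coe_toNNReal r hr0.le, NNReal.coe_le_coe, ← ENNReal.coe_le_coe,
                  coe_exitMin]
                refine le_min hlt.le (ENNReal.coe_le_coe.2 ?_)
                rw [Real.toNNReal_le_iff_le_coe]
                simpa using hr.2.le
              rw [killedValue, indicator_of_mem (by exact hlt), hF]
              simp only
              rw [indicator_of_mem (by exact hle),
                indicator_of_mem (coordProc_mem_of_lt_exitTime hr' hlt)]
            · rw [killedValue, indicator_of_notMem (by exact hlt)]
              exact hF0 _
  calc 1 / 2 * (h r₀ * ∫ y, φ' y * c y ∂m) * φ x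
      = ∫ _r in Ico (1 / 2 : ℝ) 1, h r₀ * φ x * ∫ y, φ' y * c y ∂m := by
        rw [setIntegral_const]
        simp only [Measure.real, Real.volume_Ico, smul_eq_mul]
        rw [ENNReal.toReal_ofReal (by norm_num)]
        ring
    _ ≤ ∫ r in Ico (1 / 2 : ℝ) 1, (∫ ω, F (ω, r) ∂(P x)) :=
        setIntegral_mono_on (integrable_const _) (hFint2.mono_set hsub) measurableSet_Ico hlow
    _ ≤ ∫ r in Ioc (0 : ℝ) (1 : ℝ≥0), (∫ ω, F (ω, r) ∂(P x)) :=
        setIntegral_mono_set hFint2 (Eventually.of_forall fun r => integral_nonneg fun ω => hF0 _)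
          (LE.le.eventuallyLE hsub)

/-- The **quantitative Hopf lemma**: with killing, `ū - u` exceeds `ū` times the probability of
being killed before time one. -/
theorem exists_quantitative_hopf [IsMarkovKernel P] (hp : IsTransitionDensity P D m p)
    (hφ : IsPrincipalTriple D m p lam φ φ') (hD : IsOpen D) (hmD : m Dᶜ = 0)
    (hinit : ∀ x ∈ D, ∀ᵐ ω ∂(P x), coordProc 0 ω = x)
    (hexit : ∀ x ∈ D, ∀ᵐ ω ∂(P x), ∀ s : ℝ≥0, exitTime D ω = s → coordProc s ω ∈ extDomain N D)
    {h : ℝ → ℝ} (hh : IsLowerRate D p φ φ' h) (hc : IsKillingRate D c)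
    (hne : ¬ ∀ᵐ y ∂m, c y = 0) :
    ∃ a : ℝ, 0 < a ∧ ∀ g u : Euc d → ℝ, IsWeakSubsolution P D c g u →
      ∀ x ∈ D, a * sSup (u '' extDomain N D) * φ x ≤ sSup (u '' extDomain N D) - u x := by
  obtain ⟨a, ha, H⟩ := hh.exists_le_integral_exitFunctional hp hφ hD hmD hinit hc hne
  obtain ⟨C, hC⟩ := hc.1.2
  refine ⟨Real.exp (-|C|) * a, by positivity, fun g u hu x hx => ?_⟩
  set M := sSup (u '' extDomain N D) with hMdef
  have hφx := hφ.pos x hx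
  rcases lt_or_ge M 0 with hM | hM
  · have h1 : u x ≤ M := hu.le_sSup (Or.inr hx)
    have h2 : Real.exp (-|C|) * a * M * φ x ≤ 0 :=
      mul_nonpos_of_nonpos_of_nonneg (mul_nonpos_of_nonneg_of_nonpos (by positivity) hM.le) hφx.le
    linarith
  · obtain ⟨hInt, hle⟩ := H x hx
    have hτ := hp.aemeasurable_exitTime hD hmD hφ.measure_ne_zero' hx (hinit x hx)
    have key := hu.integral_le_sub hD hc hx hτ 1 M (hInt.const_mul (M * Real.exp (-|C|))) ?_
    · rw [integral_const_mul] at key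
      refine le_trans ?_ key
      calc Real.exp (-|C|) * a * M * φ x = M * Real.exp (-|C|) * (a * φ x) := by ring
        _ ≤ _ := by gcongr
    · filter_upwards [ae_coordProc_exitMin_mem one_pos (hexit x hx)] with ω hω
      set I := exitFunctional D c 1 ω with hI
      have hI0 : 0 ≤ I := exitFunctional_nonneg hc.2 1 ω
      have hI1 : I ≤ |C| := by
        have := exitFunctional_le hc.2 (abs_nonneg C)
          (fun y hy => (le_abs_self _).trans ((hC y hy).trans (le_abs_self _))) 1 ω
        simpa using this
      have huM := mul_le_mul_of_nonneg_left (hu.le_sSup hω) (Real.exp_pos (-I)).le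
      -- `1 - e^{-I} ≥ I e^{-I}` because `e^I ≥ 1 + I`
      have h1 : Real.exp (-|C|) * I ≤ 1 - Real.exp (-I) := by
        have h2 : Real.exp (-|C|) * I ≤ Real.exp (-I) * I := by gcongr
        have h3 : Real.exp (-I) * (I + 1) ≤ Real.exp (-I) * Real.exp I := by
          gcongr; exact Real.add_one_le_exp I
        rw [← Real.exp_add, neg_add_cancel, Real.exp_zero] at h3
        linarith
      have h4 := mul_le_mul_of_nonneg_left h1 hM
      linarith

end Hopf

end

theorem corollary5p2 {d : ℕ}
    (Q : Euc d → Matrix (Fin d) (Fin d) ℝ) (b : Euc d → Euc d) (N : Kernel (Euc d) (Euc d))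
    (D : Set (Euc d)) (hDo : IsOpen D) (hDc : IsConnected D)
    (hQb : DiffusionDriftCondition D Q b) (hN : LevyKernelCondition N)
    (P : Kernel (Euc d) (CadlagPath d)) (hP : IsStrongMarkovSolution Q b N P)
    (hET : ExitTimeFinite P D)
    (m : Measure (Euc d)) (hmfin : IsFiniteMeasure m) (hmD : m Dᶜ = 0)
    (p : ℝ → Euc d → Euc d → ℝ) (hp : IsTransitionDensity P D m p)
    (lam : ℝ) (φ φ' : Euc d → ℝ) (hφ : IsPrincipalTriple D m p lam φ φ')
    (hIU : IntrinsicallyUltracontractive D p φ φ') :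
    -- the minorization condition holds for every `α > 0`, with the explicit measure
    (∃ h : ℝ → ℝ, IsLowerRate D p φ φ' h) ∧
    (∀ h : ℝ → ℝ, IsLowerRate D p φ φ' h → ∀ α : ℝ, 0 < α →
      MinorizationByEigenfunction P D m lam φ α (minorizingMeasure m φ' h α) ∧
      m ≪ minorizingMeasure m φ' h α) ∧
    ∀ c : Euc d → ℝ, IsKillingRate D c →
      -- the Hopf lemma
      (∀ g u : Euc d → ℝ, IsNonposSource D g → IsWeakSubsolution P D c g u →
        0 ≤ sSup (u '' extDomain N D) → (¬ ∃ k : ℝ, ∀ᵐ x ∂(m.restrict D), u x = k) →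
        ∃ a : ℝ, 0 < a ∧ ∀ x ∈ D, a * φ x ≤ sSup (u '' extDomain N D) - u x) ∧
      -- the quantitative Hopf lemma
      (0 < ∫ x in D, c x ∂m →
        ∃ a : ℝ, 0 < a ∧ ∀ g u : Euc d → ℝ, IsNonposSource D g → IsWeakSubsolution P D c g u →
          ∀ x ∈ D, a * sSup (u '' extDomain N D) * φ x ≤ sSup (u '' extDomain N D) - u x) := by
  have : IsMarkovKernel P := ⟨fun x => (hP.solution x).prob⟩
  have hinit : ∀ x ∈ D, ∀ᵐ ω ∂(P x), coordProc 0 ω = x := fun x _ =>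
    (hP.solution x).ae_coordProc_zero
  have hexit : ∀ x ∈ D, ∀ᵐ ω ∂(P x), ∀ s : ℝ≥0, exitTime D ω = s →
      coordProc s ω ∈ extDomain N D := fun x hx =>
    (hP.solution x).ae_exit_mem_extDomain hN hDo hx
  have hfull : ∀ U ⊆ D, IsOpen U → U.Nonempty → m U ≠ 0 := fun U hUD hU hne =>
    hp.measure_ne_zero hDo hmD hφ.measure_ne_zero' hinit hUD hU hne
  have hres : m.restrict D = m := Measure.restrict_eq_self_of_ae_mem (ae_mem_of_compl_null hmD)
  obtain ⟨h, hh⟩ := hIU.exists_isLowerRate hp hφ hDo hDc.nonempty hmD hfull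
  rw [hres]
  refine ⟨⟨h, hh⟩, fun h' hh' α _ => ⟨hφ.minorizationByEigenfunction hp hDo hmD hinit hh' α,
    hφ.absolutelyContinuous_minorizingMeasure hDo hmD hh' α⟩, fun c hc => ⟨?_, fun hcpos => ?_⟩⟩
  · exact fun g u _ hu hM hne => hu.hopf hp hφ hDo hmD hinit hexit hh hc hM hne
  · have hne : ¬ ∀ᵐ y ∂m, c y = 0 := fun h0 => by
      rw [integral_congr_ae h0, integral_zero] at hcpos
      exact lt_irrefl _ hcpos
    obtain ⟨a, ha, H⟩ := exists_quantitative_hopf hp hφ hDo hmD hinit hexit hh hc hne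
    exact ⟨a, ha, fun g u _ hu => H g u hu⟩
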